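/- Let $U:\mathbb R\to\mathbb R$ be a $C^2$ Morse function (i.e. $U'(x)=0\Rightarrow U''(x)\neq 0$) whose local minima are exactly $x_0<x_2$, with a single local maximum $x_1\in(x_0,x_2)$, which is convex on $(-\infty,x_0]$ and on $[x_2,\infty)$, with $U(x)\to\infty$ as $|x|\to\infty$, and assume $U(x_2)<U(x_0)$. For $\varepsilon>0$, let $(X^\varepsilon_s,Y^\varepsilon_s)_{s\ge 0}$ be the velocity jump process on $\mathbb R\times\{\pm1\}$ with generator $$Lf(x,y)=y\,\partial_xf(x,y)+\tfrac1\varepsilon\,(yU'(x))_+\,\bigl(f(x,-y)-f(x,y)\bigr),$$ started at $(X^\varepsilon_0,Y^\varepsilon_0)=(x_0,-1)$; explicitly, with i.i.d. standard exponential variables $(E_i)_{i\ge0}$ and $T_0=0$, for all $i\ge 0$, $$T_{i+1}=\inf\Bigl\{s>T_i:\ \int_{T_i}^s\tfrac1\varepsilon\bigl(Y^\varepsilon_{T_i}U'(X^\varepsilon_{T_i}+Y^\varepsilon_{T_i}(u-T_i))\bigr)_+du\ \ge\ E_i\Bigr\},$$ $X^\varepsilon_s=X^\varepsilon_{T_i}+Y^\varepsilon_{T_i}(s-T_i)$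 for $s\in[T_i,T_{i+1}]$, $Y^\varepsilon_s=Y^\varepsilon_{T_i}$ for $s\in[T_i,T_{i+1})$, and $Y^\varepsilon_{T_{i+1}}=-Y^\varepsilon_{T_i}$. Let $\tau=\inf\{s>0: X^\varepsilon_s=x_1\}$. Then $\mathbb E[\tau]<\infty$ for every $\varepsilon>0$, and for every $t>0$, writing $t_\varepsilon=t\,\mathbb E[\tau]$, $h_{t_\varepsilon}$ for the law of $X^\varepsilon_{t_\varepsilon}$, and $\mu^1_\varepsilon(dx)=e^{-U(x)/\varepsilon}dx\big/\int_{\mathbb R}e^{-U(z)/\varepsilon}dz$ for the first marginal of the Gibbs measure, $$\mathcal W\bigl(h_{t_\varepsilon},\mu^1_\varepsilon\bigr)\ \longrightarrow\ e^{-t}\,|x_2-x_0|\qquad\text{as }\varepsilon\to0^+,$$ where $\mathcal W(\nu_1,\nu_2)=\inf_\pi\mathbb E_\pi\bigl[|Z_1-Z_2|\bigr]$, the infimum being over all probability measures $\pi$ on $\mathbb R^2$ with first marginal $\nu_1$ and second marginal $\nu_2$. -/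

import Mathlib

open MeasureTheory ProbabilityTheory Filter Topology
open scoped ENNReal

/-- `U` is a double-well potential on `ℝ`: a Morse function, convex outside `(x₀, x₂)` and tending
to infinity at infinity, whose local minima are exactly `x₀` and `x₂` and whose only local maximum
`x₁` lies strictly between them. -/
structure IsDoubleWell (U : ℝ → ℝ) (x₀ x₁ x₂ : ℝ) : Prop where
  contDiff : ContDiff ℝ 2 U
  morse : ∀ x, deriv U x = 0 → deriv (deriv U) x ≠ 0
  lt_left : x₀ < x₁
  lt_right : x₁ < x₂
  isLocalMin_iff : ∀ x, IsLocalMin U x ↔ x = x₀ ∨ x = x₂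
  isLocalMax_iff : ∀ x, IsLocalMax U x ↔ x = x₁
  convexOn_left : ConvexOn ℝ (Set.Iic x₀) U
  convexOn_right : ConvexOn ℝ (Set.Ici x₂) U
  tendsto_atTop : Tendsto U (cocompact ℝ) atTop

namespace VelocityJump

noncomputable section

/-- The minimal jump rate `(y U'(x))₊ / ε` at temperature `ε`. -/
def jumpRate (U : ℝ → ℝ) (ε x y : ℝ) : ℝ :=
  max (y * deriv U x) 0 / ε

/-- Time until the next velocity flip, starting from position `x` with velocity `y`, when the
exponential clock has the value `e`: the first `s > 0` at which the rate integrated along the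
straight line `u ↦ x + y u` reaches `e`. (For a potential tending to infinity at `±∞` and
`y = ±1`, the integrated rate is unbounded, so that the set is nonempty.) -/
def waitingTime (U : ℝ → ℝ) (ε x y e : ℝ) : ℝ :=
  sInf {s : ℝ | 0 < s ∧ e ≤ ∫ u in (0 : ℝ)..s, jumpRate U ε (x + y * u) y}

/-- A jump time, with the position at that time and the velocity just after it. -/
structure JumpState where
  time : ℝ
  pos : ℝ
  vel : ℝ

/-- The states `(T_i, X_{T_i}, Y_{T_i})` at the successive jump times, with `T_0 = 0` and
`(X_0, Y_0) = (x, y)`, driven by the sequence of clocks `e`. -/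
def jumpState (U : ℝ → ℝ) (ε x y : ℝ) (e : ℕ → ℝ) : ℕ → JumpState
  | 0 => ⟨0, x, y⟩
  | i + 1 =>
    let S := jumpState U ε x y e i
    let s := waitingTime U ε S.pos S.vel (e i)
    ⟨S.time + s, S.pos + S.vel * s, -S.vel⟩

/-- The number of jumps in `[0, t]`, that is, the largest `n` with `T_n ≤ t`. -/
def numJumps (U : ℝ → ℝ) (ε x y : ℝ) (e : ℕ → ℝ) (t : ℝ) : ℕ :=
  sSup {n : ℕ | (jumpState U ε x y e n).time ≤ t}

/-- The velocity jump process `(X_t, Y_t)` started at `(x, y)`: for `t ∈ [T_i, T_{i+1})`,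
`X_t = X_{T_i} + Y_{T_i} (t - T_i)` and `Y_t = Y_{T_i}`. -/
def process (U : ℝ → ℝ) (ε x y : ℝ) (e : ℕ → ℝ) (t : ℝ) : ℝ × ℝ :=
  let S := jumpState U ε x y e (numJumps U ε x y e t)
  (S.pos + S.vel * (t - S.time), S.vel)

/-- The first hitting time `inf {t > 0 | X_t = z}`, equal to `∞` if `z` is never reached. -/
def hittingTime (U : ℝ → ℝ) (ε x y : ℝ) (e : ℕ → ℝ) (z : ℝ) : ℝ≥0∞ :=
  ⨅ (t : ℝ) (_ : 0 < t ∧ (process U ε x y e t).1 = z), ENNReal.ofReal t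

variable {Ω : Type*} [MeasurableSpace Ω]

/-- The expected hitting time of `z`. -/
def meanHittingTime (P : Measure Ω) (E : ℕ → Ω → ℝ) (U : ℝ → ℝ) (ε x y z : ℝ) : ℝ≥0∞ :=
  ∫⁻ ω, hittingTime U ε x y (fun k => E k ω) z ∂P

/-- The law of the position `X_t`. -/
def positionLaw (P : Measure Ω) (E : ℕ → Ω → ℝ) (U : ℝ → ℝ) (ε x y t : ℝ) : Measure ℝ :=
  P.map (fun ω => (process U ε x y (fun k => E k ω) t).1)

/-- The Gibbs probability measure `e^{-U(x)/ε} dx / ∫ e^{-U/ε}`. -/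
def gibbs (U : ℝ → ℝ) (ε : ℝ) : Measure ℝ :=
  (volume : Measure ℝ).tilted (fun x => -U x / ε)

/-- The Wasserstein distance: the infimum of `E_π |Z₁ - Z₂|` over all couplings `π`. -/
def wasserstein (ν₁ ν₂ : Measure ℝ) : ℝ≥0∞ :=
  ⨅ (π : Measure (ℝ × ℝ)) (_ : π.fst = ν₁ ∧ π.snd = ν₂), ∫⁻ z, ENNReal.ofReal |z.1 - z.2| ∂π

end

end VelocityJump

/-! ### The shape of a double well -/

namespace IsDoubleWell

variable {U : ℝ → ℝ} {x₀ x₁ x₂ : ℝ}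

/-! Write H = U x₁ - U x₀ and H' = U x₁ - U x₂, so that H < H'. Jumps occur only uphill, and a clock
e makes a flight turn once it has climbed ε e in total. The downhill run after a turn uses up no
clock, so every flight may be regarded as starting at the bottom of the well where the previous one
turned (`IsDoubleWell.base_target`). The trajectory therefore splits into excursions from a bottom
to a turning point and on to a bottom, alternately left- and right-moving, each determined by its
initial well and its clock (`IsDoubleWell.jumpState_spec`). A right-moving excursion leaves the left
well iff ε e > H, with probability p = exp(-H/ε); a left-moving one leaves the right well iff ε e >
H'.

Until the first crossing, the durations are functions of separate clocks. The number of attempts is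
geometric with parameter p, so Wald's identity gives E[τ] = m / p up to the bounded travel time x₁ -
x₀, where m is the mean length of a round (`IsClock.meanHittingTime_bounds`). Chebyshev's inequality
turns the time t E[τ] into about t / p rounds, and (1 - p)^(t/p) → exp(-t) is the limiting
probability of not having crossed (`IsClock.tendsto_trapped`).

It remains to see that the process sits near the bottom of its well and has not come back. Both rest
on a renewal bound: on average at most O(1 + l/ε) excursions start in a time window of length l
(`IsClock.tsum_measure_start_le`). Multiplied by exp(-H'/ε), it excludes returns, since the time
horizon is O(exp(H/ε)) and H < H'; it also controls the size bias of the excursion in progress.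
Hence E|X - x₂| → exp(-t) (x₂ - x₀) (`IsClock.tendsto_lintegral_abs_dist_sub`).

By Laplace's method the Gibbs measure collapses to x₂ in the first moment
(`tendsto_lintegral_gibbs`), so the Wasserstein distance to it is E|X - x₂| up to o(1)
(`wasserstein_le`, `lintegral_le_wasserstein_add`). -/

theorem deriv_comp_neg_eq (U : ℝ → ℝ) : deriv (fun z => U (-z)) = fun z => -deriv U (-z) := by
  funext z
  exact deriv_comp_neg U z

theorem isLocalMin_comp_neg {U : ℝ → ℝ} {x : ℝ} :
    IsLocalMin (fun z => U (-z)) x ↔ IsLocalMin U (-x) := by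
  unfold IsLocalMin IsMinFilter
  constructor
  · intro h
    have hc : Tendsto (fun z : ℝ => -z) (𝓝 (-x)) (𝓝 x) := by
      simpa using (continuous_neg (G := ℝ)).tendsto (-x)
    simpa using hc.eventually h
  · intro h
    exact ((continuous_neg (G := ℝ)).tendsto x).eventually h

theorem isLocalMax_comp_neg {U : ℝ → ℝ} {x : ℝ} :
    IsLocalMax (fun z => U (-z)) x ↔ IsLocalMax U (-x) := by
  have := isLocalMin_comp_neg (U := fun z => -U z) (x := x)
  constructor
  · intro h
    simpa using (this.1 h.neg).neg
  · intro h
    simpa using (this.2 h.neg).neg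

/-- The mirror image of a double well is a double well. -/
theorem comp_neg (hU : IsDoubleWell U x₀ x₁ x₂) :
    IsDoubleWell (fun z => U (-z)) (-x₂) (-x₁) (-x₀) where
  contDiff := hU.contDiff.comp contDiff_neg
  morse x hx := by
    rw [deriv_comp_neg_eq] at hx ⊢
    have h : deriv (fun z => -deriv U (-z)) x = deriv (deriv U) (-x) := by
      rw [deriv.fun_neg, deriv_comp_neg, neg_neg]
    rw [h]
    exact hU.morse _ (by simpa using hx)
  lt_left := neg_lt_neg hU.lt_right
  lt_right := neg_lt_neg hU.lt_left
  isLocalMin_iff x := by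
    rw [isLocalMin_comp_neg, hU.isLocalMin_iff, neg_eq_iff_eq_neg, neg_eq_iff_eq_neg, or_comm]
  isLocalMax_iff x := by
    rw [isLocalMax_comp_neg, hU.isLocalMax_iff, neg_eq_iff_eq_neg]
  convexOn_left := by
    have hS : Set.Iic (-x₂) = ⇑(-LinearMap.id : ℝ →ₗ[ℝ] ℝ) ⁻¹' Set.Ici x₂ := by
      ext z
      simp [le_neg]
    rw [hS]
    exact hU.convexOn_right.comp_linearMap (-LinearMap.id)
  convexOn_right := by
    have hS : Set.Ici (-x₀) = ⇑(-LinearMap.id : ℝ →ₗ[ℝ] ℝ) ⁻¹' Set.Iic x₀ := by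
      ext z
      simp [neg_le]
    rw [hS]
    exact hU.convexOn_left.comp_linearMap (-LinearMap.id)
  tendsto_atTop := hU.tendsto_atTop.comp (Homeomorph.neg ℝ).isClosedEmbedding.tendsto_cocompact

theorem continuous (hU : IsDoubleWell U x₀ x₁ x₂) : Continuous U := hU.contDiff.continuous

theorem continuous_deriv (hU : IsDoubleWell U x₀ x₁ x₂) : Continuous (deriv U) :=
  hU.contDiff.continuous_deriv (by norm_num)

theorem hasDerivAt (hU : IsDoubleWell U x₀ x₁ x₂) (x : ℝ) : HasDerivAt U (deriv U x) x :=
  (hU.contDiff.differentiable (by norm_num) x).hasDerivAt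

theorem isLocalMin_left (hU : IsDoubleWell U x₀ x₁ x₂) : IsLocalMin U x₀ :=
  (hU.isLocalMin_iff _).2 (.inl rfl)

theorem isLocalMin_right (hU : IsDoubleWell U x₀ x₁ x₂) : IsLocalMin U x₂ :=
  (hU.isLocalMin_iff _).2 (.inr rfl)

/-- At a critical point the Morse condition gives a nonzero second derivative, hence a local
extremum, and these are all listed. -/
theorem deriv_ne_zero (hU : IsDoubleWell U x₀ x₁ x₂) {x : ℝ} (h0 : x ≠ x₀) (h1 : x ≠ x₁)
    (h2 : x ≠ x₂) : deriv U x ≠ 0 := by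
  intro h
  rcases lt_or_gt_of_ne (hU.morse x h) with h' | h'
  · exact h1 ((hU.isLocalMax_iff x).1 (isLocalMax_of_deriv_deriv_neg h' h hU.continuous.continuousAt))
  · rcases (hU.isLocalMin_iff x).1
      (isLocalMin_of_deriv_deriv_pos h' h hU.continuous.continuousAt) with h3 | h3
    · exact h0 h3
    · exact h2 h3

/-- By the intermediate value theorem a zero-free derivative keeps its sign; a negative sign would
make `U` strictly decreasing to the right of `a`, against minimality. -/
theorem deriv_pos_of_isLocalMin (hU : IsDoubleWell U x₀ x₁ x₂) {a b : ℝ} (ha : IsLocalMin U a)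
    (hne : ∀ z ∈ Set.Ioo a b, deriv U z ≠ 0) {z : ℝ} (hz : z ∈ Set.Ioo a b) : 0 < deriv U z := by
  by_contra hneg
  have hz0 : deriv U z < 0 := lt_of_le_of_ne (not_lt.1 hneg) (hne z hz)
  have hall : ∀ w ∈ Set.Ioo a b, deriv U w < 0 := by
    intro w hw
    by_contra hw0
    have hw1 : 0 ≤ deriv U w := not_lt.1 hw0
    obtain ⟨v, hv, hv0⟩ := (isPreconnected_Ioo (a := a) (b := b)).intermediate_value hz hw
      hU.continuous_deriv.continuousOn (show (0 : ℝ) ∈ Set.Icc _ _ from ⟨hz0.le, hw1⟩)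
    exact hne v hv hv0
  have hanti : StrictAntiOn U (Set.Icc a b) :=
    strictAntiOn_of_deriv_neg (convex_Icc a b) hU.continuous.continuousOn
      (by rw [interior_Icc]; exact hall)
  have hab : a < b := hz.1.trans hz.2
  have h1 : ∀ᶠ w in 𝓝[>] a, U a ≤ U w := nhdsWithin_le_nhds ha
  have h2 : ∀ᶠ w in 𝓝[>] a, w ∈ Set.Ioo a b := Ioo_mem_nhdsGT hab
  obtain ⟨w, hw1, hw2⟩ := (h1.and h2).exists
  exact absurd (hanti ⟨le_rfl, hab.le⟩ ⟨hw2.1.le, hw2.2.le⟩ hw2.1) (not_lt.2 hw1)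

theorem deriv_pos_left (hU : IsDoubleWell U x₀ x₁ x₂) {z : ℝ} (hz : z ∈ Set.Ioo x₀ x₁) :
    0 < deriv U z :=
  hU.deriv_pos_of_isLocalMin hU.isLocalMin_left (fun _ hw => hU.deriv_ne_zero hw.1.ne' hw.2.ne
    (hw.2.trans hU.lt_right).ne) hz

theorem deriv_pos_right (hU : IsDoubleWell U x₀ x₁ x₂) {z : ℝ} (hz : x₂ < z) :
    0 < deriv U z :=
  hU.deriv_pos_of_isLocalMin hU.isLocalMin_right (b := z + 1) (fun _ hw => hU.deriv_ne_zero
    ((hU.lt_left.trans hU.lt_right).trans hw.1).ne' (hU.lt_right.trans hw.1).ne' hw.1.ne')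
    ⟨hz, by linarith⟩

theorem deriv_neg_left (hU : IsDoubleWell U x₀ x₁ x₂) {z : ℝ} (hz : z < x₀) :
    deriv U z < 0 := by
  have := hU.comp_neg.deriv_pos_right (z := -z) (by linarith)
  rw [deriv_comp_neg_eq] at this
  simpa using this

theorem deriv_neg_right (hU : IsDoubleWell U x₀ x₁ x₂) {z : ℝ} (hz : z ∈ Set.Ioo x₁ x₂) :
    deriv U z < 0 := by
  have := hU.comp_neg.deriv_pos_left (z := -z) ⟨by linarith [hz.2], by linarith [hz.1]⟩
  rw [deriv_comp_neg_eq] at this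
  simpa using this

theorem strictMonoOn_left (hU : IsDoubleWell U x₀ x₁ x₂) : StrictMonoOn U (Set.Icc x₀ x₁) :=
  strictMonoOn_of_deriv_pos (convex_Icc _ _) hU.continuous.continuousOn
    (by rw [interior_Icc]; exact fun z hz => hU.deriv_pos_left hz)

theorem strictMonoOn_right (hU : IsDoubleWell U x₀ x₁ x₂) : StrictMonoOn U (Set.Ici x₂) :=
  strictMonoOn_of_deriv_pos (convex_Ici _) hU.continuous.continuousOn
    (by rw [interior_Ici]; exact fun z hz => hU.deriv_pos_right hz)

theorem strictAntiOn_left (hU : IsDoubleWell U x₀ x₁ x₂) : StrictAntiOn U (Set.Iic x₀) :=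
  strictAntiOn_of_deriv_neg (convex_Iic _) hU.continuous.continuousOn
    (by rw [interior_Iic]; exact fun z hz => hU.deriv_neg_left hz)

theorem strictAntiOn_right (hU : IsDoubleWell U x₀ x₁ x₂) : StrictAntiOn U (Set.Icc x₁ x₂) :=
  strictAntiOn_of_deriv_neg (convex_Icc _ _) hU.continuous.continuousOn
    (by rw [interior_Icc]; exact fun z hz => hU.deriv_neg_right hz)

theorem barrier_left_pos (hU : IsDoubleWell U x₀ x₁ x₂) : 0 < U x₁ - U x₀ :=
  sub_pos.2 (hU.strictMonoOn_left ⟨le_rfl, hU.lt_left.le⟩ ⟨hU.lt_left.le, le_rfl⟩ hU.lt_left)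

theorem barrier_right_pos (hU : IsDoubleWell U x₀ x₁ x₂) : 0 < U x₁ - U x₂ :=
  sub_pos.2 (hU.strictAntiOn_right ⟨le_rfl, hU.lt_right.le⟩ ⟨hU.lt_right.le, le_rfl⟩ hU.lt_right)

/-- Convexity forces at least linear growth to the right of the right well. -/
theorem exists_linear_growth (hU : IsDoubleWell U x₀ x₁ x₂) :
    ∃ c, 0 < c ∧ ∀ z, x₂ ≤ z → c * (z - x₂ - 1) ≤ U z - U x₂ := by
  refine ⟨U (x₂ + 1) - U x₂, sub_pos.2 (hU.strictMonoOn_right Set.self_mem_Ici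
    (by simp : x₂ + 1 ∈ Set.Ici x₂) (by linarith)), fun z hz => ?_⟩
  have hpos : 0 < U (x₂ + 1) - U x₂ := sub_pos.2 (hU.strictMonoOn_right Set.self_mem_Ici
    (by simp : x₂ + 1 ∈ Set.Ici x₂) (by linarith))
  rcases le_or_gt z (x₂ + 1) with h | h
  · have h1 : U x₂ ≤ U z := hU.strictMonoOn_right.monotoneOn Set.self_mem_Ici hz hz
    nlinarith
  · have := hU.convexOn_right.secant_mono (a := x₂) (x := x₂ + 1) (y := z) Set.self_mem_Ici
      (by simp) hz (by linarith) (by linarith : z ≠ x₂) h.le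
    rw [add_sub_cancel_left, div_one, le_div_iff₀ (by linarith)] at this
    nlinarith

end IsDoubleWell


/-! ### Ascent and turning points of right-moving flights -/

namespace VelocityJump

/-- The total increase of `V` between `a` and `z`. -/
noncomputable def ascent (V : ℝ → ℝ) (a z : ℝ) : ℝ := ∫ u in a..z, max (deriv V u) 0

/-- The first point to the right of `a` that is reached after a total increase `h` of `V`. -/
noncomputable def landing (V : ℝ → ℝ) (a h : ℝ) : ℝ := sInf {z : ℝ | a ≤ z ∧ h ≤ ascent V a z}

end VelocityJump

namespace IsDoubleWell

open VelocityJump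

variable {U : ℝ → ℝ} {x₀ x₁ x₂ : ℝ}

theorem lt (hU : IsDoubleWell U x₀ x₁ x₂) : x₀ < x₂ := hU.lt_left.trans hU.lt_right

theorem continuous_slope (hU : IsDoubleWell U x₀ x₁ x₂) :
    Continuous fun u => max (deriv U u) 0 := hU.continuous_deriv.max continuous_const

theorem intervalIntegrable_slope (hU : IsDoubleWell U x₀ x₁ x₂) (a b : ℝ) :
    IntervalIntegrable (fun u => max (deriv U u) 0) volume a b :=
  hU.continuous_slope.intervalIntegrable a b

theorem continuous_ascent (hU : IsDoubleWell U x₀ x₁ x₂) (a : ℝ) : Continuous (ascent U a) :=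
  intervalIntegral.continuous_primitive (fun _ _ => hU.intervalIntegrable_slope _ _) a

theorem ascent_add (hU : IsDoubleWell U x₀ x₁ x₂) (a b c : ℝ) :
    ascent U a b + ∫ u in b..c, max (deriv U u) 0 = ascent U a c :=
  intervalIntegral.integral_add_adjacent_intervals (hU.intervalIntegrable_slope _ _)
    (hU.intervalIntegrable_slope _ _)

theorem monotone_ascent (hU : IsDoubleWell U x₀ x₁ x₂) (a : ℝ) : Monotone (ascent U a) := by
  intro b c hbc
  rw [← hU.ascent_add a b c]
  exact le_add_of_nonneg_right (intervalIntegral.integral_nonneg hbc fun u _ => le_max_right _ _)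

theorem integral_slope_of_nonneg (hU : IsDoubleWell U x₀ x₁ x₂) {a b : ℝ} (hab : a ≤ b)
    (h : ∀ z ∈ Set.Ioo a b, 0 < deriv U z) :
    ∫ u in a..b, max (deriv U u) 0 = U b - U a := by
  rw [← intervalIntegral.integral_eq_sub_of_hasDerivAt (fun x _ => hU.hasDerivAt x)
    (hU.continuous_deriv.intervalIntegrable _ _)]
  rw [intervalIntegral.integral_of_le hab, intervalIntegral.integral_of_le hab,
    integral_Ioc_eq_integral_Ioo, integral_Ioc_eq_integral_Ioo]
  exact setIntegral_congr_fun measurableSet_Ioo fun z hz => max_eq_left (h z hz).le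

theorem integral_slope_of_nonpos {a b : ℝ} (hab : a ≤ b)
    (h : ∀ z ∈ Set.Ioo a b, deriv U z < 0) :
    ∫ u in a..b, max (deriv U u) 0 = 0 := by
  rw [intervalIntegral.integral_of_le hab, integral_Ioc_eq_integral_Ioo]
  exact setIntegral_eq_zero_of_forall_eq_zero fun z hz => max_eq_right (h z hz).le

theorem ascent_of_le (hU : IsDoubleWell U x₀ x₁ x₂) {z : ℝ} (hz : z ≤ x₀) : ascent U x₀ z = 0 := by
  rw [ascent, intervalIntegral.integral_symm, neg_eq_zero]
  exact integral_slope_of_nonpos hz fun w hw => hU.deriv_neg_left hw.2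

theorem ascent_of_mem_left (hU : IsDoubleWell U x₀ x₁ x₂) {z : ℝ} (hz : z ∈ Set.Icc x₀ x₁) :
    ascent U x₀ z = U z - U x₀ :=
  hU.integral_slope_of_nonneg hz.1 fun _ hw => hU.deriv_pos_left ⟨hw.1, hw.2.trans_le hz.2⟩

/-- There is no ascent between the top and the right bottom, so `ascent` has a plateau at the
barrier height. A flight that passes the top therefore cannot turn before the right bottom. -/
theorem ascent_of_mem_right (hU : IsDoubleWell U x₀ x₁ x₂) {z : ℝ} (hz : z ∈ Set.Icc x₁ x₂) :
    ascent U x₀ z = U x₁ - U x₀ := by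
  rw [← hU.ascent_add x₀ x₁ z, hU.ascent_of_mem_left ⟨hU.lt_left.le, le_rfl⟩,
    integral_slope_of_nonpos hz.1 fun w hw => hU.deriv_neg_right ⟨hw.1, hw.2.trans_le hz.2⟩,
    add_zero]

theorem ascent_of_ge (hU : IsDoubleWell U x₀ x₁ x₂) {z : ℝ} (hz : x₂ ≤ z) :
    ascent U x₀ z = U x₁ - U x₀ + (U z - U x₂) := by
  rw [← hU.ascent_add x₀ x₂ z, hU.ascent_of_mem_right ⟨hU.lt_right.le, le_rfl⟩,
    hU.integral_slope_of_nonneg hz fun w hw => hU.deriv_pos_right hw.1]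

/-- Linear growth of `U` at infinity makes the length of a flight at most linear in the height
climbed; all moment bounds on durations come from this. -/
theorem exists_le_ascent (hU : IsDoubleWell U x₀ x₁ x₂) :
    ∃ C, 0 ≤ C ∧ ∀ h, 0 ≤ h → h ≤ ascent U x₀ (x₀ + C * (1 + h)) := by
  obtain ⟨c, hc, hgrow⟩ := hU.exists_linear_growth
  have hC0 : 0 ≤ x₂ + 1 - x₀ + 1 / c := by
    have := hU.lt
    have : 0 < 1 / c := by positivity
    linarith
  refine ⟨x₂ + 1 - x₀ + 1 / c, hC0, fun h hh => ?_⟩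
  -- At `x₂ + 1 + h / c` the linear growth bound already yields a height `h` above the right bottom.
  have hz : x₂ + 1 + 1 / c * h ≤ x₀ + (x₂ + 1 - x₀ + 1 / c) * (1 + h) := by
    have h1 : 0 ≤ (x₂ + 1 - x₀) * h := mul_nonneg (by linarith [hU.lt]) hh
    have : 0 < 1 / c := by positivity
    nlinarith
  have hx : x₂ ≤ x₂ + 1 + 1 / c * h := by
    have : 0 ≤ 1 / c * h := by positivity
    linarith
  refine le_trans ?_ (hU.monotone_ascent x₀ hz)
  rw [hU.ascent_of_ge hx]
  have h2 := hgrow _ hx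
  have h3 : c * (x₂ + 1 + 1 / c * h - x₂ - 1) = h := by field_simp; ring
  linarith [hU.barrier_left_pos]

theorem nonempty_landing (hU : IsDoubleWell U x₀ x₁ x₂) (h : ℝ) :
    {z : ℝ | x₀ ≤ z ∧ h ≤ ascent U x₀ z}.Nonempty := by
  obtain ⟨C, hC, hle⟩ := hU.exists_le_ascent
  refine ⟨x₀ + C * (1 + max h 0), ?_, (le_max_left h 0).trans (hle _ (le_max_right h 0))⟩
  have : 0 ≤ C * (1 + max h 0) := by positivity
  linarith

theorem bddBelow_landing (U : ℝ → ℝ) (x₀ h : ℝ) :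
    BddBelow {z : ℝ | x₀ ≤ z ∧ h ≤ ascent U x₀ z} := ⟨x₀, fun _ hz => hz.1⟩

theorem landing_mem (hU : IsDoubleWell U x₀ x₁ x₂) (h : ℝ) :
    x₀ ≤ landing U x₀ h ∧ h ≤ ascent U x₀ (landing U x₀ h) :=
  IsClosed.csInf_mem
    (isClosed_Ici.inter (isClosed_le continuous_const (hU.continuous_ascent x₀)))
    (hU.nonempty_landing h) (bddBelow_landing U x₀ h)

theorem landing_le {h z : ℝ} (hz : x₀ ≤ z) (hle : h ≤ ascent U x₀ z) : landing U x₀ h ≤ z :=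
  csInf_le (bddBelow_landing U x₀ h) ⟨hz, hle⟩

theorem ascent_landing (hU : IsDoubleWell U x₀ x₁ x₂) {h : ℝ} (hh : 0 ≤ h) :
    ascent U x₀ (landing U x₀ h) = h := by
  obtain ⟨h1, h2⟩ := hU.landing_mem h
  have h0 : ascent U x₀ x₀ = 0 := hU.ascent_of_le le_rfl
  obtain ⟨z, hz, hzh⟩ := intermediate_value_Icc h1 (hU.continuous_ascent x₀).continuousOn
    (show h ∈ Set.Icc _ _ from ⟨h0.trans_le hh, h2⟩)
  rwa [le_antisymm (landing_le hz.1 hzh.ge) hz.2]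

theorem monotone_landing (hU : IsDoubleWell U x₀ x₁ x₂) : Monotone (landing U x₀) :=
  fun _ h' hh => csInf_le_csInf (bddBelow_landing U x₀ _) (hU.nonempty_landing h')
    fun _ hz => ⟨hz.1, hh.trans hz.2⟩

theorem lt_landing (hU : IsDoubleWell U x₀ x₁ x₂) {x h : ℝ} (hh : ascent U x₀ x < h) :
    x < landing U x₀ h := by
  by_contra hle
  exact absurd ((hU.landing_mem h).2.trans (hU.monotone_ascent x₀ (not_lt.1 hle))) (not_le.2 hh)

theorem landing_le_barrier (hU : IsDoubleWell U x₀ x₁ x₂) {h : ℝ} (hh : h ≤ U x₁ - U x₀) :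
    landing U x₀ h ≤ x₁ :=
  landing_le hU.lt_left.le (by rwa [hU.ascent_of_mem_left ⟨hU.lt_left.le, le_rfl⟩])

theorem landing_lt_barrier (hU : IsDoubleWell U x₀ x₁ x₂) {h : ℝ} (hh0 : 0 ≤ h)
    (hh : h < U x₁ - U x₀) : landing U x₀ h < x₁ := by
  refine lt_of_le_of_ne (hU.landing_le_barrier hh.le) fun heq => hh.ne ?_
  rw [← hU.ascent_landing hh0, heq, hU.ascent_of_mem_left ⟨hU.lt_left.le, le_rfl⟩]

/-- The first passage above the barrier height skips the whole plateau, whereas the height equal to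
the barrier lands at the top itself, which is counted with the left well. -/
theorem lt_landing_of_barrier_lt (hU : IsDoubleWell U x₀ x₁ x₂) {h : ℝ} (hh : U x₁ - U x₀ < h) :
    x₂ < landing U x₀ h :=
  hU.lt_landing (by rwa [hU.ascent_of_mem_right ⟨hU.lt_right.le, le_rfl⟩])

theorem exists_landing_le (hU : IsDoubleWell U x₀ x₁ x₂) :
    ∃ C, 0 ≤ C ∧ ∀ h, 0 ≤ h → landing U x₀ h - x₀ ≤ C * (1 + h) := by
  obtain ⟨C, hC, hle⟩ := hU.exists_le_ascent
  refine ⟨C, hC, fun h hh => ?_⟩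
  have h0 : 0 ≤ C * (1 + h) := by positivity
  linarith [landing_le (by linarith) (hle h hh)]

/-- The slope is bounded on `[x₀, x₂ + 1]`, so a climb of `h` needs a distance `h / M`, unless the
flight has length at least one anyway. This keeps excursions from being too short in the renewal
bound. -/
theorem exists_le_landing (hU : IsDoubleWell U x₀ x₁ x₂) :
    ∃ M, 0 < M ∧ ∀ x, x₀ ≤ x → x ≤ x₂ → ∀ h, 0 < h →
      min 1 (h / M) ≤ landing U x₀ (ascent U x₀ x + h) - x := by
  obtain ⟨M, hM⟩ := (isCompact_Icc (a := x₀) (b := x₂ + 1)).exists_bound_of_continuousOn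
    hU.continuous_slope.continuousOn
  refine ⟨max M 1, by positivity, fun x hx0 hx2 h hh => ?_⟩
  have hpos : 0 ≤ ascent U x₀ x := by
    rw [← hU.ascent_of_le (le_refl x₀)]
    exact hU.monotone_ascent x₀ hx0
  set z := landing U x₀ (ascent U x₀ x + h) with hz
  have hGz : ascent U x₀ z = ascent U x₀ x + h := hU.ascent_landing (by linarith)
  have hxz : x < z := hU.lt_landing (by linarith)
  rcases le_or_gt 1 (z - x) with h1 | h1
  · exact (min_le_left _ _).trans h1
  · refine (min_le_right _ _).trans ?_
    rw [div_le_iff₀ (by positivity)]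
    have h2 : ∫ u in x..z, max (deriv U u) 0 = h := by
      have := hU.ascent_add x₀ x z
      linarith
    have h3 : ‖∫ u in x..z, max (deriv U u) 0‖ ≤ max M 1 * |z - x| := by
      refine intervalIntegral.norm_integral_le_of_norm_le_const fun u hu => ?_
      rw [Set.uIoc_of_le hxz.le] at hu
      exact (hM u ⟨by linarith [hu.1], by linarith [hu.2]⟩).trans (le_max_left _ _)
    rw [h2, Real.norm_of_nonneg hh.le, abs_of_pos (by linarith)] at h3
    linarith

/-- `U` increases strictly to the right of both bottoms, so going a distance `δ` beyond either of
them costs a positive height. -/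
theorem exists_landing_near (hU : IsDoubleWell U x₀ x₁ x₂) {δ : ℝ} (hδ : 0 < δ) :
    ∃ η, 0 < η ∧ η < U x₁ - U x₀ ∧ ∀ h, h ≤ η → landing U x₀ h ≤ x₀ + δ ∧
      landing U x₀ (U x₁ - U x₀ + h) ≤ x₂ + δ := by
  have h1 : 0 < ascent U x₀ (x₀ + δ) := by
    have hm : min (x₀ + δ) x₁ ∈ Set.Icc x₀ x₁ :=
      ⟨le_min (by linarith) hU.lt_left.le, min_le_right _ _⟩
    refine lt_of_lt_of_le ?_ (hU.monotone_ascent x₀ (min_le_left _ x₁))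
    rw [hU.ascent_of_mem_left hm]
    exact sub_pos.2 (hU.strictMonoOn_left ⟨le_rfl, hU.lt_left.le⟩ hm
      (lt_min (by linarith) hU.lt_left))
  have h2 : 0 < U (x₂ + δ) - U x₂ :=
    sub_pos.2 (hU.strictMonoOn_right Set.self_mem_Ici (by simp [hδ.le]) (by linarith))
  have h3 := hU.barrier_left_pos
  refine ⟨min (min (ascent U x₀ (x₀ + δ)) (U (x₂ + δ) - U x₂)) ((U x₁ - U x₀) / 2),
    by positivity, (min_le_right _ _).trans_lt (by linarith), fun h hh => ⟨?_, ?_⟩⟩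
  · exact landing_le (by linarith) (hh.trans ((min_le_left _ _).trans (min_le_left _ _)))
  · refine landing_le (by linarith [hU.lt]) ?_
    rw [hU.ascent_of_ge (by linarith)]
    have := hh.trans ((min_le_left _ _).trans (min_le_right _ _))
    linarith

/-- Along a right-moving line the integrated rate is the increment of `ascent` divided by `ε`, so
the clock `e` becomes a climb of height `ε e`. -/
theorem waitingTime_right (hU : IsDoubleWell U x₀ x₁ x₂) {ε e : ℝ} (hε : 0 < ε) (he : 0 < e)
    (x : ℝ) : waitingTime U ε x 1 e = landing U x₀ (ascent U x₀ x + ε * e) - x := by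
  have hpos : 0 ≤ ascent U x₀ x := by
    rw [← hU.ascent_of_le (min_le_right x x₀)]
    exact hU.monotone_ascent x₀ (min_le_left _ _)
  have hεe : 0 < ε * e := mul_pos hε he
  have hint : ∀ s, ∫ u in (0 : ℝ)..s, jumpRate U ε (x + 1 * u) 1 =
      (ascent U x₀ (x + s) - ascent U x₀ x) / ε := by
    intro s
    have h1 : ∫ u in x..(x + s), max (deriv U u) 0 = ascent U x₀ (x + s) - ascent U x₀ x := by
      rw [← hU.ascent_add x₀ x (x + s)]; ring
    rw [← h1, ← intervalIntegral.integral_div]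
    simp only [jumpRate, one_mul]
    have := intervalIntegral.integral_comp_add_left (a := 0) (b := s)
      (fun u => max (deriv U u) 0 / ε) x
    simpa using this
  have hle : ∀ s, e ≤ ∫ u in (0 : ℝ)..s, jumpRate U ε (x + 1 * u) 1 ↔
      ascent U x₀ x + ε * e ≤ ascent U x₀ (x + s) := by
    intro s
    rw [hint, le_div_iff₀ hε]
    constructor <;> intro h <;> linarith
  refine IsLeast.csInf_eq ⟨⟨?_, ?_⟩, ?_⟩
  · exact sub_pos.2 (hU.lt_landing (by linarith))
  · rw [hle, add_sub_cancel]
    exact (hU.landing_mem _).2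
  · rintro s ⟨-, hs⟩
    rw [hle] at hs
    have hx : x₀ ≤ x + s := by
      by_contra hlt
      rw [hU.ascent_of_le (not_le.1 hlt).le] at hs
      linarith
    linarith [landing_le hx hs]

theorem waitingTime_left (U : ℝ → ℝ) (ε x e : ℝ) :
    waitingTime U ε x (-1) e = waitingTime (fun z => U (-z)) ε (-x) 1 e := by
  unfold waitingTime jumpRate
  rw [deriv_comp_neg_eq]
  congr! 9 with s u
  ring_nf

end IsDoubleWell


/-! ### Excursions in both directions, by reflection -/

namespace VelocityJump

noncomputable section

/-- The bottom of the left (`false`) or of the right (`true`) well. -/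
def bottom (x₀ x₂ : ℝ) (w : Bool) : ℝ := cond w x₂ x₀

/-- The velocity of a left-moving (`false`) or right-moving (`true`) flight. -/
def sgn (d : Bool) : ℝ := cond d 1 (-1)

/-- The ascent of `U` before `x` in the direction `d`. -/
def base (U : ℝ → ℝ) (x₀ x₂ : ℝ) (d : Bool) (x : ℝ) : ℝ :=
  cond d (ascent U x₀ x) (ascent (fun z => U (-z)) (-x₂) (-x))

/-- The turning point of the right-moving flight that climbs `h` from the bottom of the well `w`. -/
def rightTarget (U : ℝ → ℝ) (x₀ x₂ : ℝ) (w : Bool) (h : ℝ) : ℝ :=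
  landing U x₀ (ascent U x₀ (bottom x₀ x₂ w) + h)

/-- The well which contains `rightTarget U x₀ x₂ w h`. -/
def rightNextWell (U : ℝ → ℝ) (x₀ x₁ x₂ : ℝ) (w : Bool) (h : ℝ) : Bool :=
  decide (U x₁ - U x₀ < ascent U x₀ (bottom x₀ x₂ w) + h)

/-- The turning point of the flight in direction `d` that climbs `h` from the bottom of the
well `w`. -/
def target (U : ℝ → ℝ) (x₀ x₂ : ℝ) (d w : Bool) (h : ℝ) : ℝ :=
  cond d (rightTarget U x₀ x₂ w h) (-rightTarget (fun z => U (-z)) (-x₂) (-x₀) (!w) h)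

/-- The well which contains the turning point `target U x₀ x₂ d w h`. -/
def nextWell (U : ℝ → ℝ) (x₀ x₁ x₂ : ℝ) (d w : Bool) (h : ℝ) : Bool :=
  cond d (rightNextWell U x₀ x₁ x₂ w h)
    (!rightNextWell (fun z => U (-z)) (-x₂) (-x₁) (-x₀) (!w) h)

/-- The time to go from the bottom of the well `w` to the turning point, and on to the bottom of
the well there. -/
def duration (U : ℝ → ℝ) (x₀ x₁ x₂ : ℝ) (d w : Bool) (h : ℝ) : ℝ :=
  |target U x₀ x₂ d w h - bottom x₀ x₂ w| +
    |target U x₀ x₂ d w h - bottom x₀ x₂ (nextWell U x₀ x₁ x₂ d w h)|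

theorem sgn_mul_self (d : Bool) : sgn d * sgn d = 1 := by cases d <;> simp [sgn]

theorem sgn_not (d : Bool) : sgn (!d) = -sgn d := by cases d <;> simp [sgn]

theorem abs_sgn (d : Bool) : |sgn d| = 1 := by cases d <;> simp [sgn]

theorem bottom_neg (x₀ x₂ : ℝ) (w : Bool) : bottom (-x₂) (-x₀) (!w) = -bottom x₀ x₂ w := by
  cases w <;> rfl

theorem target_true (U : ℝ → ℝ) (x₀ x₂ : ℝ) (w : Bool) (h : ℝ) :
    target U x₀ x₂ true w h = rightTarget U x₀ x₂ w h := rfl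

theorem target_false (U : ℝ → ℝ) (x₀ x₂ : ℝ) (w : Bool) (h : ℝ) :
    target U x₀ x₂ false w h = -rightTarget (fun z => U (-z)) (-x₂) (-x₀) (!w) h := rfl

theorem nextWell_true (U : ℝ → ℝ) (x₀ x₁ x₂ : ℝ) (w : Bool) (h : ℝ) :
    nextWell U x₀ x₁ x₂ true w h = rightNextWell U x₀ x₁ x₂ w h := rfl

theorem nextWell_false (U : ℝ → ℝ) (x₀ x₁ x₂ : ℝ) (w : Bool) (h : ℝ) :
    nextWell U x₀ x₁ x₂ false w h =
      !rightNextWell (fun z => U (-z)) (-x₂) (-x₁) (-x₀) (!w) h := rfl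

theorem base_true (U : ℝ → ℝ) (x₀ x₂ x : ℝ) : base U x₀ x₂ true x = ascent U x₀ x := rfl

theorem base_false (U : ℝ → ℝ) (x₀ x₂ x : ℝ) :
    base U x₀ x₂ false x = ascent (fun z => U (-z)) (-x₂) (-x) := rfl

theorem target_sub_false (U : ℝ → ℝ) (x₀ x₂ : ℝ) (w w' : Bool) (h : ℝ) :
    target U x₀ x₂ false w h - bottom x₀ x₂ w' =
      -(rightTarget (fun z => U (-z)) (-x₂) (-x₀) (!w) h - bottom (-x₂) (-x₀) (!w')) := by
  rw [target_false, bottom_neg]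
  ring

theorem duration_nonneg (U : ℝ → ℝ) (x₀ x₁ x₂ : ℝ) (d w : Bool) (h : ℝ) :
    0 ≤ duration U x₀ x₁ x₂ d w h := by unfold duration; positivity

end

end VelocityJump

namespace IsDoubleWell

open VelocityJump

variable {U : ℝ → ℝ} {x₀ x₁ x₂ : ℝ}

theorem ascent_bottom_false (hU : IsDoubleWell U x₀ x₁ x₂) :
    ascent U x₀ (bottom x₀ x₂ false) = 0 := hU.ascent_of_le le_rfl

theorem ascent_bottom_true (hU : IsDoubleWell U x₀ x₁ x₂) :
    ascent U x₀ (bottom x₀ x₂ true) = U x₁ - U x₀ :=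
  hU.ascent_of_mem_right ⟨hU.lt_right.le, le_rfl⟩

theorem ascent_bottom_nonneg (hU : IsDoubleWell U x₀ x₁ x₂) (w : Bool) :
    0 ≤ ascent U x₀ (bottom x₀ x₂ w) := by
  cases w
  · exact hU.ascent_bottom_false.ge
  · exact hU.ascent_bottom_true.ge.trans' hU.barrier_left_pos.le

theorem nextWell_true_false (hU : IsDoubleWell U x₀ x₁ x₂) (h : ℝ) :
    nextWell U x₀ x₁ x₂ true false h = decide (U x₁ - U x₀ < h) := by
  rw [nextWell_true, rightNextWell, hU.ascent_bottom_false]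
  simp only [zero_add]

theorem nextWell_true_true (hU : IsDoubleWell U x₀ x₁ x₂) {h : ℝ} (hh : 0 < h) :
    nextWell U x₀ x₁ x₂ true true h = true := by
  rw [nextWell_true, rightNextWell, hU.ascent_bottom_true]
  simpa using hh

theorem nextWell_false_true (hU : IsDoubleWell U x₀ x₁ x₂) (h : ℝ) :
    nextWell U x₀ x₁ x₂ false true h = !decide (U x₁ - U x₂ < h) := by
  rw [nextWell_false, Bool.not_true, ← nextWell_true, hU.comp_neg.nextWell_true_false]
  simp only [neg_neg]

theorem nextWell_false_false (hU : IsDoubleWell U x₀ x₁ x₂) {h : ℝ} (hh : 0 < h) :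
    nextWell U x₀ x₁ x₂ false false h = false := by
  rw [nextWell_false, Bool.not_false, ← nextWell_true, hU.comp_neg.nextWell_true_true hh,
    Bool.not_true]

theorem sgn_mul_target_sub_bottom_pos (hU : IsDoubleWell U x₀ x₁ x₂) (d w : Bool) {h : ℝ}
    (hh : 0 < h) : 0 < sgn d * (target U x₀ x₂ d w h - bottom x₀ x₂ w) := by
  have key : ∀ {U : ℝ → ℝ} {x₀ x₁ x₂ : ℝ}, IsDoubleWell U x₀ x₁ x₂ → ∀ w : Bool,
      0 < rightTarget U x₀ x₂ w h - bottom x₀ x₂ w := fun hU w =>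
    sub_pos.2 (hU.lt_landing (show ascent _ _ _ < _ by linarith))
  cases d
  · rw [target_sub_false]
    simpa [sgn] using key hU.comp_neg (!w)
  · simpa [sgn, target_true, nextWell_true] using key hU w

/-- A flight turns while climbing, hence past the bottom of the well it has reached; the way back to
that bottom is downhill. -/
theorem sgn_mul_target_sub_nextWell_nonneg (hU : IsDoubleWell U x₀ x₁ x₂) (d w : Bool) (h : ℝ) :
    0 ≤ sgn d * (target U x₀ x₂ d w h -
      bottom x₀ x₂ (nextWell U x₀ x₁ x₂ d w h)) := by
  have key : ∀ {U : ℝ → ℝ} {x₀ x₁ x₂ : ℝ}, IsDoubleWell U x₀ x₁ x₂ → ∀ w : Bool,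
      0 ≤ rightTarget U x₀ x₂ w h - bottom x₀ x₂ (rightNextWell U x₀ x₁ x₂ w h) := by
    intro U x₀ x₁ x₂ hU w
    rw [sub_nonneg]
    by_cases hc : U x₁ - U x₀ < ascent U x₀ (bottom x₀ x₂ w) + h
    · simp only [rightNextWell, hc, decide_true]
      exact (hU.lt_landing_of_barrier_lt hc).le
    · simp only [rightNextWell, hc, decide_false]
      exact (hU.landing_mem _).1
  cases d
  · rw [target_sub_false, nextWell_false, Bool.not_not]
    simpa [sgn] using key hU.comp_neg (!w)
  · simpa [sgn, target_true, nextWell_true] using key hU w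

theorem abs_target_sub_bottom (hU : IsDoubleWell U x₀ x₁ x₂) (d w : Bool) {h : ℝ}
    (hh : 0 < h) : |target U x₀ x₂ d w h - bottom x₀ x₂ w| =
      sgn d * (target U x₀ x₂ d w h - bottom x₀ x₂ w) := by
  rw [← abs_of_pos (hU.sgn_mul_target_sub_bottom_pos d w hh), abs_mul, abs_sgn, one_mul]

theorem abs_target_sub_nextWell (hU : IsDoubleWell U x₀ x₁ x₂) (d w : Bool) (h : ℝ) :
    |target U x₀ x₂ d w h - bottom x₀ x₂ (nextWell U x₀ x₁ x₂ d w h)| =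
      sgn d * (target U x₀ x₂ d w h - bottom x₀ x₂ (nextWell U x₀ x₁ x₂ d w h)) := by
  rw [← abs_of_nonneg (hU.sgn_mul_target_sub_nextWell_nonneg d w h), abs_mul, abs_sgn, one_mul]

theorem measurable_target (hU : IsDoubleWell U x₀ x₁ x₂) (d w : Bool) :
    Measurable (target U x₀ x₂ d w) := by
  cases d
  · exact (hU.comp_neg.monotone_landing.measurable.comp (measurable_const_add _)).neg
  · exact hU.monotone_landing.measurable.comp (measurable_const_add _)

theorem measurable_nextWell (U : ℝ → ℝ) (x₀ x₁ x₂ : ℝ) (d w : Bool) :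
    Measurable (nextWell U x₀ x₁ x₂ d w) := by
  have key : ∀ a b : ℝ, Measurable fun h => decide (a < b + h) := by
    intro a b
    refine measurable_to_bool ?_
    simpa [Set.preimage] using measurableSet_lt measurable_const (measurable_const_add b)
  cases d
  · exact (measurable_of_countable Bool.not).comp (key _ _)
  · exact key _ _

theorem measurable_duration (hU : IsDoubleWell U x₀ x₁ x₂) (d w : Bool) :
    Measurable (duration U x₀ x₁ x₂ d w) := by
  have h1 := hU.measurable_target d w
  have h2 : Measurable fun h => bottom x₀ x₂ (nextWell U x₀ x₁ x₂ d w h) :=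
    (measurable_of_countable (bottom x₀ x₂)).comp (measurable_nextWell U x₀ x₁ x₂ d w)
  have h3 : Measurable fun h => |target U x₀ x₂ d w h - bottom x₀ x₂ w| :=
    (h1.sub_const _).abs
  have h4 : Measurable fun h => |target U x₀ x₂ d w h -
    bottom x₀ x₂ (nextWell U x₀ x₁ x₂ d w h)| := (h1.sub h2).abs
  exact h3.add h4

theorem bottom_mem (hU : IsDoubleWell U x₀ x₁ x₂) (w : Bool) :
    x₀ ≤ bottom x₀ x₂ w ∧ bottom x₀ x₂ w ≤ x₂ := by
  cases w
  · exact ⟨le_rfl, hU.lt.le⟩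
  · exact ⟨hU.lt.le, le_rfl⟩

/-- The bound is stated for an arbitrary bottom `w'`, so that it covers both legs of an excursion.
-/
theorem exists_target_le (hU : IsDoubleWell U x₀ x₁ x₂) :
    ∃ C, 0 ≤ C ∧ ∀ d w w' h, 0 < h →
      |target U x₀ x₂ d w h - bottom x₀ x₂ w'| ≤ C * (1 + h) := by
  have key : ∀ {U : ℝ → ℝ} {x₀ x₁ x₂ : ℝ}, IsDoubleWell U x₀ x₁ x₂ → ∃ C, 0 ≤ C ∧
      ∀ w w' h, 0 < h → |rightTarget U x₀ x₂ w h - bottom x₀ x₂ w'| ≤ C * (1 + h) := by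
    intro U x₀ x₁ x₂ hU
    obtain ⟨C, hC, hle⟩ := hU.exists_landing_le
    have hb := hU.barrier_left_pos
    have hl := hU.lt
    refine ⟨C * (1 + (U x₁ - U x₀)) + (x₂ - x₀), by
      have := mul_nonneg hC (by linarith : 0 ≤ 1 + (U x₁ - U x₀)); linarith,
      fun w w' h hh => ?_⟩
    have hbase : ascent U x₀ (bottom x₀ x₂ w) ≤ U x₁ - U x₀ := by
      cases w
      · rw [hU.ascent_bottom_false]; exact hb.le
      · rw [hU.ascent_bottom_true]
    have hbase0 := hU.ascent_bottom_nonneg w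
    have h1 : rightTarget U x₀ x₂ w h - x₀ ≤
        C * (1 + (ascent U x₀ (bottom x₀ x₂ w) + h)) := hle _ (by linarith)
    have h2 : x₀ ≤ rightTarget U x₀ x₂ w h := (hU.landing_mem _).1
    have h3 := hU.bottom_mem w'
    have h4 : C * (1 + (ascent U x₀ (bottom x₀ x₂ w) + h)) ≤
        C * ((1 + (U x₁ - U x₀)) * (1 + h)) := by
      refine mul_le_mul_of_nonneg_left ?_ hC
      nlinarith
    have h5 : 0 ≤ (x₂ - x₀) * h := mul_nonneg (by linarith) hh.le
    have h6 : 0 ≤ C * ((1 + (U x₁ - U x₀)) * (1 + h)) := by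
      have : 0 ≤ (1 + (U x₁ - U x₀)) := by linarith
      positivity
    rw [abs_le]
    constructor <;> linarith
  obtain ⟨C, hC, h1⟩ := key hU
  obtain ⟨C', hC', h2⟩ := key hU.comp_neg
  refine ⟨max C C', le_max_of_le_left hC, fun d w w' h hh => ?_⟩
  have hh1 : 0 ≤ 1 + h := by linarith
  cases d
  · rw [target_sub_false, abs_neg]
    exact (h2 _ _ h hh).trans (mul_le_mul_of_nonneg_right (le_max_right _ _) hh1)
  · exact (h1 _ _ h hh).trans (mul_le_mul_of_nonneg_right (le_max_left _ _) hh1)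

theorem exists_le_target (hU : IsDoubleWell U x₀ x₁ x₂) :
    ∃ M, 0 < M ∧ ∀ d w h, 0 < h → min 1 (h / M) ≤ |target U x₀ x₂ d w h - bottom x₀ x₂ w| := by
  have key : ∀ {U : ℝ → ℝ} {x₀ x₁ x₂ : ℝ}, IsDoubleWell U x₀ x₁ x₂ → ∃ M, 0 < M ∧
      ∀ w h, 0 < h → min 1 (h / M) ≤ |rightTarget U x₀ x₂ w h - bottom x₀ x₂ w| := by
    intro U x₀ x₁ x₂ hU
    obtain ⟨M, hM, hle⟩ := hU.exists_le_landing
    exact ⟨M, hM, fun w h hh => (hle _ (hU.bottom_mem w).1 (hU.bottom_mem w).2 h hh).trans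
      (le_abs_self _)⟩
  obtain ⟨M, hM, h1⟩ := key hU
  obtain ⟨M', hM', h2⟩ := key hU.comp_neg
  refine ⟨max M M', lt_max_of_lt_left hM, fun d w h hh => ?_⟩
  cases d
  · rw [target_sub_false, abs_neg]
    exact le_trans (min_le_min_left _ (by gcongr; exact le_max_right _ _)) (h2 _ h hh)
  · exact le_trans (min_le_min_left _ (by gcongr; exact le_max_left _ _)) (h1 _ h hh)

theorem exists_target_near (hU : IsDoubleWell U x₀ x₁ x₂) {δ : ℝ} (hδ : 0 < δ) :
    ∃ η, 0 < η ∧ η < U x₁ - U x₀ ∧ η < U x₁ - U x₂ ∧ ∀ d w h, 0 < h → h ≤ η →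
      |target U x₀ x₂ d w h - bottom x₀ x₂ w| ≤ δ := by
  have key : ∀ {U : ℝ → ℝ} {x₀ x₁ x₂ : ℝ}, IsDoubleWell U x₀ x₁ x₂ → ∃ η, 0 < η ∧
      η < U x₁ - U x₀ ∧ ∀ w h, 0 < h → h ≤ η →
      |rightTarget U x₀ x₂ w h - bottom x₀ x₂ w| ≤ δ := by
    intro U x₀ x₁ x₂ hU
    obtain ⟨η, hη, hη1, hle⟩ := hU.exists_landing_near hδ
    refine ⟨η, hη, hη1, fun w h hh hhη => ?_⟩
    rw [← target_true, hU.abs_target_sub_bottom true w hh, target_true]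
    simp only [sgn, cond_true, one_mul]
    cases w
    · have := (hle h hhη).1
      simp only [rightTarget, hU.ascent_bottom_false, zero_add]
      simp only [bottom, cond_false]
      linarith
    · have := (hle h hhη).2
      simp only [rightTarget, hU.ascent_bottom_true]
      simp only [bottom, cond_true]
      linarith
  obtain ⟨η, hη, hη1, h1⟩ := key hU
  obtain ⟨η', hη', hη1', h2⟩ := key hU.comp_neg
  rw [neg_neg, neg_neg] at hη1'
  refine ⟨min η η', lt_min hη hη', (min_le_left _ _).trans_lt hη1,
    (min_le_right _ _).trans_lt hη1', fun d w h hh hhη => ?_⟩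
  cases d
  · rw [target_sub_false, abs_neg]
    exact h2 _ h hh (hhη.trans (min_le_right _ _))
  · exact h1 _ h hh (hhη.trans (min_le_left _ _))

/-- Regeneration: between the turning point and the bottom of its well there is no ascent in the
reversed direction, so the way down uses up nothing of the next clock. The reflected ascent is zero
beyond the right bottom and lies on its plateau between the left bottom and the top. -/
theorem base_target (hU : IsDoubleWell U x₀ x₁ x₂) (d w : Bool) {h : ℝ} (hh : 0 < h) :
    base U x₀ x₂ (!d) (target U x₀ x₂ d w h) =
      base U x₀ x₂ (!d) (bottom x₀ x₂ (nextWell U x₀ x₁ x₂ d w h)) := by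
  have key : ∀ {U : ℝ → ℝ} {x₀ x₁ x₂ : ℝ}, IsDoubleWell U x₀ x₁ x₂ → ∀ w : Bool,
      base U x₀ x₂ false (rightTarget U x₀ x₂ w h) =
      base U x₀ x₂ false (bottom x₀ x₂ (rightNextWell U x₀ x₁ x₂ w h)) := by
    intro U x₀ x₁ x₂ hU w
    have h0 := hU.ascent_bottom_nonneg w
    simp only [base_false]
    by_cases hc : U x₁ - U x₀ < ascent U x₀ (bottom x₀ x₂ w) + h
    · have ht : x₂ < rightTarget U x₀ x₂ w h := hU.lt_landing_of_barrier_lt hc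
      simp only [rightNextWell, hc, decide_true]
      rw [hU.comp_neg.ascent_of_le (by linarith), hU.comp_neg.ascent_of_le (by simp [bottom])]
    · have ht : x₀ < rightTarget U x₀ x₂ w h :=
        hU.lt_landing (by rw [hU.ascent_of_le le_rfl]; linarith)
      have ht1 : rightTarget U x₀ x₂ w h ≤ x₁ := hU.landing_le_barrier (not_lt.1 hc)
      simp only [rightNextWell, hc, decide_false]
      have hb : bottom x₀ x₂ false = x₀ := rfl
      rw [hU.comp_neg.ascent_of_mem_right ⟨by linarith, by linarith⟩,
        hU.comp_neg.ascent_of_mem_right ⟨by linarith [hU.lt_left], by linarith⟩]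
  cases d
  · rw [nextWell_false, Bool.not_false, base_true, base_true, target_false]
    have := key hU.comp_neg (!w)
    rw [base_false, base_false, neg_neg, ← bottom_neg, neg_neg, neg_neg] at this
    simpa only [neg_neg] using this
  · exact key hU w

/-- Only the ascent before `x` matters, so a flight from `x` ends at the same turning point as a
flight from the bottom with the same `base`. -/
theorem waitingTime_eq (hU : IsDoubleWell U x₀ x₁ x₂) {ε e : ℝ} (hε : 0 < ε) (he : 0 < e)
    (d w : Bool) {x : ℝ} (hx : base U x₀ x₂ d x = base U x₀ x₂ d (bottom x₀ x₂ w)) :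
    waitingTime U ε x (sgn d) e = sgn d * (target U x₀ x₂ d w (ε * e) - x) := by
  have key : ∀ {U : ℝ → ℝ} {x₀ x₁ x₂ x : ℝ} {w : Bool}, IsDoubleWell U x₀ x₁ x₂ →
      ascent U x₀ x = ascent U x₀ (bottom x₀ x₂ w) →
      waitingTime U ε x 1 e = rightTarget U x₀ x₂ w (ε * e) - x := by
    intro U x₀ x₁ x₂ x w hU hx
    rw [hU.waitingTime_right hε he, rightTarget, ← hx]
  cases d
  · simp only [sgn, cond_false]
    rw [waitingTime_left, target_false, key (w := !w) hU.comp_neg]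
    · ring
    · rw [bottom_neg]
      exact hx
  · simpa [sgn, target_true] using key hU hx

theorem lt_target_of_barrier_lt (hU : IsDoubleWell U x₀ x₁ x₂) {h : ℝ} (hh : U x₁ - U x₀ < h) :
    x₂ < target U x₀ x₂ true false h := by
  simp only [target_true, rightTarget, hU.ascent_bottom_false, zero_add]
  exact hU.lt_landing_of_barrier_lt hh

theorem target_lt_barrier (hU : IsDoubleWell U x₀ x₁ x₂) {h : ℝ} (h0 : 0 ≤ h)
    (hh : h < U x₁ - U x₀) : target U x₀ x₂ true false h < x₁ := by
  simp only [target_true, rightTarget, hU.ascent_bottom_false, zero_add]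
  exact hU.landing_lt_barrier h0 hh

end IsDoubleWell


/-! ### Decomposition of a trajectory into excursions -/

namespace VelocityJump

noncomputable section

/-- The well in which the `n`-th excursion starts. -/
def well (U : ℝ → ℝ) (x₀ x₁ x₂ ε : ℝ) (e : ℕ → ℝ) : ℕ → Bool
  | 0 => false
  | n + 1 => nextWell U x₀ x₁ x₂ n.bodd (well U x₀ x₁ x₂ ε e n) (ε * e n)

/-- The duration of the `n`-th excursion. -/
def excursionTime (U : ℝ → ℝ) (x₀ x₁ x₂ ε : ℝ) (e : ℕ → ℝ) (n : ℕ) : ℝ :=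
  duration U x₀ x₁ x₂ n.bodd (well U x₀ x₁ x₂ ε e n) (ε * e n)

/-- The time at which the `n`-th excursion leaves the bottom of a well. -/
def start (U : ℝ → ℝ) (x₀ x₁ x₂ ε : ℝ) (e : ℕ → ℝ) (n : ℕ) : ℝ :=
  ∑ i ∈ Finset.range n, excursionTime U x₀ x₁ x₂ ε e i

theorem start_succ (U : ℝ → ℝ) (x₀ x₁ x₂ ε : ℝ) (e : ℕ → ℝ) (n : ℕ) :
    start U x₀ x₁ x₂ ε e (n + 1) = start U x₀ x₁ x₂ ε e n + excursionTime U x₀ x₁ x₂ ε e n :=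
  Finset.sum_range_succ _ _

theorem start_zero (U : ℝ → ℝ) (x₀ x₁ x₂ ε : ℝ) (e : ℕ → ℝ) :
    start U x₀ x₁ x₂ ε e 0 = 0 := rfl

theorem monotone_start (U : ℝ → ℝ) (x₀ x₁ x₂ ε : ℝ) (e : ℕ → ℝ) :
    Monotone (start U x₀ x₁ x₂ ε e) :=
  monotone_nat_of_le_succ fun n => by
    rw [start_succ]
    exact le_add_of_nonneg_right (duration_nonneg _ _ _ _ _ _ _)

theorem start_nonneg (U : ℝ → ℝ) (x₀ x₁ x₂ ε : ℝ) (e : ℕ → ℝ) (n : ℕ) :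
    0 ≤ start U x₀ x₁ x₂ ε e n := monotone_start U x₀ x₁ x₂ ε e (Nat.zero_le n)

theorem exists_start_le_lt {U : ℝ → ℝ} {x₀ x₁ x₂ ε : ℝ} {e : ℕ → ℝ}
    (htop : Tendsto (start U x₀ x₁ x₂ ε e) atTop atTop) {s : ℝ} (hs : 0 ≤ s) :
    ∃ n, start U x₀ x₁ x₂ ε e n ≤ s ∧ s < start U x₀ x₁ x₂ ε e (n + 1) := by
  have hex : ∃ n, s < start U x₀ x₁ x₂ ε e n := (htop.eventually_gt_atTop s).exists
  classical
  have hpos : Nat.find hex ≠ 0 := by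
    intro h
    have := Nat.find_spec hex
    rw [h, start_zero] at this
    linarith
  obtain ⟨m, hm⟩ := Nat.exists_eq_succ_of_ne_zero hpos
  refine ⟨m, not_lt.1 (Nat.find_min hex (by omega)), ?_⟩
  have := Nat.find_spec hex
  rwa [hm] at this

theorem process_eq {U : ℝ → ℝ} {ε x y : ℝ} {e : ℕ → ℝ} {s : ℝ} {n : ℕ}
    (hmono : Monotone fun i => (jumpState U ε x y e i).time)
    (h1 : (jumpState U ε x y e n).time ≤ s) (h2 : s < (jumpState U ε x y e (n + 1)).time) :
    (process U ε x y e s).1 = (jumpState U ε x y e n).pos +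
      (jumpState U ε x y e n).vel * (s - (jumpState U ε x y e n).time) := by
  have hn : numJumps U ε x y e s = n := by
    -- A supremum in `ℕ` is meaningful only for bounded sets; monotone jump times make `n` the
    -- greatest element.
    refine IsGreatest.csSup_eq ⟨h1, fun m hm => ?_⟩
    by_contra hlt
    have hm' : (jumpState U ε x y e m).time ≤ s := hm
    have := hmono (not_le.1 hlt : n + 1 ≤ m)
    simp only at this
    linarith
  simp only [process, hn]

end

end VelocityJump

namespace IsDoubleWell

open VelocityJump

variable {U : ℝ → ℝ} {x₀ x₁ x₂ ε : ℝ} {e : ℕ → ℝ}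

/-- Invariant of the jump chain: the `n`-th jump happens uphill of the bottom of the current well,
at the same `base`, and the downhill run from it ends at time `start n`. The two conjuncts about the
next jump follow from the others by `waitingTime_eq`, and they feed the induction. -/
theorem jumpState_spec (hU : IsDoubleWell U x₀ x₁ x₂) (hε : 0 < ε) (he : ∀ i, 0 < e i) (n : ℕ) :
    (jumpState U ε x₀ (-1) e n).vel = sgn n.bodd ∧
    base U x₀ x₂ n.bodd (jumpState U ε x₀ (-1) e n).pos =
      base U x₀ x₂ n.bodd (bottom x₀ x₂ (well U x₀ x₁ x₂ ε e n)) ∧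
    0 ≤ sgn n.bodd * (bottom x₀ x₂ (well U x₀ x₁ x₂ ε e n) -
      (jumpState U ε x₀ (-1) e n).pos) ∧
    (jumpState U ε x₀ (-1) e n).time = start U x₀ x₁ x₂ ε e n -
      sgn n.bodd * (bottom x₀ x₂ (well U x₀ x₁ x₂ ε e n) - (jumpState U ε x₀ (-1) e n).pos) ∧
    (jumpState U ε x₀ (-1) e (n + 1)).pos =
      target U x₀ x₂ n.bodd (well U x₀ x₁ x₂ ε e n) (ε * e n) ∧
    (jumpState U ε x₀ (-1) e (n + 1)).time = start U x₀ x₁ x₂ ε e n +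
      |target U x₀ x₂ n.bodd (well U x₀ x₁ x₂ ε e n) (ε * e n) -
        bottom x₀ x₂ (well U x₀ x₁ x₂ ε e n)| := by
  have hnext : ∀ n, (jumpState U ε x₀ (-1) e n).vel = sgn n.bodd →
      base U x₀ x₂ n.bodd (jumpState U ε x₀ (-1) e n).pos =
        base U x₀ x₂ n.bodd (bottom x₀ x₂ (well U x₀ x₁ x₂ ε e n)) →
      (jumpState U ε x₀ (-1) e n).time = start U x₀ x₁ x₂ ε e n -
        sgn n.bodd * (bottom x₀ x₂ (well U x₀ x₁ x₂ ε e n) -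
          (jumpState U ε x₀ (-1) e n).pos) →
      (jumpState U ε x₀ (-1) e (n + 1)).pos =
        target U x₀ x₂ n.bodd (well U x₀ x₁ x₂ ε e n) (ε * e n) ∧
      (jumpState U ε x₀ (-1) e (n + 1)).time = start U x₀ x₁ x₂ ε e n +
        |target U x₀ x₂ n.bodd (well U x₀ x₁ x₂ ε e n) (ε * e n) -
          bottom x₀ x₂ (well U x₀ x₁ x₂ ε e n)| := by
    intro n hv hb ht
    have hw := hU.waitingTime_eq hε (he n) n.bodd (well U x₀ x₁ x₂ ε e n) hb
    rw [hU.abs_target_sub_bottom _ _ (mul_pos hε (he n))]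
    simp only [jumpState]
    rw [hv, hw, ht, ← mul_assoc, sgn_mul_self]
    constructor <;> ring
  induction n with
  | zero =>
    have h1 : (jumpState U ε x₀ (-1) e 0).vel = sgn (Nat.bodd 0) := by simp [jumpState, sgn]
    have h2 : base U x₀ x₂ (Nat.bodd 0) (jumpState U ε x₀ (-1) e 0).pos =
        base U x₀ x₂ (Nat.bodd 0) (bottom x₀ x₂ (well U x₀ x₁ x₂ ε e 0)) := rfl
    have h3 : bottom x₀ x₂ (well U x₀ x₁ x₂ ε e 0) - (jumpState U ε x₀ (-1) e 0).pos = 0 :=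
      sub_self x₀
    have h4 : (jumpState U ε x₀ (-1) e 0).time = start U x₀ x₁ x₂ ε e 0 -
        sgn (Nat.bodd 0) * (bottom x₀ x₂ (well U x₀ x₁ x₂ ε e 0) -
          (jumpState U ε x₀ (-1) e 0).pos) := by
      rw [h3, start_zero]
      simp [jumpState]
    exact ⟨h1, h2, by rw [h3, mul_zero], h4, hnext 0 h1 h2 h4⟩
  | succ n ih =>
    obtain ⟨hv, hb, -, -, hp, ht⟩ := ih
    have hh := mul_pos hε (he n)
    have h1 : (jumpState U ε x₀ (-1) e (n + 1)).vel = sgn (n + 1).bodd := by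
      rw [Nat.bodd_succ, sgn_not, ← hv]
      rfl
    have h2 : base U x₀ x₂ (n + 1).bodd (jumpState U ε x₀ (-1) e (n + 1)).pos =
        base U x₀ x₂ (n + 1).bodd (bottom x₀ x₂ (well U x₀ x₁ x₂ ε e (n + 1))) := by
      rw [hp, Nat.bodd_succ]
      exact hU.base_target _ _ hh
    have h3 : sgn (n + 1).bodd * (bottom x₀ x₂ (well U x₀ x₁ x₂ ε e (n + 1)) -
        (jumpState U ε x₀ (-1) e (n + 1)).pos) =
        |target U x₀ x₂ n.bodd (well U x₀ x₁ x₂ ε e n) (ε * e n) -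
          bottom x₀ x₂ (well U x₀ x₁ x₂ ε e (n + 1))| := by
      rw [hp, Nat.bodd_succ, sgn_not, well, hU.abs_target_sub_nextWell]
      ring
    have h4 : (jumpState U ε x₀ (-1) e (n + 1)).time = start U x₀ x₁ x₂ ε e (n + 1) -
        sgn (n + 1).bodd * (bottom x₀ x₂ (well U x₀ x₁ x₂ ε e (n + 1)) -
          (jumpState U ε x₀ (-1) e (n + 1)).pos) := by
      rw [h3, ht, start_succ, excursionTime, duration, well]
      ring
    exact ⟨h1, h2, by rw [h3]; positivity, h4, hnext _ h1 h2 h4⟩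

/-- Together with `start_lt_time`: jumps and starts of excursions interlace, so excursion `n`
consists of the end of flight `n` and the beginning of flight `n + 1`. -/
theorem time_le_start (hU : IsDoubleWell U x₀ x₁ x₂) (hε : 0 < ε) (he : ∀ i, 0 < e i) (n : ℕ) :
    (jumpState U ε x₀ (-1) e n).time ≤ start U x₀ x₁ x₂ ε e n := by
  obtain ⟨-, -, h3, h4, -⟩ := hU.jumpState_spec hε he n
  linarith

theorem start_lt_time (hU : IsDoubleWell U x₀ x₁ x₂) (hε : 0 < ε) (he : ∀ i, 0 < e i) (n : ℕ) :
    start U x₀ x₁ x₂ ε e n < (jumpState U ε x₀ (-1) e (n + 1)).time := by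
  obtain ⟨-, -, -, -, -, h4⟩ := hU.jumpState_spec hε he n
  rw [h4, hU.abs_target_sub_bottom _ _ (mul_pos hε (he n))]
  linarith [hU.sgn_mul_target_sub_bottom_pos n.bodd (well U x₀ x₁ x₂ ε e n) (mul_pos hε (he n))]

theorem monotone_time (hU : IsDoubleWell U x₀ x₁ x₂) (hε : 0 < ε) (he : ∀ i, 0 < e i) :
    Monotone fun i => (jumpState U ε x₀ (-1) e i).time :=
  monotone_nat_of_le_succ fun n =>
    (hU.time_le_start hε he n).trans (hU.start_lt_time hε he n).le

/-- Until the turning point, the process moves away from the bottom at unit speed. -/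
theorem process_of_lt_turn (hU : IsDoubleWell U x₀ x₁ x₂) (hε : 0 < ε) (he : ∀ i, 0 < e i)
    {n : ℕ} {s : ℝ} (h1 : start U x₀ x₁ x₂ ε e n ≤ s) (h2 : s < start U x₀ x₁ x₂ ε e n +
      |target U x₀ x₂ n.bodd (well U x₀ x₁ x₂ ε e n) (ε * e n) -
        bottom x₀ x₂ (well U x₀ x₁ x₂ ε e n)|) :
    (process U ε x₀ (-1) e s).1 = bottom x₀ x₂ (well U x₀ x₁ x₂ ε e n) +
      sgn n.bodd * (s - start U x₀ x₁ x₂ ε e n) := by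
  obtain ⟨hv, -, -, ht, -, ht'⟩ := hU.jumpState_spec hε he n
  rw [process_eq (hU.monotone_time hε he) ((hU.time_le_start hε he n).trans h1) (ht'.symm ▸ h2),
    hv, ht]
  linear_combination (bottom x₀ x₂ (well U x₀ x₁ x₂ ε e n) -
          (jumpState U ε x₀ (-1) e n).pos) * sgn_mul_self n.bodd

/-- During an excursion the process stays between the initial bottom and the turning point. -/
theorem process_mem (hU : IsDoubleWell U x₀ x₁ x₂) (hε : 0 < ε) (he : ∀ i, 0 < e i)
    {n : ℕ} {s : ℝ} (h1 : start U x₀ x₁ x₂ ε e n ≤ s) (h2 : s < start U x₀ x₁ x₂ ε e (n + 1)) :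
    (process U ε x₀ (-1) e s).1 ∈ Set.uIcc (bottom x₀ x₂ (well U x₀ x₁ x₂ ε e n))
      (target U x₀ x₂ n.bodd (well U x₀ x₁ x₂ ε e n) (ε * e n)) := by
  have hh := mul_pos hε (he n)
  have hpos := hU.sgn_mul_target_sub_bottom_pos n.bodd (well U x₀ x₁ x₂ ε e n) hh
  have habs := hU.abs_target_sub_bottom n.bodd (well U x₀ x₁ x₂ ε e n) hh
  have hmem : ∀ X, 0 ≤ sgn n.bodd * (X - bottom x₀ x₂ (well U x₀ x₁ x₂ ε e n)) →
      0 ≤ sgn n.bodd * (target U x₀ x₂ n.bodd (well U x₀ x₁ x₂ ε e n) (ε * e n) - X) →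
      X ∈ Set.uIcc (bottom x₀ x₂ (well U x₀ x₁ x₂ ε e n))
        (target U x₀ x₂ n.bodd (well U x₀ x₁ x₂ ε e n) (ε * e n)) := by
    intro X hX1 hX2
    cases hd : n.bodd
    · rw [hd] at hX1 hX2
      simp only [sgn, cond_false] at hX1 hX2
      exact Set.mem_uIcc_of_ge (by linarith) (by linarith)
    · rw [hd] at hX1 hX2
      simp only [sgn, cond_true] at hX1 hX2
      exact Set.mem_uIcc_of_le (by linarith) (by linarith)
  have hss := sgn_mul_self n.bodd
  rcases lt_or_ge s (start U x₀ x₁ x₂ ε e n +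
      |target U x₀ x₂ n.bodd (well U x₀ x₁ x₂ ε e n) (ε * e n) -
        bottom x₀ x₂ (well U x₀ x₁ x₂ ε e n)|) with h | h
  · rw [hU.process_of_lt_turn hε he h1 h]
    apply hmem
    · rw [add_sub_cancel_left, ← mul_assoc, hss]
      linarith
    · rw [← sub_sub, mul_sub, ← mul_assoc, hss]
      linarith
  · obtain ⟨-, -, -, -, hp, ht⟩ := hU.jumpState_spec hε he n
    obtain ⟨hv', -, h3', ht', -, -⟩ := hU.jumpState_spec hε he (n + 1)
    have hnn := hU.sgn_mul_target_sub_nextWell_nonneg n.bodd (well U x₀ x₁ x₂ ε e n) (ε * e n)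
    have habs' := hU.abs_target_sub_nextWell n.bodd (well U x₀ x₁ x₂ ε e n) (ε * e n)
    -- On the return leg the process is already governed by jump state `n + 1`, whose flight
    -- outlasts the excursion.
    have hlt : s < (jumpState U ε x₀ (-1) e (n + 1 + 1)).time :=
      h2.trans (hU.start_lt_time hε he (n + 1))
    have hs2 := h2
    rw [start_succ, excursionTime, duration, habs, habs'] at hs2
    -- A flight either stays in its well or changes well in its own direction, so the final bottom
    -- is never behind the initial one.
    have hbb : 0 ≤ sgn n.bodd * (bottom x₀ x₂ (nextWell U x₀ x₁ x₂ n.bodd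
        (well U x₀ x₁ x₂ ε e n) (ε * e n)) - bottom x₀ x₂ (well U x₀ x₁ x₂ ε e n)) := by
      have hx := hU.lt
      cases hd : n.bodd <;> cases hw : well U x₀ x₁ x₂ ε e n
      · rw [hU.nextWell_false_false hh, sub_self, mul_zero]
      · cases nextWell U x₀ x₁ x₂ false true (ε * e n) <;> simp [sgn, bottom, hx.le]
      · cases nextWell U x₀ x₁ x₂ true false (ε * e n) <;> simp [sgn, bottom, hx.le]
      · rw [hU.nextWell_true_true hh, sub_self, mul_zero]
    rw [process_eq (hU.monotone_time hε he) (ht.symm ▸ h) hlt, hv', hp, ht, Nat.bodd_succ, sgn_not]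
    rw [habs] at h ⊢
    apply hmem
    · linear_combination hs2.le + hbb +
        (s - (start U x₀ x₁ x₂ ε e n + sgn n.bodd *
          (target U x₀ x₂ n.bodd (well U x₀ x₁ x₂ ε e n) (ε * e n) -
            bottom x₀ x₂ (well U x₀ x₁ x₂ ε e n)))) * hss
    · linear_combination h - (s - (start U x₀ x₁ x₂ ε e n + sgn n.bodd *
          (target U x₀ x₂ n.bodd (well U x₀ x₁ x₂ ε e n) (ε * e n) -
            bottom x₀ x₂ (well U x₀ x₁ x₂ ε e n)))) * hss

end IsDoubleWell


/-! ### The first transition, along a fixed sequence of clocks -/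

namespace VelocityJump

noncomputable section

/-- The duration of the `n`-th excursion from the left well if it does not leave that well,
and zero otherwise. -/
def trappedTime (U : ℝ → ℝ) (x₀ x₁ x₂ ε : ℝ) (n : ℕ) (e : ℝ) : ℝ :=
  if n.bodd = true ∧ U x₁ - U x₀ < ε * e then 0 else duration U x₀ x₁ x₂ n.bodd false (ε * e)

/-- The process has made no transition from left to right by time `s`. -/
def Trapped (U : ℝ → ℝ) (x₀ x₁ x₂ ε : ℝ) (e : ℕ → ℝ) (s : ℝ) : Prop :=
  ∀ k : ℕ, k.bodd = true → start U x₀ x₁ x₂ ε e k ≤ s → ε * e k ≤ U x₁ - U x₀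

/-- The first `j` right-moving flights do not leave the left well. -/
def Fails (U : ℝ → ℝ) (x₀ x₁ ε : ℝ) (e : ℕ → ℝ) (j : ℕ) : Prop :=
  ∀ i < j, ε * e (2 * i + 1) ≤ U x₁ - U x₀

theorem trappedTime_nonneg (U : ℝ → ℝ) (x₀ x₁ x₂ ε : ℝ) (n : ℕ) (e : ℝ) :
    0 ≤ trappedTime U x₀ x₁ x₂ ε n e := by
  unfold trappedTime
  split_ifs
  · exact le_rfl
  · exact duration_nonneg _ _ _ _ _ _ _

open Classical in
/-- The time spent in complete excursions from the left well before the first transition. -/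
def escapeTime (U : ℝ → ℝ) (x₀ x₁ x₂ ε : ℝ) (e : ℕ → ℝ) : ℝ≥0∞ :=
  ∑' j, if Fails U x₀ x₁ ε e j then ENNReal.ofReal (trappedTime U x₀ x₁ x₂ ε (2 * j) (e (2 * j)) +
    trappedTime U x₀ x₁ x₂ ε (2 * j + 1) (e (2 * j + 1))) else 0

end

end VelocityJump

namespace IsDoubleWell

open VelocityJump

variable {U : ℝ → ℝ} {x₀ x₁ x₂ ε : ℝ} {e : ℕ → ℝ}

/-- Left-moving flights cannot leave the left well, so only the clocks of odd index have to be
restricted. -/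
theorem well_eq_false (hU : IsDoubleWell U x₀ x₁ x₂) (hε : 0 < ε) (he : ∀ i, 0 < e i) {n : ℕ}
    (h : ∀ k < n, k.bodd = true → ε * e k ≤ U x₁ - U x₀) : well U x₀ x₁ x₂ ε e n = false := by
  induction n with
  | zero => rfl
  | succ n ih =>
    rw [well, ih fun k hk => h k (hk.trans n.lt_succ_self)]
    cases hd : n.bodd
    · exact hU.nextWell_false_false (mul_pos hε (he n))
    · rw [hU.nextWell_true_false]
      simpa using h n n.lt_succ_self hd

/-- The crossing flight ends in the right well wherever it started, and afterwards only a
left-moving climb above the higher barrier `U x₁ - U x₂` could undo it. -/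
theorem well_eq_true (hU : IsDoubleWell U x₀ x₁ x₂) (hε : 0 < ε) (he : ∀ i, 0 < e i) {k n : ℕ}
    (hkn : k < n) (hk : k.bodd = true) (hc : U x₁ - U x₀ < ε * e k)
    (h : ∀ j < n, ε * e j ≤ U x₁ - U x₂) : well U x₀ x₁ x₂ ε e n = true := by
  induction n, hkn using Nat.le_induction with
  | base =>
    rw [well, hk]
    cases well U x₀ x₁ x₂ ε e k
    · rw [hU.nextWell_true_false]
      simpa using hc
    · exact hU.nextWell_true_true (mul_pos hε (he k))
  | succ n _ ih =>
    rw [well, ih fun j hj => h j (hj.trans n.lt_succ_self)]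
    cases n.bodd
    · rw [hU.nextWell_false_true]
      simpa using h n n.lt_succ_self
    · exact hU.nextWell_true_true (mul_pos hε (he n))

theorem abs_process_sub_le (hU : IsDoubleWell U x₀ x₁ x₂) (hε : 0 < ε) (he : ∀ i, 0 < e i)
    {n : ℕ} {s : ℝ} (h1 : start U x₀ x₁ x₂ ε e n ≤ s) (h2 : s < start U x₀ x₁ x₂ ε e (n + 1)) :
    |(process U ε x₀ (-1) e s).1 - bottom x₀ x₂ (well U x₀ x₁ x₂ ε e n)| ≤
      |target U x₀ x₂ n.bodd (well U x₀ x₁ x₂ ε e n) (ε * e n) -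
        bottom x₀ x₂ (well U x₀ x₁ x₂ ε e n)| :=
  Set.abs_sub_left_of_mem_uIcc (hU.process_mem hε he h1 h2)

open Classical in
/-- The distance to the lower bottom is determined by `Trapped` up to errors that come from the
width of typical excursions, from returns, and from an untypical current excursion. -/
theorem abs_dist_sub_le (hU : IsDoubleWell U x₀ x₁ x₂) (hε : 0 < ε) (hε1 : ε ≤ 1)
    (he : ∀ i, 0 < e i) (htop : Tendsto (start U x₀ x₁ x₂ ε e) atTop atTop) {s : ℝ} (hs : 0 ≤ s)
    {δ η C : ℝ} (hη : η < U x₁ - U x₀)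
    (hnear : ∀ d w h, 0 < h → h ≤ η → |target U x₀ x₂ d w h - bottom x₀ x₂ w| ≤ δ)
    (hC0 : 0 ≤ C)
    (hC : ∀ d w w' h, 0 < h → |target U x₀ x₂ d w h - bottom x₀ x₂ w'| ≤ C * (1 + h))
    (hCL : x₂ - x₀ ≤ C) :
    ENNReal.ofReal |(|(process U ε x₀ (-1) e s).1 - x₂|) -
        (if Trapped U x₀ x₁ x₂ ε e s then x₂ - x₀ else 0)| ≤
      ENNReal.ofReal δ +
      (∑' k, if start U x₀ x₁ x₂ ε e k ≤ s ∧ U x₁ - U x₂ < ε * e k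
        then ENNReal.ofReal (x₂ - x₀) else 0) +
      ∑' k, if (s - 2 * C * (1 + e k) < start U x₀ x₁ x₂ ε e k ∧ start U x₀ x₁ x₂ ε e k ≤ s) ∧
        η < ε * e k then ENNReal.ofReal (2 * C * (1 + e k)) else 0 := by
  obtain ⟨n, h1, h2⟩ := exists_start_le_lt htop hs
  have hh := mul_pos hε (he n)
  have hlt := hU.lt
  set X := (process U ε x₀ (-1) e s).1 with hX
  set w := well U x₀ x₁ x₂ ε e n with hw
  have hXb : |X - bottom x₀ x₂ w| ≤ _ := hU.abs_process_sub_le hε he h1 h2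
  have hb : |bottom x₀ x₂ w - x₂| ≤ x₂ - x₀ := by
    have := hU.bottom_mem w
    rw [abs_le]
    constructor <;> linarith
  have hX2 : |X - x₂| ≤ |X - bottom x₀ x₂ w| + (x₂ - x₀) :=
    (abs_sub_le X (bottom x₀ x₂ w) x₂).trans (by linarith)
  -- Used in both exceptional cases, where nothing is known about the well.
  have hcrude : |(|X - x₂|) - (if Trapped U x₀ x₁ x₂ ε e s then x₂ - x₀ else 0)| ≤
      |X - bottom x₀ x₂ w| + (x₂ - x₀) := by
    have h0 := abs_nonneg (X - x₂)
    have h0' := abs_nonneg (X - bottom x₀ x₂ w)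
    split_ifs <;> rw [abs_le] <;> constructor <;> linarith
  -- If the current clock is untypical, the error is charged to the term `n` of the last series: the
  -- excursion lasts at most `2 C (1 + e n)`, so its start lies in the window ending at `s`.
  by_cases hbad : η < ε * e n
  · refine le_trans ?_ le_add_self
    refine le_trans ?_ (ENNReal.le_tsum n)
    have hen : ε * e n ≤ e n := mul_le_of_le_one_left (he n).le hε1
    have hCe : C * (1 + ε * e n) ≤ C * (1 + e n) := mul_le_mul_of_nonneg_left (by linarith) hC0
    have hdur : s < start U x₀ x₁ x₂ ε e n + 2 * C * (1 + e n) := by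
      rw [start_succ, excursionTime, duration] at h2
      have h3 := hC n.bodd w w _ hh
      have h4 := hC n.bodd w (nextWell U x₀ x₁ x₂ n.bodd w (ε * e n)) _ hh
      linarith
    refine le_trans ?_ (if_pos ⟨⟨by linarith, h1⟩, hbad⟩).ge
    refine ENNReal.ofReal_le_ofReal (hcrude.trans ?_)
    have h3 := hC n.bodd w w _ hh
    have h5 : 0 ≤ C * e n := mul_nonneg hC0 (he n).le
    linarith
  · have hXδ := hXb.trans (hnear n.bodd w _ hh (not_lt.1 hbad))
    refine le_trans ?_ le_self_add
    by_cases hret : ∃ k, start U x₀ x₁ x₂ ε e k ≤ s ∧ U x₁ - U x₂ < ε * e k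
    · obtain ⟨k, hk⟩ := hret
      refine le_trans ?_ (add_le_add_right (ENNReal.le_tsum k) _)
      rw [if_pos hk, ← ENNReal.ofReal_add ((abs_nonneg _).trans hXδ) (by linarith)]
      exact ENNReal.ofReal_le_ofReal (hcrude.trans (by linarith))
    · refine le_trans (ENNReal.ofReal_le_ofReal ?_) le_self_add
      push Not at hret
      have hstart : ∀ k < n, start U x₀ x₁ x₂ ε e k ≤ s := fun k hk =>
        (monotone_start U x₀ x₁ x₂ ε e hk.le).trans h1
      by_cases hA : Trapped U x₀ x₁ x₂ ε e s
      · have hwf : w = false :=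
          hU.well_eq_false hε he fun k hk hodd => hA k hodd (hstart k hk)
        rw [hwf] at hXδ
        rw [if_pos hA]
        simp only [bottom, cond_false] at hXδ
        have h3 : x₂ - x₀ = |x₀ - x₂| := by rw [abs_of_neg] <;> linarith
        rw [h3]
        refine (abs_abs_sub_abs_le _ _).trans ?_
        rwa [sub_sub_sub_cancel_right]
      · have hA' := hA
        unfold Trapped at hA'
        push Not at hA'
        obtain ⟨k, hodd, hks, hck⟩ := hA'
        -- The crossing cannot be the current excursion, since a climb above the barrier would
        -- exceed `η`.
        have hkn : k < n := by
          rcases lt_trichotomy k n with h | h | h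
          · exact h
          · rw [h] at hck
            linarith
          · have := monotone_start U x₀ x₁ x₂ ε e (Nat.succ_le_of_lt h)
            simp only [Nat.succ_eq_add_one] at this
            linarith
        have hwt : w = true :=
          hU.well_eq_true hε he hkn hodd hck fun j hj => hret j (hstart j hj)
        rw [hwt] at hXδ
        rw [if_neg hA, sub_zero, abs_abs]
        exact hXδ

/-- As long as no crossing occurs, the initial well is always the left one, so each duration is a
function of its own clock and the starting time becomes a sum of independent variables. -/
theorem start_eq_sum (hU : IsDoubleWell U x₀ x₁ x₂) (hε : 0 < ε) (he : ∀ i, 0 < e i) {n : ℕ}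
    (h : ∀ k < n, k.bodd = true → ε * e k ≤ U x₁ - U x₀) :
    start U x₀ x₁ x₂ ε e n = ∑ k ∈ Finset.range n, trappedTime U x₀ x₁ x₂ ε k (e k) := by
  refine Finset.sum_congr rfl fun k hk => ?_
  rw [Finset.mem_range] at hk
  rw [excursionTime, hU.well_eq_false hε he fun j hj => h j (hj.trans hk), trappedTime, if_neg]
  rintro ⟨h1, h2⟩
  exact absurd (h k hk h1) (not_le.2 h2)

end IsDoubleWell

namespace VelocityJump

variable {U : ℝ → ℝ} {x₀ x₁ x₂ ε : ℝ} {e : ℕ → ℝ}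

theorem Fails.le_of_bodd {j : ℕ} (h : Fails U x₀ x₁ ε e j) {k : ℕ} (hk : k < 2 * j + 1)
    (hodd : k.bodd = true) : ε * e k ≤ U x₁ - U x₀ := by
  have h2 := Nat.bodd_add_div2 k
  rw [hodd] at h2
  simp only [Bool.toNat_true] at h2
  rw [show k = 2 * k.div2 + 1 by omega]
  exact h _ (by omega)

theorem exists_fails_of_crossing {k : ℕ} (hodd : k.bodd = true) (hk : U x₁ - U x₀ < ε * e k) :
    ∃ j, 2 * j + 1 ≤ k ∧ Fails U x₀ x₁ ε e j ∧ U x₁ - U x₀ < ε * e (2 * j + 1) := by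
  classical
  have h2 := Nat.bodd_add_div2 k
  rw [hodd] at h2
  simp only [Bool.toNat_true] at h2
  have hex : ∃ j, U x₁ - U x₀ < ε * e (2 * j + 1) := ⟨k.div2, by
    rwa [show 2 * k.div2 + 1 = k by omega]⟩
  refine ⟨Nat.find hex, ?_, fun i hi => not_lt.1 (Nat.find_min hex hi), Nat.find_spec hex⟩
  have : Nat.find hex ≤ k.div2 := Nat.find_min' hex (by rwa [show 2 * k.div2 + 1 = k by omega])
  omega

end VelocityJump

namespace IsDoubleWell

open VelocityJump

variable {U : ℝ → ℝ} {x₀ x₁ x₂ ε : ℝ} {e : ℕ → ℝ}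

/-- The terms after the round of the first crossing vanish because `Fails` breaks, and the crossing
excursion itself counts zero, so the series telescopes to the start of that excursion. -/
theorem escapeTime_eq (hU : IsDoubleWell U x₀ x₁ x₂) (hε : 0 < ε) (he : ∀ i, 0 < e i) {j : ℕ}
    (hj : Fails U x₀ x₁ ε e j) (hc : U x₁ - U x₀ < ε * e (2 * j + 1)) :
    escapeTime U x₀ x₁ x₂ ε e = ENNReal.ofReal (start U x₀ x₁ x₂ ε e (2 * j + 1)) := by
  classical
  rw [escapeTime, tsum_eq_sum (s := Finset.range (j + 1))]
  · have h0 : trappedTime U x₀ x₁ x₂ ε (2 * j + 1) (e (2 * j + 1)) = 0 := by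
      rw [trappedTime, if_pos ⟨by simp, hc⟩]
    have hpair : ∀ m, ∑ i ∈ Finset.range m, (trappedTime U x₀ x₁ x₂ ε (2 * i) (e (2 * i)) +
        trappedTime U x₀ x₁ x₂ ε (2 * i + 1) (e (2 * i + 1))) =
        ∑ k ∈ Finset.range (2 * m), trappedTime U x₀ x₁ x₂ ε k (e k) := by
      intro m
      induction m with
      | zero => simp
      | succ m ih =>
        rw [Finset.sum_range_succ, ih, Nat.mul_succ, Finset.sum_range_succ,
          Finset.sum_range_succ, add_assoc]
    rw [hU.start_eq_sum hε he fun k hk hodd => hj.le_of_bodd hk hodd]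
    have h1 : ∑ k ∈ Finset.range (2 * j + 1), trappedTime U x₀ x₁ x₂ ε k (e k) =
        ∑ k ∈ Finset.range (2 * (j + 1)), trappedTime U x₀ x₁ x₂ ε k (e k) := by
      rw [Nat.mul_succ, Finset.sum_range_succ _ (2 * j + 1), h0, add_zero]
    rw [h1, ← hpair, ENNReal.ofReal_sum_of_nonneg fun i _ =>
      add_nonneg (trappedTime_nonneg _ _ _ _ _ _ _) (trappedTime_nonneg _ _ _ _ _ _ _)]
    refine Finset.sum_congr rfl fun i hi => if_pos fun l hl => hj l ?_
    rw [Finset.mem_range] at hi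
    omega
  · intro i hi
    rw [Finset.mem_range, not_lt] at hi
    exact if_neg fun hf => absurd (hf j (by omega)) (not_le.2 hc)

/-- Earlier excursions turn before the top; the crossing one starts at `x₀` and passes `x₁` at unit
speed after the time `x₁ - x₀`. -/
theorem hittingTime_bounds (hU : IsDoubleWell U x₀ x₁ x₂) (hε : 0 < ε) (he : ∀ i, 0 < e i)
    (htop : Tendsto (start U x₀ x₁ x₂ ε e) atTop atTop) (hne : ∀ i, ε * e i ≠ U x₁ - U x₀)
    (hex : ∃ j, U x₁ - U x₀ < ε * e (2 * j + 1)) :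
    escapeTime U x₀ x₁ x₂ ε e ≤ hittingTime U ε x₀ (-1) e x₁ ∧
      hittingTime U ε x₀ (-1) e x₁ ≤ escapeTime U x₀ x₁ x₂ ε e + ENNReal.ofReal (x₁ - x₀) := by
  obtain ⟨i, hi⟩ := hex
  obtain ⟨j, -, hj, hc⟩ := exists_fails_of_crossing (by simp) hi
  have hl := hU.lt_left
  have hr := hU.lt_right
  have hwell : ∀ n < 2 * j + 2, well U x₀ x₁ x₂ ε e n = false := fun n hn =>
    hU.well_eq_false hε he fun k hk hodd => hj.le_of_bodd (by omega) hodd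
  rw [hU.escapeTime_eq hε he hj hc]
  constructor
  · refine le_iInf₂ fun s hs => ENNReal.ofReal_le_ofReal ?_
    obtain ⟨hs0, hs1⟩ := hs
    by_contra hlt
    obtain ⟨n, h1, h2⟩ := exists_start_le_lt htop hs0.le
    have hn : n < 2 * j + 1 := by
      by_contra hge
      linarith [monotone_start U x₀ x₁ x₂ ε e (not_lt.1 hge)]
    have hmem := hU.process_mem hε he h1 h2
    have hh := mul_pos hε (he n)
    rw [hs1, hwell n (by omega)] at hmem
    cases hd : n.bodd
    · rw [hd] at hmem
      have := hU.sgn_mul_target_sub_bottom_pos false false hh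
      simp only [sgn, cond_false, bottom] at this hmem
      rw [Set.uIcc_of_ge (by linarith)] at hmem
      linarith [hmem.2]
    · rw [hd] at hmem
      -- A climb exactly equal to the barrier would turn at `x₁` and hit it early; `hne` excludes
      -- this.
      have h3 := hU.target_lt_barrier hh.le (lt_of_le_of_ne (hj.le_of_bodd hn hd) (hne n))
      have := hU.sgn_mul_target_sub_bottom_pos true false hh
      simp only [sgn, cond_false, cond_true, bottom] at this hmem
      rw [Set.uIcc_of_le (by linarith)] at hmem
      linarith [hmem.2]
  · have hs0 := start_nonneg U x₀ x₁ x₂ ε e (2 * j + 1)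
    rw [← ENNReal.ofReal_add hs0 (by linarith)]
    refine iInf₂_le _ ⟨by linarith, ?_⟩
    have hw := hwell (2 * j + 1) (by omega)
    have hd : (2 * j + 1).bodd = true := by simp
    have htar := hU.lt_target_of_barrier_lt hc
    rw [hU.process_of_lt_turn hε he (n := 2 * j + 1) (by linarith), hw, hd]
    · simp only [bottom, sgn, cond_true, cond_false]
      ring
    · rw [hw, hd, add_lt_add_iff_left]
      refine lt_of_lt_of_le ?_ (le_abs_self _)
      simp only [bottom, cond_false]
      linarith

/-- With `fails_or_of_trapped`, this compares `Trapped` with the explicit event `Fails j`, up to a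
deviation of a sum of independent durations. -/
theorem trapped_of_fails (hU : IsDoubleWell U x₀ x₁ x₂) (hε : 0 < ε) (he : ∀ i, 0 < e i) {j : ℕ}
    {s : ℝ} (hj : Fails U x₀ x₁ ε e j)
    (hs : s < ∑ k ∈ Finset.range (2 * j), trappedTime U x₀ x₁ x₂ ε k (e k)) :
    Trapped U x₀ x₁ x₂ ε e s := by
  intro k hodd hk
  rcases lt_or_ge k (2 * j + 1) with h | h
  · exact hj.le_of_bodd h hodd
  · rw [← hU.start_eq_sum hε he fun k hk hodd => hj.le_of_bodd (by omega) hodd] at hs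
    linarith [monotone_start U x₀ x₁ x₂ ε e (show 2 * j ≤ k by omega)]

/-- If one of the first `j` attempts succeeds, the first success starts after fewer summands than
the full sum; if that sum is at most `s`, the crossing has started by time `s`. -/
theorem fails_or_of_trapped (hU : IsDoubleWell U x₀ x₁ x₂) (hε : 0 < ε) (he : ∀ i, 0 < e i)
    {s : ℝ} (hs : Trapped U x₀ x₁ x₂ ε e s) (j : ℕ) :
    Fails U x₀ x₁ ε e j ∨
      s < ∑ k ∈ Finset.range (2 * j), trappedTime U x₀ x₁ x₂ ε k (e k) := by
  by_contra hcon
  push Not at hcon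
  obtain ⟨h1, h2⟩ := hcon
  unfold Fails at h1
  push Not at h1
  obtain ⟨i, hij, hi⟩ := h1
  obtain ⟨l, hl, hfl, hc⟩ := exists_fails_of_crossing (by simp) hi
  refine absurd (hs (2 * l + 1) (by simp) ?_) (not_le.2 hc)
  rw [hU.start_eq_sum hε he fun k hk hodd => hfl.le_of_bodd hk hodd]
  refine le_trans (Finset.sum_le_sum_of_subset_of_nonneg ?_ fun k _ _ =>
    trappedTime_nonneg _ _ _ _ _ _ _) h2
  exact Finset.range_subset_range.2 (by omega)

end IsDoubleWell


/-! ### Standard exponential clocks -/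

namespace VelocityJump

theorem expMeasure_Ioi {x : ℝ} (hx : 0 ≤ x) :
    expMeasure 1 (Set.Ioi x) = ENNReal.ofReal (Real.exp (-x)) := by
  have := isProbabilityMeasure_expMeasure one_pos
  have h : (expMeasure 1).real (Set.Iic x) = 1 - Real.exp (-x) := by
    rw [← cdf_eq_real, cdf_expMeasure_eq one_pos, if_pos hx, one_mul]
  have h2 : (expMeasure 1).real (Set.Ioi x) = Real.exp (-x) := by
    rw [← Set.compl_Iic, measureReal_compl measurableSet_Iic, h, probReal_univ]
    ring
  rw [← h2, ofReal_measureReal]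

instance isProbabilityMeasure_expMeasure_one : IsProbabilityMeasure (expMeasure 1) := isProbabilityMeasure_expMeasure one_pos

instance nullSingletonClass_expMeasure_one : NullSingletonClass (expMeasure 1) := by
  unfold expMeasure gammaMeasure
  exact ⟨fun x => withDensity_absolutelyContinuous _ _ (measure_singleton x)⟩

theorem expMeasure_Ici {x : ℝ} (hx : 0 ≤ x) :
    expMeasure 1 (Set.Ici x) = ENNReal.ofReal (Real.exp (-x)) := by
  rw [← expMeasure_Ioi hx, measure_congr Ioi_ae_eq_Ici]

theorem expMeasure_ae_pos : ∀ᵐ x ∂expMeasure 1, 0 < x := by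
  rw [ae_iff]
  simp only [not_lt]
  change expMeasure 1 (Set.Iic 0) = 0
  rw [← ofReal_measureReal, ← cdf_eq_real, cdf_expMeasure_eq one_pos]
  simp

/-- The fourth moment suffices throughout: it dominates the squared durations and the size-biased
weights of untypical excursions. -/
theorem integrable_one_add_pow_four_expMeasure :
    Integrable (fun x : ℝ => (1 + x) ^ 4) (expMeasure 1) := by
  have h1 : IntegrableOn (fun x : ℝ => Real.exp (-x) * x ^ ((5 : ℝ) - 1)) (Set.Ioi 0) :=
    Real.GammaIntegral_convergent (by norm_num)
  have h2 : IntegrableOn (fun x : ℝ => Real.exp (-x) * x ^ ((1 : ℝ) - 1)) (Set.Ioi 0) :=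
    Real.GammaIntegral_convergent (by norm_num)
  have h3 : IntegrableOn (fun x : ℝ => Real.exp (-x) * (1 + x) ^ 4) (Set.Ioi 0) := by
    refine ((h1.add h2).const_mul 8).mono' (by fun_prop) ?_
    filter_upwards [ae_restrict_mem measurableSet_Ioi] with x hx
    have hx0 : (0 : ℝ) < x := hx
    rw [Real.norm_of_nonneg (by positivity)]
    have h4 : x ^ ((5 : ℝ) - 1) = x ^ 4 := by
      rw [show (5 : ℝ) - 1 = (4 : ℕ) by norm_num, Real.rpow_natCast]
    simp only [Pi.add_apply, h4, sub_self, Real.rpow_zero]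
    have : (1 + x) ^ 4 ≤ 8 * (x ^ 4 + 1) := by
      nlinarith [sq_nonneg (x - 1), sq_nonneg (x ^ 2 - 1), sq_nonneg (x + 1),
        mul_nonneg (sq_nonneg (x - 1)) (sq_nonneg (x + 1)),
        mul_nonneg (sq_nonneg (x - 1)) (sq_nonneg x), sq_nonneg (x ^ 2 - x)]
    have h5 := mul_le_mul_of_nonneg_left this (Real.exp_pos (-x)).le
    linarith
  have h4 : IntegrableOn (fun x : ℝ => Real.exp (-x) * (1 + x) ^ 4) (Set.Ici 0) :=
    (integrableOn_Ici_iff_integrableOn_Ioi).2 h3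
  rw [expMeasure, gammaMeasure, integrable_withDensity_iff (f := gammaPDF 1 1)
    (measurable_gammaPDFReal 1 1).ennreal_ofReal (Eventually.of_forall fun _ => ENNReal.ofReal_lt_top)]
  refine (h4.integrable_indicator measurableSet_Ici).congr (Eventually.of_forall fun x => ?_)
  have h5 : gammaPDF 1 1 x = ENNReal.ofReal (if 0 ≤ x then 1 * Real.exp (-(1 * x)) else 0) :=
    exponentialPDF_eq 1 x
  simp only [h5]
  by_cases hx : 0 ≤ x
  · rw [Set.indicator_of_mem (by exact hx), if_pos hx, ENNReal.toReal_ofReal (by positivity)]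
    simp only [one_mul]
    ring
  · rw [Set.indicator_of_notMem (by exact hx), if_neg hx]
    simp

theorem lintegral_one_add_pow_four_lt_top :
    ∫⁻ x, ENNReal.ofReal ((1 + x) ^ 4) ∂expMeasure 1 < ∞ :=
  integrable_one_add_pow_four_expMeasure.lintegral_lt_top

/-- A sequence of independent standard exponential clocks. -/
structure IsClock {Ω : Type*} [MeasurableSpace Ω] (P : Measure Ω) (E : ℕ → Ω → ℝ) : Prop where
  isProb : IsProbabilityMeasure P
  measurable : ∀ k, Measurable (E k)
  indep : iIndepFun E P
  map_eq : ∀ k, P.map (E k) = expMeasure 1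

namespace IsClock

variable {Ω : Type*} [MeasurableSpace Ω] {P : Measure Ω} {E : ℕ → Ω → ℝ}

theorem ae_of_ae (hE : IsClock P E) (k : ℕ) {p : ℝ → Prop} (h : ∀ᵐ x ∂expMeasure 1, p x) :
    ∀ᵐ ω ∂P, p (E k ω) := by
  rw [← hE.map_eq k] at h
  exact ae_of_ae_map (hE.measurable k).aemeasurable h

theorem ae_pos (hE : IsClock P E) : ∀ᵐ ω ∂P, ∀ k, 0 < E k ω :=
  ae_all_iff.2 fun k => hE.ae_of_ae k expMeasure_ae_pos

theorem ae_ne (hE : IsClock P E) (a : ℝ) : ∀ᵐ ω ∂P, ∀ k, E k ω ≠ a :=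
  ae_all_iff.2 fun k => hE.ae_of_ae k (compl_mem_ae_iff.2 (measure_singleton a))

theorem lintegral_comp (hE : IsClock P E) (k : ℕ) {φ : ℝ → ℝ≥0∞} (hφ : Measurable φ) :
    ∫⁻ ω, φ (E k ω) ∂P = ∫⁻ x, φ x ∂expMeasure 1 := by
  rw [← hE.map_eq k, lintegral_map hφ (hE.measurable k)]

theorem measure_preimage (hE : IsClock P E) (k : ℕ) {s : Set ℝ} (hs : MeasurableSet s) :
    P (E k ⁻¹' s) = expMeasure 1 s := by
  rw [← hE.map_eq k, Measure.map_apply (hE.measurable k) hs]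

end IsClock

end VelocityJump


/-! ### Renewal bound for the starts of excursions -/

namespace VelocityJump

variable {Ω : Type*} {E : ℕ → Ω → ℝ}
  {U : ℝ → ℝ} {x₀ x₁ x₂ ε : ℝ}

theorem measurable_excursion {α : Type*} [MeasurableSpace α] (hU : IsDoubleWell U x₀ x₁ x₂) (d : Bool)
    {w : α → Bool} {h : α → ℝ} (hw : Measurable w) (hh : Measurable h) :
    Measurable (fun a => nextWell U x₀ x₁ x₂ d (w a) (h a)) ∧
      Measurable (fun a => duration U x₀ x₁ x₂ d (w a) (h a)) := by
  have h0 : Measurable fun a => (w a, h a) := hw.prodMk hh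
  have h1 : Measurable fun p : Bool × ℝ => nextWell U x₀ x₁ x₂ d p.1 p.2 := by
    apply measurable_from_prod_countable_right
    intro w
    have := IsDoubleWell.measurable_nextWell U x₀ x₁ x₂ d w
    exact this
  have h2 : Measurable fun p : Bool × ℝ => duration U x₀ x₁ x₂ d p.1 p.2 := by
    apply measurable_from_prod_countable_right
    intro w
    have := hU.measurable_duration d w
    exact this
  have h3 := h1.comp h0
  have h4 := h2.comp h0
  exact ⟨h3, h4⟩

/-- Predictability: only clocks of index below `n` are involved. Stated for the σ-algebra of the
past, it yields the independence of `start n` and `E n`. -/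
theorem measurable_well_start (hU : IsDoubleWell U x₀ x₁ x₂) (ε : ℝ) (n : ℕ) :
    Measurable[⨆ i ∈ Set.Iio n, MeasurableSpace.comap (E i) inferInstance]
      (fun ω => well U x₀ x₁ x₂ ε (fun k => E k ω) n) ∧
    Measurable[⨆ i ∈ Set.Iio n, MeasurableSpace.comap (E i) inferInstance]
      (fun ω => start U x₀ x₁ x₂ ε (fun k => E k ω) n) := by
  induction n with
  | zero => exact ⟨measurable_const, measurable_const⟩
  | succ n ih =>
    have hle : (⨆ i ∈ Set.Iio n, MeasurableSpace.comap (E i) inferInstance) ≤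
        ⨆ i ∈ Set.Iio (n + 1), MeasurableSpace.comap (E i) inferInstance :=
      biSup_mono fun i hi => Set.mem_Iio.2 ((Set.mem_Iio.1 hi).trans n.lt_succ_self)
    have hle' : MeasurableSpace.comap (E n) inferInstance ≤
        ⨆ i ∈ Set.Iio (n + 1), MeasurableSpace.comap (E i) inferInstance :=
      le_biSup (fun i => MeasurableSpace.comap (E i) inferInstance)
        (Set.mem_Iio.2 n.lt_succ_self)
    have key : ∀ m : MeasurableSpace Ω,
        Measurable[m] (fun ω => well U x₀ x₁ x₂ ε (fun k => E k ω) n) →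
        Measurable[m] (fun ω => start U x₀ x₁ x₂ ε (fun k => E k ω) n) → Measurable[m] (E n) →
        Measurable[m] (fun ω => well U x₀ x₁ x₂ ε (fun k => E k ω) (n + 1)) ∧
        Measurable[m] (fun ω => start U x₀ x₁ x₂ ε (fun k => E k ω) (n + 1)) := by
      intro m h1 h2 h3
      obtain ⟨h4, h5⟩ := measurable_excursion hU n.bodd h1 (h3.const_mul ε)
      refine ⟨h4, ?_⟩
      simp only [start_succ]
      exact h2.add h5
    exact key _ (ih.1.mono hle le_rfl) (ih.2.mono hle le_rfl)
      ((comap_measurable (E n)).mono hle' le_rfl)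

variable [MeasurableSpace Ω] {P : Measure Ω}

theorem IsClock.measurable_well (hE : IsClock P E) (hU : IsDoubleWell U x₀ x₁ x₂) (ε : ℝ) (n : ℕ) :
    Measurable (fun ω => well U x₀ x₁ x₂ ε (fun k => E k ω) n) :=
  (measurable_well_start hU ε n).1.mono (iSup₂_le fun i _ => (hE.measurable i).comap_le) le_rfl

theorem IsClock.measurable_start (hE : IsClock P E) (hU : IsDoubleWell U x₀ x₁ x₂) (ε : ℝ) (n : ℕ) :
    Measurable (fun ω => start U x₀ x₁ x₂ ε (fun k => E k ω) n) :=
  (measurable_well_start hU ε n).2.mono (iSup₂_le fun i _ => (hE.measurable i).comap_le) le_rfl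

theorem IsClock.indepFun_start (hE : IsClock P E) (hU : IsDoubleWell U x₀ x₁ x₂) (ε : ℝ) (n : ℕ) :
    IndepFun (fun ω => start U x₀ x₁ x₂ ε (fun k => E k ω) n) (E n) P := by
  rw [IndepFun_iff_Indep]
  have h : Indep (⨆ i ∈ Set.Iio n, MeasurableSpace.comap (E i) inferInstance)
      (⨆ i ∈ ({n} : Set ℕ), MeasurableSpace.comap (E i) inferInstance) P :=
    indep_iSup_of_disjoint (fun i => (hE.measurable i).comap_le) hE.indep.iIndep (by simp)
  refine indep_of_indep_of_le_left (indep_of_indep_of_le_right h ?_)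
    (measurable_well_start hU ε n).2.comap_le
  exact le_biSup (fun i => MeasurableSpace.comap (E i) inferInstance) (Set.mem_singleton n)

theorem IsClock.lintegral_start (hE : IsClock P E) (hU : IsDoubleWell U x₀ x₁ x₂) (ε : ℝ) (n : ℕ)
    {φ : ℝ × ℝ → ℝ≥0∞} (hφ : Measurable φ) :
    ∫⁻ ω, φ (start U x₀ x₁ x₂ ε (fun k => E k ω) n, E n ω) ∂P =
      ∫⁻ x, ∫⁻ ω, φ (start U x₀ x₁ x₂ ε (fun k => E k ω) n, x) ∂P ∂expMeasure 1 := by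
  have := hE.isProb
  have hS := hE.measurable_start hU ε n
  rw [← lintegral_map (g := fun ω => (start U x₀ x₁ x₂ ε (fun k => E k ω) n, E n ω)) hφ
    (hS.prodMk (hE.measurable n)),
    (indepFun_iff_map_prod_eq_prod_map_map hS.aemeasurable (hE.measurable n).aemeasurable).1
      (hE.indepFun_start hU ε n), hE.map_eq n, lintegral_prod_symm _ hφ.aemeasurable]
  refine lintegral_congr fun x => ?_
  exact lintegral_map (hφ.comp measurable_prodMk_right) hS

open Classical in
/-- A window of length `l` contains the starting times of at most `1 + l / ρ` excursions of
duration at least `ρ`. -/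
theorem sum_window_le {e : ℕ → ℝ} {ρ : ℝ} (hρ : 0 < ρ)
    (hlong : ∀ n, 1 ≤ e n → ρ ≤ excursionTime U x₀ x₁ x₂ ε e n) (t : ℝ) {l : ℝ} (hl : 0 ≤ l)
    (N : ℕ) :
    ∑ n ∈ Finset.range N, (if (t - l < start U x₀ x₁ x₂ ε e n ∧ start U x₀ x₁ x₂ ε e n ≤ t) ∧
      1 ≤ e n then (1 : ℝ) else 0) ≤ 1 + l / ρ := by
  -- Each counted excursion moves the starting time forward by at least `ρ`. The right-hand side
  -- measures the progress within the window, capped at `t + ρ` because the last counted excursion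
  -- may overshoot `t`.
  have key : ∑ n ∈ Finset.range N, (if (t - l < start U x₀ x₁ x₂ ε e n ∧
      start U x₀ x₁ x₂ ε e n ≤ t) ∧ 1 ≤ e n then ρ else 0) ≤
      max 0 (min (start U x₀ x₁ x₂ ε e N) (t + ρ) - (t - l)) := by
    induction N with
    | zero => simp
    | succ N ih =>
      rw [Finset.sum_range_succ]
      have hmono := monotone_start U x₀ x₁ x₂ ε e N.le_succ
      split_ifs with h
      · have h1 : start U x₀ x₁ x₂ ε e N + ρ ≤ start U x₀ x₁ x₂ ε e (N + 1) := by
          rw [start_succ]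
          linarith [hlong N h.2]
        rw [min_eq_left (by linarith [h.1.2]), max_eq_right (by linarith [h.1.1])] at ih
        refine le_max_of_le_right ?_
        rw [le_sub_iff_add_le]
        exact le_min (by linarith) (by linarith [h.1.2])
      · rw [add_zero]
        exact ih.trans (max_le_max_left _ (sub_le_sub_right (min_le_min_right _ hmono) _))
  have hsum : ∑ n ∈ Finset.range N, (if (t - l < start U x₀ x₁ x₂ ε e n ∧
      start U x₀ x₁ x₂ ε e n ≤ t) ∧ 1 ≤ e n then ρ else 0) =
      ρ * ∑ n ∈ Finset.range N, (if (t - l < start U x₀ x₁ x₂ ε e n ∧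
      start U x₀ x₁ x₂ ε e n ≤ t) ∧ 1 ≤ e n then (1 : ℝ) else 0) := by
    rw [Finset.mul_sum]
    exact Finset.sum_congr rfl fun n _ => by split_ifs <;> simp
  rw [hsum] at key
  have h2 : max 0 (min (start U x₀ x₁ x₂ ε e N) (t + ρ) - (t - l)) ≤ ρ + l :=
    max_le (by linarith) (by linarith [min_le_right (start U x₀ x₁ x₂ ε e N) (t + ρ)])
  rw [← mul_le_mul_iff_right₀ hρ, mul_add, mul_one, mul_div_cancel₀ _ hρ.ne']
  linarith

/-- Renewal bound: the expected number of excursions that start in a window of length `l`. -/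
theorem IsClock.tsum_measure_start_le (hE : IsClock P E) (hU : IsDoubleWell U x₀ x₁ x₂) {ρ : ℝ}
    (hρ : 0 < ρ)
    (hlong : ∀ ω n, 1 ≤ E n ω → ρ ≤ excursionTime U x₀ x₁ x₂ ε (fun k => E k ω) n) (t l : ℝ) :
    ∑' n, P {ω | t - l < start U x₀ x₁ x₂ ε (fun k => E k ω) n ∧
      start U x₀ x₁ x₂ ε (fun k => E k ω) n ≤ t} ≤ ENNReal.ofReal (Real.exp 1 * (1 + l / ρ)) := by
  classical
  have := hE.isProb
  rcases lt_or_ge l 0 with hl | hl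
  · refine (ENNReal.tsum_eq_zero.2 fun n => ?_).le.trans zero_le
    convert measure_empty (μ := P)
    ext ω
    simp only [Set.mem_ofPred_eq, Set.mem_empty_iff_false, iff_false, not_and, not_le]
    intro h
    linarith
  have hwin : ∀ n, MeasurableSet {ω | t - l < start U x₀ x₁ x₂ ε (fun k => E k ω) n ∧
      start U x₀ x₁ x₂ ε (fun k => E k ω) n ≤ t} := fun n =>
    hE.measurable_start hU ε n measurableSet_Ioc
  -- The clock of an excursion is independent of its start, so requiring `1 ≤ E n` thins the starts
  -- in the window by the factor `exp (-1)`; the thinned count is bounded pathwise by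
  -- `sum_window_le`.
  have hprod : ∀ n, P {ω | (t - l < start U x₀ x₁ x₂ ε (fun k => E k ω) n ∧
      start U x₀ x₁ x₂ ε (fun k => E k ω) n ≤ t) ∧ 1 ≤ E n ω} =
      P {ω | t - l < start U x₀ x₁ x₂ ε (fun k => E k ω) n ∧
      start U x₀ x₁ x₂ ε (fun k => E k ω) n ≤ t} * ENNReal.ofReal (Real.exp (-1)) := by
    intro n
    rw [← expMeasure_Ici zero_le_one, ← hE.measure_preimage n measurableSet_Ici]
    exact (hE.indepFun_start hU ε n).measure_inter_preimage_eq_mul (Set.Ioc (t - l) t)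
      (Set.Ici 1) measurableSet_Ioc measurableSet_Ici
  have hcount : ∑' n, P {ω | (t - l < start U x₀ x₁ x₂ ε (fun k => E k ω) n ∧
      start U x₀ x₁ x₂ ε (fun k => E k ω) n ≤ t) ∧ 1 ≤ E n ω} ≤ ENNReal.ofReal (1 + l / ρ) := by
    refine ENNReal.tsum_le_of_sum_range_le fun N => ?_
    have h1 : ∀ n, P {ω | (t - l < start U x₀ x₁ x₂ ε (fun k => E k ω) n ∧
      start U x₀ x₁ x₂ ε (fun k => E k ω) n ≤ t) ∧ 1 ≤ E n ω} =
      ∫⁻ ω, ENNReal.ofReal (if (t - l < start U x₀ x₁ x₂ ε (fun k => E k ω) n ∧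
      start U x₀ x₁ x₂ ε (fun k => E k ω) n ≤ t) ∧ 1 ≤ E n ω then 1 else 0) ∂P := by
      intro n
      have hs : MeasurableSet {ω | (t - l < start U x₀ x₁ x₂ ε (fun k => E k ω) n ∧
        start U x₀ x₁ x₂ ε (fun k => E k ω) n ≤ t) ∧ 1 ≤ E n ω} :=
        (hwin n).inter (hE.measurable n measurableSet_Ici)
      rw [← lintegral_indicator_one hs]
      refine lintegral_congr fun ω => ?_
      rw [Set.indicator_apply]
      split_ifs with h1 h2 h2
      · simp
      · exact absurd h1 h2
      · exact absurd h2 h1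
      · simp
    have h2 : ∀ n, Measurable fun ω => ENNReal.ofReal
        (if (t - l < start U x₀ x₁ x₂ ε (fun k => E k ω) n ∧
        start U x₀ x₁ x₂ ε (fun k => E k ω) n ≤ t) ∧ 1 ≤ E n ω then 1 else 0) := fun n =>
      (Measurable.ite ((hwin n).inter (hE.measurable n measurableSet_Ici)) measurable_const
        measurable_const).ennreal_ofReal
    rw [Finset.sum_congr rfl fun n _ => h1 n, ← lintegral_finsetSum _ fun n _ => h2 n]
    refine (lintegral_mono fun ω => ?_).trans (lintegral_const (ENNReal.ofReal (1 + l / ρ))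
      (μ := P) |>.trans (by simp)).le
    rw [← ENNReal.ofReal_sum_of_nonneg fun n _ => by positivity]
    exact ENNReal.ofReal_le_ofReal (sum_window_le hρ (hlong ω) t hl N)
  simp_rw [hprod] at hcount
  rw [ENNReal.tsum_mul_right] at hcount
  have h3 : ENNReal.ofReal (Real.exp 1) * ENNReal.ofReal (Real.exp (-1)) = 1 := by
    rw [← ENNReal.ofReal_mul (Real.exp_pos 1).le, ← Real.exp_add]
    simp
  calc _ = ENNReal.ofReal (Real.exp 1) * ((∑' n, P {ω | t - l <
        start U x₀ x₁ x₂ ε (fun k => E k ω) n ∧ start U x₀ x₁ x₂ ε (fun k => E k ω) n ≤ t}) *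
        ENNReal.ofReal (Real.exp (-1))) := by
        rw [mul_left_comm, h3, mul_one]
    _ ≤ ENNReal.ofReal (Real.exp 1) * ENNReal.ofReal (1 + l / ρ) := by gcongr
    _ = _ := by rw [ENNReal.ofReal_mul (Real.exp_pos 1).le]

open Classical in
/-- Weighted form of the renewal bound, for a window and a weight that depend on the clock of the
excursion. -/
theorem IsClock.lintegral_tsum_le (hE : IsClock P E) (hU : IsDoubleWell U x₀ x₁ x₂) {ρ : ℝ}
    (hρ : 0 < ρ)
    (hlong : ∀ ω n, 1 ≤ E n ω → ρ ≤ excursionTime U x₀ x₁ x₂ ε (fun k => E k ω) n) (t : ℝ)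
    {g : ℝ → ℝ} (hg : Measurable g) {φ : ℝ → ℝ≥0∞} (hφ : Measurable φ) :
    ∫⁻ ω, ∑' n, (if t - g (E n ω) < start U x₀ x₁ x₂ ε (fun k => E k ω) n ∧
      start U x₀ x₁ x₂ ε (fun k => E k ω) n ≤ t then φ (E n ω) else 0) ∂P ≤
      ∫⁻ x, φ x * ENNReal.ofReal (Real.exp 1 * (1 + g x / ρ)) ∂expMeasure 1 := by
  have hψ : Measurable fun p : ℝ × ℝ => if t - g p.2 < p.1 ∧ p.1 ≤ t then φ p.2 else 0 := by
    refine Measurable.ite ?_ (hφ.comp measurable_snd) measurable_const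
    exact (measurableSet_lt (measurable_const.sub (hg.comp measurable_snd)) measurable_fst).inter
      (measurableSet_le measurable_fst measurable_const)
  have hS := hE.measurable_start hU ε
  have hterm : ∀ n, Measurable fun ω => if t - g (E n ω) < start U x₀ x₁ x₂ ε (fun k => E k ω) n ∧
      start U x₀ x₁ x₂ ε (fun k => E k ω) n ≤ t then φ (E n ω) else 0 := fun n =>
    hψ.comp ((hS n).prodMk (hE.measurable n))
  rw [lintegral_tsum fun n => (hterm n).aemeasurable]
  have h1 : ∀ n, ∫⁻ ω, (if t - g (E n ω) < start U x₀ x₁ x₂ ε (fun k => E k ω) n ∧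
      start U x₀ x₁ x₂ ε (fun k => E k ω) n ≤ t then φ (E n ω) else 0) ∂P =
      ∫⁻ x, φ x * P {ω | t - g x < start U x₀ x₁ x₂ ε (fun k => E k ω) n ∧
        start U x₀ x₁ x₂ ε (fun k => E k ω) n ≤ t} ∂expMeasure 1 := by
    intro n
    refine (hE.lintegral_start hU ε n hψ).trans (lintegral_congr fun x => ?_)
    have hs : MeasurableSet {ω | t - g x < start U x₀ x₁ x₂ ε (fun k => E k ω) n ∧
        start U x₀ x₁ x₂ ε (fun k => E k ω) n ≤ t} := hS n measurableSet_Ioc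
    rw [← lintegral_indicator_const hs]
    refine lintegral_congr fun ω => ?_
    simp only [Set.indicator_apply, Set.mem_ofPred_eq]
  have hmeas : ∀ n, Measurable fun x => P {ω | t - g x < start U x₀ x₁ x₂ ε (fun k => E k ω) n ∧
        start U x₀ x₁ x₂ ε (fun k => E k ω) n ≤ t} := by
    intro n
    have := hE.isProb
    refine measurable_measure_prodMk_left (ν := P) (s := {p : ℝ × Ω | t - g p.1 <
      start U x₀ x₁ x₂ ε (fun k => E k p.2) n ∧ start U x₀ x₁ x₂ ε (fun k => E k p.2) n ≤ t}) ?_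
    exact (measurableSet_lt (measurable_const.sub (hg.comp measurable_fst))
      ((hS n).comp measurable_snd)).inter
      (measurableSet_le ((hS n).comp measurable_snd) measurable_const)
  simp_rw [h1]
  have hprod : ∀ n, Measurable fun x => φ x *
      P {ω | t - g x < start U x₀ x₁ x₂ ε (fun k => E k ω) n ∧
        start U x₀ x₁ x₂ ε (fun k => E k ω) n ≤ t} := fun n => hφ.mul (hmeas n)
  rw [← lintegral_tsum fun n => (hprod n).aemeasurable]
  refine lintegral_mono fun x => ?_
  rw [ENNReal.tsum_mul_left]
  gcongr
  exact hE.tsum_measure_start_le hU hρ hlong t (g x)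

/-- Borel–Cantelli: the expected number of starts in `(-1, N]` is finite, and starts are
nonnegative, so almost surely only finitely many excursions start before time `N`. -/
theorem IsClock.ae_tendsto_start (hE : IsClock P E) (hU : IsDoubleWell U x₀ x₁ x₂) {ρ : ℝ}
    (hρ : 0 < ρ)
    (hlong : ∀ ω n, 1 ≤ E n ω → ρ ≤ excursionTime U x₀ x₁ x₂ ε (fun k => E k ω) n) :
    ∀ᵐ ω ∂P, Tendsto (start U x₀ x₁ x₂ ε (fun k => E k ω)) atTop atTop := by
  have h1 : ∀ N : ℕ, ∀ᵐ ω ∂P, ∀ᶠ n in atTop, ω ∉ {ω | (N : ℝ) - (N + 1) <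
      start U x₀ x₁ x₂ ε (fun k => E k ω) n ∧ start U x₀ x₁ x₂ ε (fun k => E k ω) n ≤ N} :=
    fun N => ae_eventually_notMem ((hE.tsum_measure_start_le hU hρ hlong N (N + 1)).trans_lt
      ENNReal.ofReal_lt_top).ne
  filter_upwards [ae_all_iff.2 h1] with ω hω
  rw [tendsto_atTop]
  intro b
  obtain ⟨N, hN⟩ := exists_nat_ge b
  filter_upwards [hω N] with n hn
  by_contra hlt
  refine hn ⟨?_, by linarith⟩
  linarith [start_nonneg U x₀ x₁ x₂ ε (fun k => E k ω) n]

end VelocityJump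


/-! ### Measurability and quantitative localization -/

namespace VelocityJump

variable {Ω : Type*} [MeasurableSpace Ω] {P : Measure Ω} {E : ℕ → Ω → ℝ}
  {U : ℝ → ℝ} {x₀ x₁ x₂ ε : ℝ}

theorem _root_.IsDoubleWell.exists_le_excursionTime (hU : IsDoubleWell U x₀ x₁ x₂) :
    ∃ M, 0 < M ∧ ∀ ε, 0 < ε → ∀ d w h, ε ≤ h → min 1 (ε / M) ≤ duration U x₀ x₁ x₂ d w h := by
  obtain ⟨M, hM, h⟩ := hU.exists_le_target
  refine ⟨M, hM, fun ε hε d w a ha => ?_⟩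
  refine le_trans ?_ ((h d w a (by linarith)).trans (le_add_of_nonneg_right (abs_nonneg _)))
  gcongr

/-- Along almost every clock sequence, all clocks are positive and the excursions exhaust time. -/
theorem IsClock.ae_regular (hE : IsClock P E) (hU : IsDoubleWell U x₀ x₁ x₂) (hε : 0 < ε) :
    ∀ᵐ ω ∂P, (∀ k, 0 < E k ω) ∧ Tendsto (start U x₀ x₁ x₂ ε (fun k => E k ω)) atTop atTop := by
  obtain ⟨M, hM, h⟩ := hU.exists_le_excursionTime
  exact hE.ae_pos.and (hE.ae_tendsto_start hU (lt_min one_pos (div_pos hε hM)) fun ω n hn =>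
    h ε hε _ _ _ (le_mul_of_one_le_right hε.le hn))

/-- Between consecutive jump times the position is an explicit function of measurable data. These
formulas hold only for positive clocks, and the intervals cover `s` only almost surely, hence the
weaker measurability. -/
theorem IsClock.aemeasurable_process (hE : IsClock P E) (hU : IsDoubleWell U x₀ x₁ x₂)
    (hε : 0 < ε) {s : ℝ} (hs : 0 ≤ s) :
    AEMeasurable (fun ω => (process U ε x₀ (-1) (fun k => E k ω) s).1) P := by
  have hwell := hE.measurable_well hU ε
  have hstart := hE.measurable_start hU ε
  have hex : ∀ n, ∃ p τ : Ω → ℝ, Measurable p ∧ Measurable τ ∧ ∀ ω, (∀ k, 0 < E k ω) →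
      (jumpState U ε x₀ (-1) (fun k => E k ω) n).pos = p ω ∧
      (jumpState U ε x₀ (-1) (fun k => E k ω) n).time = τ ω := by
    intro n
    cases n with
    | zero => exact ⟨fun _ => x₀, fun _ => 0, measurable_const, measurable_const,
        fun ω _ => ⟨rfl, rfl⟩⟩
    | succ n =>
      have h0 : Measurable fun ω => (well U x₀ x₁ x₂ ε (fun k => E k ω) n, ε * E n ω) :=
        (hwell n).prodMk ((hE.measurable n).const_mul ε)
      have h1 : Measurable fun p : Bool × ℝ => target U x₀ x₂ n.bodd p.1 p.2 := by
        apply measurable_from_prod_countable_right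
        intro w
        have := hU.measurable_target n.bodd w
        exact this
      have h2 := h1.comp h0
      have h3 : Measurable fun ω => bottom x₀ x₂ (well U x₀ x₁ x₂ ε (fun k => E k ω) n) :=
        (measurable_of_countable (bottom x₀ x₂)).comp (hwell n)
      refine ⟨_, _, h2, (hstart n).add (h2.sub h3).abs, fun ω hω => ?_⟩
      obtain ⟨-, -, -, -, h4, h5⟩ := hU.jumpState_spec hε hω n
      exact ⟨h4, h5⟩
  choose p τ hp hτ hspec using hex
  have hcover : ∀ᵐ ω ∂P, ω ∈ ⋃ n, {ω | τ n ω ≤ s ∧ s < τ (n + 1) ω} := by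
    filter_upwards [hE.ae_regular hU hε] with ω hω
    rw [Set.mem_iUnion]
    obtain ⟨n, h1, h2⟩ := exists_start_le_lt hω.2 hs
    have h3 := hU.time_le_start hε hω.1 n
    have h4 := hU.start_lt_time hε hω.1 (n + 1)
    rcases lt_or_ge s (jumpState U ε x₀ (-1) (fun k => E k ω) (n + 1)).time with h | h
    · refine ⟨n, ?_, ?_⟩
      · rw [← (hspec n ω hω.1).2]; linarith
      · rwa [← (hspec (n + 1) ω hω.1).2]
    · refine ⟨n + 1, ?_, ?_⟩
      · rwa [← (hspec (n + 1) ω hω.1).2]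
      · rw [← (hspec (n + 1 + 1) ω hω.1).2]; linarith
  rw [← Measure.restrict_eq_self_of_ae_mem hcover, aemeasurable_iUnion_iff]
  intro n
  refine AEMeasurable.congr (f := fun ω => p n ω + sgn n.bodd * (s - τ n ω)) ?_ ?_
  · exact ((hp n).add ((measurable_const.sub (hτ n)).const_mul _)).aemeasurable
  · have hms : MeasurableSet {ω | τ n ω ≤ s ∧ s < τ (n + 1) ω} :=
      (measurableSet_le (hτ n) measurable_const).inter
        (measurableSet_lt measurable_const (hτ (n + 1)))
    filter_upwards [ae_restrict_mem hms, ae_restrict_of_ae (hE.ae_regular hU hε)] with ω h1 h2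
    obtain ⟨h3, h4⟩ := h1
    rw [← (hspec n ω h2.1).2] at h3
    rw [← (hspec (n + 1) ω h2.1).2] at h4
    rw [process_eq (hU.monotone_time hε h2.1) h3 h4, (hU.jumpState_spec hε h2.1 n).1,
      (hspec n ω h2.1).1, (hspec n ω h2.1).2]

theorem IsClock.measurableSet_trapped (hE : IsClock P E) (hU : IsDoubleWell U x₀ x₁ x₂) (ε s : ℝ) :
    MeasurableSet {ω | Trapped U x₀ x₁ x₂ ε (fun k => E k ω) s} := by
  unfold Trapped
  refine measurableSet_setOfPred.2 (Measurable.forall fun k => ?_)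
  refine Measurable.imp measurable_const (Measurable.imp ?_ ?_)
  · exact measurableSet_setOfPred.1 (measurableSet_le (hE.measurable_start hU ε k) measurable_const)
  · exact measurableSet_setOfPred.1
      (measurableSet_le ((hE.measurable k).const_mul ε) measurable_const)

open Classical in
/-- Quantitative localization: the expected error made when the distance to the lower bottom is
replaced by its value at the bottom of the current well. -/
theorem IsClock.lintegral_abs_dist_sub_le (hE : IsClock P E) (hU : IsDoubleWell U x₀ x₁ x₂)
    (hε : 0 < ε) (hε1 : ε ≤ 1) {s : ℝ} (hs : 0 ≤ s) {δ η C ρ : ℝ} (hη0 : 0 < η)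
    (hη : η < U x₁ - U x₀)
    (hnear : ∀ d w h, 0 < h → h ≤ η → |target U x₀ x₂ d w h - bottom x₀ x₂ w| ≤ δ)
    (hC0 : 0 ≤ C)
    (hC : ∀ d w w' h, 0 < h → |target U x₀ x₂ d w h - bottom x₀ x₂ w'| ≤ C * (1 + h))
    (hCL : x₂ - x₀ ≤ C) (hρ0 : 0 < ρ) (hρ1 : ρ ≤ 1)
    (hρ : ∀ d w h, ε ≤ h → ρ ≤ duration U x₀ x₁ x₂ d w h) :
    ∫⁻ ω, ENNReal.ofReal |(|(process U ε x₀ (-1) (fun k => E k ω) s).1 - x₂|) -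
        (if Trapped U x₀ x₁ x₂ ε (fun k => E k ω) s then x₂ - x₀ else 0)| ∂P ≤
      ENNReal.ofReal δ +
      ENNReal.ofReal ((x₂ - x₀) * (Real.exp 1 * (1 + (s + 1) / ρ)) *
        Real.exp (-((U x₁ - U x₂) / ε))) +
      ENNReal.ofReal (2 * C * Real.exp 1 * (1 + 2 * C) / η ^ 2 * (ε ^ 2 / ρ)) *
        ∫⁻ x, ENNReal.ofReal ((1 + x) ^ 4) ∂expMeasure 1 := by
  have := hE.isProb
  have hlt := hU.lt
  have hlong : ∀ ω n, 1 ≤ E n ω → ρ ≤ excursionTime U x₀ x₁ x₂ ε (fun k => E k ω) n :=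
    fun ω n hn => hρ _ _ _ (le_mul_of_one_le_right hε.le hn)
  set φ₁ : ℝ → ℝ≥0∞ := fun x => if U x₁ - U x₂ < ε * x then ENNReal.ofReal (x₂ - x₀) else 0
    with hφ₁
  set φ₂ : ℝ → ℝ≥0∞ := fun x => if η < ε * x then ENNReal.ofReal (2 * C * (1 + x)) else 0 with hφ₂
  have hset : ∀ a : ℝ, MeasurableSet {x : ℝ | a < ε * x} := fun a =>
    measurableSet_lt measurable_const (measurable_const_mul ε)
  have hφ₁m : Measurable φ₁ := Measurable.ite (hset _) measurable_const measurable_const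
  have hφ₂m : Measurable φ₂ := Measurable.ite (hset _)
    (((measurable_const_add (1 : ℝ)).const_mul (2 * C)).ennreal_ofReal) measurable_const
  have hg₂ : Measurable fun x : ℝ => 2 * C * (1 + x) := (measurable_const_add (1 : ℝ)).const_mul _
  -- For returns the window length `s + 1` imposes nothing, since starts are nonnegative; it only
  -- brings the sum into the form of `lintegral_tsum_le`.
  have hpt : ∀ᵐ ω ∂P, ENNReal.ofReal |(|(process U ε x₀ (-1) (fun k => E k ω) s).1 - x₂|) -
        (if Trapped U x₀ x₁ x₂ ε (fun k => E k ω) s then x₂ - x₀ else 0)| ≤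
      ENNReal.ofReal δ + ((∑' n, (if s - (fun _ => s + 1) (E n ω) <
        start U x₀ x₁ x₂ ε (fun k => E k ω) n ∧
        start U x₀ x₁ x₂ ε (fun k => E k ω) n ≤ s then φ₁ (E n ω) else 0)) +
      ∑' n, (if s - (fun x => 2 * C * (1 + x)) (E n ω) < start U x₀ x₁ x₂ ε (fun k => E k ω) n ∧
        start U x₀ x₁ x₂ ε (fun k => E k ω) n ≤ s then φ₂ (E n ω) else 0)) := by
    filter_upwards [hE.ae_regular hU hε] with ω hω
    refine (hU.abs_dist_sub_le hε hε1 hω.1 hω.2 hs hη hnear hC0 hC hCL).trans ?_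
    rw [add_assoc]
    gcongr with n n
    · have h0 := start_nonneg U x₀ x₁ x₂ ε (fun k => E k ω) n
      by_cases h1 : start U x₀ x₁ x₂ ε (fun k => E k ω) n ≤ s ∧ U x₁ - U x₂ < ε * E n ω
      · rw [if_pos h1, if_pos ⟨by linarith, h1.1⟩, hφ₁]
        simp only [h1.2, if_true, le_refl]
      · rw [if_neg h1]
        exact zero_le
    · by_cases h1 : s - 2 * C * (1 + E n ω) < start U x₀ x₁ x₂ ε (fun k => E k ω) n ∧
        start U x₀ x₁ x₂ ε (fun k => E k ω) n ≤ s
      · simp only [h1, and_self, true_and, if_true, hφ₂, le_refl]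
      · simp only [h1, false_and, if_false, le_refl]
  have hterm : Measurable fun ω => ∑' n, (if s - (fun _ => s + 1) (E n ω) <
        start U x₀ x₁ x₂ ε (fun k => E k ω) n ∧
        start U x₀ x₁ x₂ ε (fun k => E k ω) n ≤ s then φ₁ (E n ω) else 0) := by
    refine Measurable.tsum fun n => ?_
    refine Measurable.ite ?_ (hφ₁m.comp (hE.measurable n)) measurable_const
    exact (measurableSet_lt measurable_const (hE.measurable_start hU ε n)).inter
      (measurableSet_le (hE.measurable_start hU ε n) measurable_const)
  refine (lintegral_mono_ae hpt).trans ?_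
  rw [lintegral_add_left measurable_const, lintegral_add_left hterm, lintegral_const,
    measure_univ, mul_one, add_assoc]
  gcongr
  · refine (hE.lintegral_tsum_le hU hρ0 hlong s measurable_const hφ₁m).trans ?_
    rw [lintegral_mul_const _ hφ₁m]
    have h1 : ∫⁻ x, φ₁ x ∂expMeasure 1 =
        ENNReal.ofReal (x₂ - x₀) * ENNReal.ofReal (Real.exp (-((U x₁ - U x₂) / ε))) := by
      rw [← expMeasure_Ioi (div_pos hU.barrier_right_pos hε).le,
        ← lintegral_indicator_const measurableSet_Ioi]
      refine lintegral_congr fun x => ?_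
      simp only [hφ₁, Set.indicator_apply, Set.mem_Ioi, div_lt_iff₀' hε]
    rw [h1, ← ENNReal.ofReal_mul (by linarith), ← ENNReal.ofReal_mul (by
      have := Real.exp_pos (-((U x₁ - U x₂) / ε))
      exact mul_nonneg (by linarith) this.le)]
    exact ENNReal.ofReal_le_ofReal (by linarith)
  · refine (hE.lintegral_tsum_le hU hρ0 hlong s hg₂ hφ₂m).trans ?_
    rw [← lintegral_const_mul _ (by fun_prop)]
    refine lintegral_mono_ae ?_
    filter_upwards [expMeasure_ae_pos] with x hx
    simp only [hφ₂]
    split_ifs with h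
    · rw [← ENNReal.ofReal_mul (by positivity), ← ENNReal.ofReal_mul (by positivity)]
      refine ENNReal.ofReal_le_ofReal ?_
      -- The indicator of `η < ε x` is at most `(ε x / η) ^ 2`, as in Chebyshev's inequality. The
      -- gained `ε ^ 2` outweighs the factor `1 / ρ` from the renewal bound, since `ρ` is of order
      -- `ε`.
      have h1 : 1 ≤ (ε * x / η) ^ 2 := by
        refine one_le_pow₀ ?_
        rw [one_le_div hη0]
        exact h.le
      have h2 : 1 + 2 * C * (1 + x) / ρ ≤ (1 + 2 * C) * (1 + x) / ρ := by
        rw [← sub_nonneg]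
        have : (1 + 2 * C) * (1 + x) / ρ - (1 + 2 * C * (1 + x) / ρ) = (1 + x - ρ) / ρ := by
          field_simp
          ring
        rw [this]
        exact div_nonneg (by linarith) hρ0.le
      have h3 : x ^ 2 ≤ (1 + x) ^ 2 := by gcongr; linarith
      calc 2 * C * (1 + x) * (Real.exp 1 * (1 + 2 * C * (1 + x) / ρ))
          ≤ 2 * C * (1 + x) * (Real.exp 1 * ((1 + 2 * C) * (1 + x) / ρ)) := by gcongr
        _ = 1 * (2 * C * (1 + x) * (Real.exp 1 * ((1 + 2 * C) * (1 + x) / ρ))) := (one_mul _).symm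
        _ ≤ (ε * x / η) ^ 2 * (2 * C * (1 + x) * (Real.exp 1 * ((1 + 2 * C) * (1 + x) / ρ))) := by
          gcongr
        _ = 2 * C * Real.exp 1 * (1 + 2 * C) / η ^ 2 * (ε ^ 2 / ρ) * (1 + x) ^ 2 * x ^ 2 := by
          field_simp
        _ ≤ 2 * C * Real.exp 1 * (1 + 2 * C) / η ^ 2 * (ε ^ 2 / ρ) * (1 + x) ^ 2 *
            (1 + x) ^ 2 := by gcongr
        _ = _ := by ring
    · rw [zero_mul]
      exact zero_le

end VelocityJump


/-! ### The mean hitting time -/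

namespace VelocityJump

variable {Ω : Type*} {E : ℕ → Ω → ℝ}
  {U : ℝ → ℝ} {x₀ x₁ x₂ ε : ℝ}

theorem measurable_trappedTime (hU : IsDoubleWell U x₀ x₁ x₂) (ε : ℝ) (n : ℕ) :
    Measurable (trappedTime U x₀ x₁ x₂ ε n) := by
  have h := (hU.measurable_duration n.bodd false).comp (measurable_const_mul ε)
  unfold trappedTime
  refine Measurable.ite ?_ measurable_const h
  exact (MeasurableSet.const _).inter (measurableSet_lt measurable_const (measurable_const_mul ε))

theorem trappedTime_le {C : ℝ} (hε : 0 < ε) (hC0 : 0 ≤ C)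
    (hC : ∀ d w w' h, 0 < h → |target U x₀ x₂ d w h - bottom x₀ x₂ w'| ≤ C * (1 + h)) (n : ℕ)
    {x : ℝ} (hx : 0 < x) : trappedTime U x₀ x₁ x₂ ε n x ≤ 2 * C * (1 + ε * x) := by
  have h := mul_pos hε hx
  unfold trappedTime
  split_ifs
  · positivity
  · unfold duration
    linarith [hC n.bodd false false _ h,
      hC n.bodd false (nextWell U x₀ x₁ x₂ n.bodd false (ε * x)) _ h]

theorem trappedTime_even (U : ℝ → ℝ) (x₀ x₁ x₂ ε : ℝ) (j : ℕ) :
    trappedTime U x₀ x₁ x₂ ε (2 * j) = trappedTime U x₀ x₁ x₂ ε 0 := by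
  unfold trappedTime
  simp

theorem trappedTime_odd (U : ℝ → ℝ) (x₀ x₁ x₂ ε : ℝ) (j : ℕ) :
    trappedTime U x₀ x₁ x₂ ε (2 * j + 1) = trappedTime U x₀ x₁ x₂ ε 1 := by
  unfold trappedTime
  simp

/-- The mean duration of a round, a left-moving and a right-moving excursion from the left well,
transitions not being counted. -/
noncomputable def meanRound (U : ℝ → ℝ) (x₀ x₁ x₂ ε : ℝ) : ℝ :=
  ∫ x, trappedTime U x₀ x₁ x₂ ε 0 x ∂expMeasure 1 + ∫ x, trappedTime U x₀ x₁ x₂ ε 1 x ∂expMeasure 1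

theorem integrable_sq_trappedTime (hU : IsDoubleWell U x₀ x₁ x₂) (hε : 0 < ε) (n : ℕ) :
    Integrable (fun x => trappedTime U x₀ x₁ x₂ ε n x ^ 2) (expMeasure 1) := by
  obtain ⟨C, hC0, hC⟩ := hU.exists_target_le
  refine (integrable_one_add_pow_four_expMeasure.const_mul ((2 * C * (1 + ε)) ^ 2)).mono'
    ((measurable_trappedTime hU ε n).pow_const 2).aestronglyMeasurable ?_
  filter_upwards [expMeasure_ae_pos] with x hx
  have h0 := trappedTime_nonneg U x₀ x₁ x₂ ε n x
  rw [Real.norm_of_nonneg (by positivity)]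
  have h1 : trappedTime U x₀ x₁ x₂ ε n x ≤ 2 * C * (1 + ε) * (1 + x) ^ 2 := by
    refine (trappedTime_le hε hC0 hC n hx).trans ?_
    rw [mul_assoc (2 * C)]
    gcongr
    nlinarith [mul_pos hε hx]
  calc _ ≤ (2 * C * (1 + ε) * (1 + x) ^ 2) ^ 2 := by gcongr
    _ = _ := by ring

theorem memLp_trappedTime (hU : IsDoubleWell U x₀ x₁ x₂) (hε : 0 < ε) (n : ℕ) :
    MemLp (trappedTime U x₀ x₁ x₂ ε n) 2 (expMeasure 1) :=
  (memLp_two_iff_integrable_sq (measurable_trappedTime hU ε n).aestronglyMeasurable).2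
    (integrable_sq_trappedTime hU hε n)

theorem integrable_trappedTime (hU : IsDoubleWell U x₀ x₁ x₂) (hε : 0 < ε) (n : ℕ) :
    Integrable (trappedTime U x₀ x₁ x₂ ε n) (expMeasure 1) :=
  (memLp_trappedTime hU hε n).integrable (by norm_num)

theorem exists_integral_sq_trappedTime_le (hU : IsDoubleWell U x₀ x₁ x₂) :
    ∃ V, 0 ≤ V ∧ ∀ ε, 0 < ε → ε ≤ 1 → ∀ n,
      ∫ x, trappedTime U x₀ x₁ x₂ ε n x ^ 2 ∂expMeasure 1 ≤ V := by
  obtain ⟨C, hC0, hC⟩ := hU.exists_target_le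
  refine ⟨∫ x : ℝ, (2 * C) ^ 2 * (1 + x) ^ 4 ∂expMeasure 1,
    integral_nonneg fun x => by positivity, fun ε hε hε1 n => ?_⟩
  refine integral_mono_ae (integrable_sq_trappedTime hU hε n)
    (integrable_one_add_pow_four_expMeasure.const_mul _) ?_
  filter_upwards [expMeasure_ae_pos] with x hx
  have h0 := trappedTime_nonneg U x₀ x₁ x₂ ε n x
  have h1 : trappedTime U x₀ x₁ x₂ ε n x ≤ 2 * C * (1 + x) ^ 2 := by
    refine (trappedTime_le hε hC0 hC n hx).trans ?_
    gcongr
    nlinarith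
  calc _ ≤ (2 * C * (1 + x) ^ 2) ^ 2 := by gcongr
    _ = _ := by ring

/-- A left-moving excursion from the left well never crosses, so its time is always counted; with
probability `exp (-1)` its clock is at least one. -/
theorem le_meanRound (hU : IsDoubleWell U x₀ x₁ x₂) (hε : 0 < ε) {ρ : ℝ}
    (hρ : ∀ d w h, ε ≤ h → ρ ≤ duration U x₀ x₁ x₂ d w h) :
    ρ * Real.exp (-1) ≤ meanRound U x₀ x₁ x₂ ε := by
  have h1 : 0 ≤ ∫ x, trappedTime U x₀ x₁ x₂ ε 1 x ∂expMeasure 1 :=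
    integral_nonneg fun x => trappedTime_nonneg _ _ _ _ _ _ _
  have h2 : ∫ x, (Set.Ici (1 : ℝ)).indicator (fun _ => ρ) x ∂expMeasure 1 ≤
      ∫ x, trappedTime U x₀ x₁ x₂ ε 0 x ∂expMeasure 1 := by
    refine integral_mono ((integrable_const ρ).indicator measurableSet_Ici)
      (integrable_trappedTime hU hε 0) fun x => ?_
    rw [Set.indicator_apply]
    split_ifs with hx
    · have h3 := hρ (Nat.bodd 0) false _ (le_mul_of_one_le_right hε.le (Set.mem_Ici.1 hx))
      simpa [trappedTime] using h3
    · exact trappedTime_nonneg _ _ _ _ _ _ _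
  rw [integral_indicator_const _ measurableSet_Ici, measureReal_def, expMeasure_Ici zero_le_one,
    ENNReal.toReal_ofReal (Real.exp_pos _).le, smul_eq_mul, mul_comm] at h2
  unfold meanRound
  linarith

theorem measurableSet_fails (n : ℕ) {j : ℕ} (hj : 2 * j ≤ n) :
    MeasurableSet[⨆ i ∈ Set.Iio n, MeasurableSpace.comap (E i) inferInstance]
      {ω | Fails U x₀ x₁ ε (fun k => E k ω) j} := by
  have key : ∀ m : MeasurableSpace Ω, (∀ i < n, Measurable[m] (E i)) →
      MeasurableSet[m] {ω | Fails U x₀ x₁ ε (fun k => E k ω) j} := by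
    intro m hm
    have : {ω | Fails U x₀ x₁ ε (fun k => E k ω) j} =
        ⋂ i, ⋂ (_ : i < j), {ω | ε * E (2 * i + 1) ω ≤ U x₁ - U x₀} := by
      ext ω
      simp [Fails]
    rw [this]
    exact MeasurableSet.iInter fun i => MeasurableSet.iInter fun hi =>
      measurableSet_le ((hm _ (by omega)).const_mul ε) measurable_const
  refine key _ fun i hi => (comap_measurable (E i)).mono ?_ le_rfl
  exact le_biSup (fun i => MeasurableSpace.comap (E i) inferInstance) (Set.mem_Iio.2 hi)

variable [MeasurableSpace Ω] {P : Measure Ω}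

theorem IsClock.indep_past (hE : IsClock P E) {n k : ℕ} (hk : n ≤ k) :
    Indep (⨆ i ∈ Set.Iio n, MeasurableSpace.comap (E i) inferInstance)
      (MeasurableSpace.comap (E k) inferInstance) P := by
  have h : Indep (⨆ i ∈ Set.Iio n, MeasurableSpace.comap (E i) inferInstance)
      (⨆ i ∈ ({k} : Set ℕ), MeasurableSpace.comap (E i) inferInstance) P :=
    indep_iSup_of_disjoint (fun i => (hE.measurable i).comap_le) hE.indep.iIndep (by simpa using hk)
  refine indep_of_indep_of_le_right h ?_
  exact le_biSup (fun i => MeasurableSpace.comap (E i) inferInstance) (Set.mem_singleton k)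

theorem IsClock.measurableSet_fails (hE : IsClock P E) (U : ℝ → ℝ) (x₀ x₁ ε : ℝ) (j : ℕ) :
    MeasurableSet {ω | Fails U x₀ x₁ ε (fun k => E k ω) j} :=
  (iSup₂_le fun i _ => (hE.measurable i).comap_le :
    (⨆ i ∈ Set.Iio (2 * j), MeasurableSpace.comap (E i) inferInstance) ≤ _) _
    (VelocityJump.measurableSet_fails (2 * j) le_rfl)

/-- The probability that the first `j` attempts fail is geometric. -/
theorem IsClock.measure_fails (hE : IsClock P E) (hU : IsDoubleWell U x₀ x₁ x₂) (hε : 0 < ε)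
    (j : ℕ) : P {ω | Fails U x₀ x₁ ε (fun k => E k ω) j} =
      (1 - ENNReal.ofReal (Real.exp (-((U x₁ - U x₀) / ε)))) ^ j := by
  have := hE.isProb
  induction j with
  | zero => simp [Fails]
  | succ j ih =>
    have hset : {ω | Fails U x₀ x₁ ε (fun k => E k ω) (j + 1)} =
        {ω | Fails U x₀ x₁ ε (fun k => E k ω) j} ∩
          E (2 * j + 1) ⁻¹' Set.Iic ((U x₁ - U x₀) / ε) := by
      ext ω
      simp only [Fails, Set.mem_ofPred_eq, Set.mem_inter_iff, Set.mem_preimage, Set.mem_Iic,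
        le_div_iff₀' hε, Nat.lt_succ_iff_lt_or_eq]
      constructor
      · exact fun h => ⟨fun i hi => h i (.inl hi), h j (.inr rfl)⟩
      · rintro ⟨h1, h2⟩ i (hi | rfl)
        · exact h1 i hi
        · exact h2
    have hind := (Indep_iff _ _ _).1 (hE.indep_past (n := 2 * j) (k := 2 * j + 1) (by omega))
      {ω | Fails U x₀ x₁ ε (fun k => E k ω) j} (E (2 * j + 1) ⁻¹' Set.Iic ((U x₁ - U x₀) / ε))
      (VelocityJump.measurableSet_fails (2 * j) le_rfl) ⟨_, measurableSet_Iic, rfl⟩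
    rw [hset, hind, ih, hE.measure_preimage _ measurableSet_Iic, pow_succ, ← Set.compl_Ioi,
      prob_compl_eq_one_sub measurableSet_Ioi, expMeasure_Ioi (div_pos hU.barrier_left_pos hε).le]

theorem IsClock.measurable_escapeTime (hE : IsClock P E) (hU : IsDoubleWell U x₀ x₁ x₂) (ε : ℝ) :
    Measurable fun ω => escapeTime U x₀ x₁ x₂ ε (fun k => E k ω) := by
  classical
  unfold escapeTime
  refine Measurable.tsum fun j => ?_
  refine Measurable.ite (hE.measurableSet_fails U x₀ x₁ ε j) ?_ measurable_const
  exact (((measurable_trappedTime hU ε (2 * j)).comp (hE.measurable _)).add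
    ((measurable_trappedTime hU ε (2 * j + 1)).comp (hE.measurable _))).ennreal_ofReal

/-- Wald's identity for the escape time. -/
theorem IsClock.lintegral_escapeTime (hE : IsClock P E) (hU : IsDoubleWell U x₀ x₁ x₂)
    (hε : 0 < ε) :
    ∫⁻ ω, escapeTime U x₀ x₁ x₂ ε (fun k => E k ω) ∂P =
      ENNReal.ofReal (meanRound U x₀ x₁ x₂ ε * Real.exp ((U x₁ - U x₀) / ε)) := by
  classical
  have := hE.isProb
  have hA : ∀ n, Measurable fun x => ENNReal.ofReal (trappedTime U x₀ x₁ x₂ ε n x) := fun n =>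
    (measurable_trappedTime hU ε n).ennreal_ofReal
  have hmean : ∀ n, ∫⁻ x, ENNReal.ofReal (trappedTime U x₀ x₁ x₂ ε n x) ∂expMeasure 1 =
      ENNReal.ofReal (∫ x, trappedTime U x₀ x₁ x₂ ε n x ∂expMeasure 1) := fun n =>
    (ofReal_integral_eq_lintegral_ofReal (integrable_trappedTime hU hε n)
      (Eventually.of_forall fun x => trappedTime_nonneg _ _ _ _ _ _ _)).symm
  -- `Fails j` involves only clocks of index below `2 j`, so it is independent of both durations of
  -- round `j`.
  have hone : ∀ j k, 2 * j ≤ k → ∫⁻ ω, {ω | Fails U x₀ x₁ ε (fun k => E k ω) j}.indicator 1 ω *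
      ENNReal.ofReal (trappedTime U x₀ x₁ x₂ ε k (E k ω)) ∂P =
      (1 - ENNReal.ofReal (Real.exp (-((U x₁ - U x₀) / ε)))) ^ j *
        ENNReal.ofReal (∫ x, trappedTime U x₀ x₁ x₂ ε k x ∂expMeasure 1) := by
    intro j k hk
    have hpast : (⨆ i ∈ Set.Iio (2 * j), MeasurableSpace.comap (E i) inferInstance) ≤
      (inferInstance : MeasurableSpace Ω) := iSup₂_le fun i _ => (hE.measurable i).comap_le
    have h := lintegral_mul_eq_lintegral_mul_lintegral_of_independent_measurableSpace
      (f := {ω | Fails U x₀ x₁ ε (fun k => E k ω) j}.indicator 1)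
      (g := fun ω => ENNReal.ofReal (trappedTime U x₀ x₁ x₂ ε k (E k ω)))
      hpast (hE.measurable k).comap_le (hE.indep_past hk)
      ((measurable_const (a := (1 : ℝ≥0∞))).indicator (VelocityJump.measurableSet_fails (2 * j) le_rfl))
      ((hA k).comp (comap_measurable (E k)))
    rw [h, lintegral_indicator_one (hE.measurableSet_fails U x₀ x₁ ε j), hE.measure_fails hU hε,
      hE.lintegral_comp k (hA k), hmean]
  have hterm : ∀ j, ∫⁻ ω, (if Fails U x₀ x₁ ε (fun k => E k ω) j then
      ENNReal.ofReal (trappedTime U x₀ x₁ x₂ ε (2 * j) (E (2 * j) ω) +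
        trappedTime U x₀ x₁ x₂ ε (2 * j + 1) (E (2 * j + 1) ω)) else 0) ∂P =
      (1 - ENNReal.ofReal (Real.exp (-((U x₁ - U x₀) / ε)))) ^ j *
        ENNReal.ofReal (meanRound U x₀ x₁ x₂ ε) := by
    intro j
    have h1 : ∀ ω, (if Fails U x₀ x₁ ε (fun k => E k ω) j then
      ENNReal.ofReal (trappedTime U x₀ x₁ x₂ ε (2 * j) (E (2 * j) ω) +
        trappedTime U x₀ x₁ x₂ ε (2 * j + 1) (E (2 * j + 1) ω)) else 0) =
      {ω | Fails U x₀ x₁ ε (fun k => E k ω) j}.indicator 1 ω *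
        ENNReal.ofReal (trappedTime U x₀ x₁ x₂ ε (2 * j) (E (2 * j) ω)) +
      {ω | Fails U x₀ x₁ ε (fun k => E k ω) j}.indicator 1 ω *
        ENNReal.ofReal (trappedTime U x₀ x₁ x₂ ε (2 * j + 1) (E (2 * j + 1) ω)) := by
      intro ω
      rw [← mul_add, ← ENNReal.ofReal_add (trappedTime_nonneg _ _ _ _ _ _ _)
        (trappedTime_nonneg _ _ _ _ _ _ _)]
      by_cases h : Fails U x₀ x₁ ε (fun k => E k ω) j <;> simp [h]
    have h2 : Measurable fun ω => {ω | Fails U x₀ x₁ ε (fun k => E k ω) j}.indicator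
        (1 : Ω → ℝ≥0∞) ω * ENNReal.ofReal (trappedTime U x₀ x₁ x₂ ε (2 * j) (E (2 * j) ω)) :=
      (measurable_one.indicator (hE.measurableSet_fails U x₀ x₁ ε j)).mul
        ((hA (2 * j)).comp (hE.measurable _))
    simp_rw [h1]
    rw [lintegral_add_left h2, hone j _ le_rfl, hone j _ (Nat.le_succ _), ← mul_add,
      trappedTime_even, trappedTime_odd, ← ENNReal.ofReal_add]
    · rfl
    · exact integral_nonneg fun x => trappedTime_nonneg _ _ _ _ _ _ _
    · exact integral_nonneg fun x => trappedTime_nonneg _ _ _ _ _ _ _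
  have hmeas : ∀ j, Measurable fun ω => if Fails U x₀ x₁ ε (fun k => E k ω) j then
      ENNReal.ofReal (trappedTime U x₀ x₁ x₂ ε (2 * j) (E (2 * j) ω) +
        trappedTime U x₀ x₁ x₂ ε (2 * j + 1) (E (2 * j + 1) ω)) else 0 := fun j =>
    Measurable.ite (hE.measurableSet_fails U x₀ x₁ ε j)
      (((measurable_trappedTime hU ε (2 * j)).comp (hE.measurable _)).add
        ((measurable_trappedTime hU ε (2 * j + 1)).comp (hE.measurable _))).ennreal_ofReal
      measurable_const
  unfold escapeTime
  rw [lintegral_tsum fun j => (hmeas j).aemeasurable]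
  simp_rw [hterm]
  -- The geometric series with ratio `1 - p` sums to `1 / p = exp ((U x₁ - U x₀) / ε)`.
  rw [ENNReal.tsum_mul_right, ENNReal.tsum_geometric, ENNReal.sub_sub_cancel ENNReal.one_ne_top,
    ← ENNReal.ofReal_inv_of_pos (Real.exp_pos _), ← Real.exp_neg, neg_neg, mul_comm,
    ENNReal.ofReal_mul' (Real.exp_pos _).le]
  rw [← ENNReal.ofReal_one]
  refine ENNReal.ofReal_le_ofReal (Real.exp_le_one_iff.2 ?_)
  exact neg_nonpos.2 (div_pos hU.barrier_left_pos hε).le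

theorem IsClock.ae_exists_crossing (hE : IsClock P E) (hU : IsDoubleWell U x₀ x₁ x₂)
    (hε : 0 < ε) : ∀ᵐ ω ∂P, ∃ j, U x₁ - U x₀ < ε * E (2 * j + 1) ω := by
  have hp : 0 < ENNReal.ofReal (Real.exp (-((U x₁ - U x₀) / ε))) :=
    ENNReal.ofReal_pos.2 (Real.exp_pos _)
  have hlt : 1 - ENNReal.ofReal (Real.exp (-((U x₁ - U x₀) / ε))) < 1 :=
    ENNReal.sub_lt_self ENNReal.one_ne_top one_ne_zero hp.ne'
  rw [ae_iff]
  refine le_antisymm (ge_of_tendsto' (ENNReal.tendsto_pow_atTop_nhds_zero_of_lt_one hlt)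
    fun j => ?_) zero_le
  rw [← hE.measure_fails hU hε]
  refine measure_mono fun ω hω i _ => ?_
  by_contra h
  exact hω ⟨i, not_le.1 h⟩

/-- The hitting time differs from the escape time by at most `x₁ - x₀`, which does not depend on `ε`
and is negligible on the exponential scale. -/
theorem IsClock.meanHittingTime_bounds (hE : IsClock P E) (hU : IsDoubleWell U x₀ x₁ x₂)
    (hε : 0 < ε) :
    ENNReal.ofReal (meanRound U x₀ x₁ x₂ ε * Real.exp ((U x₁ - U x₀) / ε)) ≤
      meanHittingTime P E U ε x₀ (-1) x₁ ∧
    meanHittingTime P E U ε x₀ (-1) x₁ ≤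
      ENNReal.ofReal (meanRound U x₀ x₁ x₂ ε * Real.exp ((U x₁ - U x₀) / ε)) +
        ENNReal.ofReal (x₁ - x₀) := by
  have := hE.isProb
  have hae : ∀ᵐ ω ∂P, escapeTime U x₀ x₁ x₂ ε (fun k => E k ω) ≤
      hittingTime U ε x₀ (-1) (fun k => E k ω) x₁ ∧
      hittingTime U ε x₀ (-1) (fun k => E k ω) x₁ ≤
        escapeTime U x₀ x₁ x₂ ε (fun k => E k ω) + ENNReal.ofReal (x₁ - x₀) := by
    filter_upwards [hE.ae_regular hU hε, hE.ae_ne ((U x₁ - U x₀) / ε),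
      hE.ae_exists_crossing hU hε] with ω h1 h2 h3
    refine hU.hittingTime_bounds hε h1.1 h1.2 (fun i hi => h2 i ?_) h3
    rw [← hi, mul_div_cancel_left₀ _ hε.ne']
  rw [← hE.lintegral_escapeTime hU hε]
  constructor
  · exact lintegral_mono_ae (hae.mono fun ω h => h.1)
  · refine (lintegral_mono_ae (hae.mono fun ω h => h.2)).trans ?_
    rw [lintegral_add_left (hE.measurable_escapeTime hU ε), lintegral_const, measure_univ, mul_one]

end VelocityJump


/-! ### The law of the first transition -/

namespace VelocityJump

variable {Ω : Type*} [MeasurableSpace Ω] {P : Measure Ω} {E : ℕ → Ω → ℝ}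
  {U : ℝ → ℝ} {x₀ x₁ x₂ ε : ℝ}

theorem IsClock.memLp_trapped (hE : IsClock P E) (hU : IsDoubleWell U x₀ x₁ x₂) (hε : 0 < ε)
    (n : ℕ) : MemLp (fun ω => trappedTime U x₀ x₁ x₂ ε n (E n ω)) 2 P := by
  have h := memLp_trappedTime hU hε n
  rw [← hE.map_eq n] at h
  exact h.comp_of_map (hE.measurable n).aemeasurable

theorem IsClock.integral_comp (hE : IsClock P E) (k : ℕ) {φ : ℝ → ℝ} (hφ : Measurable φ) :
    ∫ ω, φ (E k ω) ∂P = ∫ x, φ x ∂expMeasure 1 := by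
  rw [← hE.map_eq k, integral_map (hE.measurable k).aemeasurable hφ.aestronglyMeasurable]

theorem IsClock.integral_sum_trapped (hE : IsClock P E) (hU : IsDoubleWell U x₀ x₁ x₂) (hε : 0 < ε)
    (g : ℕ) : ∫ ω, ∑ k ∈ Finset.range (2 * g), trappedTime U x₀ x₁ x₂ ε k (E k ω) ∂P =
      g * meanRound U x₀ x₁ x₂ ε := by
  have := hE.isProb
  rw [integral_finsetSum _ fun k _ => (hE.memLp_trapped hU hε k).integrable (by norm_num)]
  induction g with
  | zero => simp
  | succ g ih =>
    rw [Nat.mul_succ, Finset.sum_range_succ, Finset.sum_range_succ, ih, trappedTime_even,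
      trappedTime_odd, hE.integral_comp _ (measurable_trappedTime hU ε 0),
      hE.integral_comp _ (measurable_trappedTime hU ε 1), meanRound]
    push_cast
    ring

/-- Chebyshev's inequality for the total duration of `g` rounds. -/
theorem IsClock.measure_sum_trapped_le (hE : IsClock P E) (hU : IsDoubleWell U x₀ x₁ x₂)
    (hε : 0 < ε) {V : ℝ}
    (hV : ∀ n, ∫ x, trappedTime U x₀ x₁ x₂ ε n x ^ 2 ∂expMeasure 1 ≤ V) (g : ℕ) {c : ℝ}
    (hc : 0 < c) :
    P.real {ω | c ≤ |(∑ k ∈ Finset.range (2 * g), trappedTime U x₀ x₁ x₂ ε k (E k ω)) -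
      g * meanRound U x₀ x₁ x₂ ε|} ≤ 2 * g * V / c ^ 2 := by
  have := hE.isProb
  have hL := hE.memLp_trapped hU hε
  have hsum : MemLp (∑ k ∈ Finset.range (2 * g),
      fun ω => trappedTime U x₀ x₁ x₂ ε k (E k ω)) 2 P :=
    memLp_finsetSum' _ fun k _ => hL k
  have hvar : variance (∑ k ∈ Finset.range (2 * g),
      fun ω => trappedTime U x₀ x₁ x₂ ε k (E k ω)) P ≤ 2 * g * V := by
    rw [IndepFun.variance_sum (fun k _ => hL k)]
    · calc _ ≤ ∑ k ∈ Finset.range (2 * g), V := by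
            refine Finset.sum_le_sum fun k _ => ?_
            refine (variance_le_expectation_sq (hL k).aestronglyMeasurable).trans ?_
            have h := hE.integral_comp k ((measurable_trappedTime hU ε k).pow_const 2)
            simp only [Pi.pow_apply]
            rw [h]
            exact hV k
        _ = 2 * g * V := by simp
    · intro i _ j _ hij
      exact (hE.indep.indepFun hij).comp (measurable_trappedTime hU ε i)
        (measurable_trappedTime hU ε j)
  have h := meas_ge_le_variance_div_sq hsum hc
  have hint := hE.integral_sum_trapped hU hε g
  simp only [Finset.sum_apply] at h
  rw [hint] at h
  have h0 : 0 ≤ variance (∑ k ∈ Finset.range (2 * g),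
      fun ω => trappedTime U x₀ x₁ x₂ ε k (E k ω)) P / c ^ 2 :=
    div_nonneg (variance_nonneg _ _) (by positivity)
  refine (ENNReal.toReal_le_of_le_ofReal h0 h).trans ?_
  gcongr

theorem IsClock.measureReal_fails (hE : IsClock P E) (hU : IsDoubleWell U x₀ x₁ x₂) (hε : 0 < ε)
    (j : ℕ) : P.real {ω | Fails U x₀ x₁ ε (fun k => E k ω) j} =
      (1 - Real.exp (-((U x₁ - U x₀) / ε))) ^ j := by
  have hle : Real.exp (-((U x₁ - U x₀) / ε)) ≤ 1 :=
    Real.exp_le_one_iff.2 (neg_nonpos.2 (div_pos hU.barrier_left_pos hε).le)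
  rw [measureReal_def, hE.measure_fails hU hε, ENNReal.toReal_pow, ← ENNReal.ofReal_one,
    ← ENNReal.ofReal_sub _ (Real.exp_pos _).le, ENNReal.toReal_ofReal (by linarith)]

/-- If `g` attempts fail but the process is not trapped, then `g` rounds took at most `s`, which
lies below their mean. Chebyshev bounds this deviation. -/
theorem IsClock.le_measure_trapped (hE : IsClock P E) (hU : IsDoubleWell U x₀ x₁ x₂)
    (hε : 0 < ε) {V : ℝ}
    (hV : ∀ n, ∫ x, trappedTime U x₀ x₁ x₂ ε n x ^ 2 ∂expMeasure 1 ≤ V) (g : ℕ) {s : ℝ}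
    (hs : s < g * meanRound U x₀ x₁ x₂ ε) :
    (1 - Real.exp (-((U x₁ - U x₀) / ε))) ^ g -
      2 * g * V / (g * meanRound U x₀ x₁ x₂ ε - s) ^ 2 ≤
      P.real {ω | Trapped U x₀ x₁ x₂ ε (fun k => E k ω) s} := by
  have := hE.isProb
  rw [sub_le_iff_le_add, ← hE.measureReal_fails hU hε]
  refine le_trans ?_ (add_le_add_right (hE.measure_sum_trapped_le hU hε hV g (sub_pos.2 hs)) _)
  refine le_trans ?_ (measureReal_union_le _ _)
  refine ENNReal.toReal_mono (measure_ne_top _ _) (measure_mono_ae ?_)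
  filter_upwards [hE.ae_pos] with ω hω hf
  by_cases hlt : s < ∑ k ∈ Finset.range (2 * g), trappedTime U x₀ x₁ x₂ ε k (E k ω)
  · exact Or.inl (hU.trapped_of_fails hε hω hf hlt)
  · right
    rw [Set.mem_ofPred_eq]
    refine le_trans ?_ (neg_le_abs _)
    linarith

theorem IsClock.measure_trapped_le (hE : IsClock P E) (hU : IsDoubleWell U x₀ x₁ x₂)
    (hε : 0 < ε) {V : ℝ}
    (hV : ∀ n, ∫ x, trappedTime U x₀ x₁ x₂ ε n x ^ 2 ∂expMeasure 1 ≤ V) (g : ℕ) {s : ℝ}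
    (hs : g * meanRound U x₀ x₁ x₂ ε < s) :
    P.real {ω | Trapped U x₀ x₁ x₂ ε (fun k => E k ω) s} ≤
      (1 - Real.exp (-((U x₁ - U x₀) / ε))) ^ g +
      2 * g * V / (s - g * meanRound U x₀ x₁ x₂ ε) ^ 2 := by
  have := hE.isProb
  rw [← hE.measureReal_fails hU hε]
  refine le_trans ?_ (add_le_add_right (hE.measure_sum_trapped_le hU hε hV g (sub_pos.2 hs)) _)
  refine le_trans ?_ (measureReal_union_le _ _)
  refine ENNReal.toReal_mono (measure_ne_top _ _) (measure_mono_ae ?_)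
  filter_upwards [hE.ae_pos] with ω hω ht
  rcases hU.fails_or_of_trapped hε hω ht g with h | h
  · exact Or.inl h
  · right
    rw [Set.mem_ofPred_eq]
    refine le_trans ?_ (le_abs_self _)
    linarith

/-- `(1 - p) ^ g → e ^ (-t)` if `p → 0` and `g p → t`. -/
theorem tendsto_one_sub_pow {α : Type*} {l : Filter α} {p : α → ℝ} {g : α → ℕ} {t : ℝ}
    (hp : Tendsto p l (𝓝 0))
    (hg : Tendsto (fun a => g a * p a) l (𝓝 t)) :
    Tendsto (fun a => (1 - p a) ^ g a) l (𝓝 (Real.exp (-t))) := by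
  have hlow : Tendsto (fun a => Real.exp (-(g a * p a / (1 - p a)))) l (𝓝 (Real.exp (-t))) := by
    have h := (hg.div ((tendsto_const_nhds (x := (1 : ℝ))).sub hp) (by norm_num)).neg
    rw [sub_zero, div_one] at h
    exact (Real.continuous_exp.tendsto _).comp h
  have hup : Tendsto (fun a => Real.exp (-(g a * p a))) l (𝓝 (Real.exp (-t))) :=
    (Real.continuous_exp.tendsto _).comp hg.neg
  have hp1 : ∀ᶠ a in l, p a < 1 := hp.eventually_lt_const one_pos
  refine tendsto_of_tendsto_of_tendsto_of_le_of_le' hlow hup ?_ ?_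
  · filter_upwards [hp1] with a ha
    have h1 : 0 < 1 - p a := by linarith
    -- From `1 + x ≤ exp x` at `x = p / (1 - p)`, where `1 + x = 1 / (1 - p)`.
    have h2 : Real.exp (-(p a / (1 - p a))) ≤ 1 - p a := by
      have h3 := Real.add_one_le_exp (p a / (1 - p a))
      rw [div_add_one h1.ne', show p a + (1 - p a) = 1 by ring] at h3
      rw [Real.exp_neg, inv_le_comm₀ (Real.exp_pos _) h1, inv_eq_one_div]
      exact h3
    calc Real.exp (-(g a * p a / (1 - p a))) = Real.exp (-(p a / (1 - p a))) ^ g a := by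
          rw [← Real.exp_nat_mul]
          congr 1
          ring
      _ ≤ _ := by gcongr
  · filter_upwards [hp1] with a ha
    calc (1 - p a) ^ g a ≤ Real.exp (-p a) ^ g a := by
          have := Real.one_sub_le_exp_neg (p a)
          have h1 : 0 ≤ 1 - p a := by linarith
          gcongr
      _ = _ := by
          rw [← Real.exp_nat_mul]
          congr 1
          ring

/-- Exponential smallness absorbs every power of `1 / ε`; this is why crude polynomial bounds on
durations suffice. -/
theorem tendsto_exp_neg_div_div_pow {H : ℝ} (hH : 0 < H) (n : ℕ) :
    Tendsto (fun ε : ℝ => Real.exp (-(H / ε)) / ε ^ n) (𝓝[>] 0) (𝓝 0) := by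
  have h := (Real.tendsto_pow_mul_exp_neg_atTop_nhds_zero n).comp
    (tendsto_inv_nhdsGT_zero.const_mul_atTop hH : Tendsto (fun ε : ℝ => H * ε⁻¹) (𝓝[>] 0) atTop)
  have h2 := h.const_mul (1 / H ^ n)
  rw [mul_zero] at h2
  refine h2.congr fun ε => ?_
  simp only [Function.comp_apply, mul_pow, div_eq_mul_inv, inv_pow]
  field_simp

end VelocityJump


/-! ### Limits as the temperature tends to zero -/

namespace VelocityJump

variable {Ω : Type*} [MeasurableSpace Ω] {P : Measure Ω} {E : ℕ → Ω → ℝ}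
  {U : ℝ → ℝ} {x₀ x₁ x₂ : ℝ}

theorem exists_le_duration (hU : IsDoubleWell U x₀ x₁ x₂) :
    ∃ κ, 0 < κ ∧ κ ≤ 1 ∧ ∀ ε, 0 < ε → ε ≤ 1 → ∀ d w h, ε ≤ h →
      κ * ε ≤ duration U x₀ x₁ x₂ d w h := by
  obtain ⟨M, hM, hle⟩ := hU.exists_le_excursionTime
  have hκ : (M + 1)⁻¹ ≤ 1 := inv_le_one_of_one_le₀ (by linarith)
  refine ⟨(M + 1)⁻¹, by positivity, hκ, fun ε hε hε1 d w h hh => ?_⟩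
  refine le_trans (le_min ?_ ?_) (hle ε hε d w h hh)
  · exact mul_le_one₀ hκ hε.le hε1
  · rw [div_eq_inv_mul]
    gcongr
    linarith

theorem exists_meanRound_le (hU : IsDoubleWell U x₀ x₁ x₂) :
    ∃ K, 0 ≤ K ∧ ∀ ε, 0 < ε → ε ≤ 1 → meanRound U x₀ x₁ x₂ ε ≤ K := by
  obtain ⟨V, hV0, hV⟩ := exists_integral_sq_trappedTime_le hU
  refine ⟨2 * (1 + V), by positivity, fun ε hε hε1 => ?_⟩
  have h : ∀ n, ∫ x, trappedTime U x₀ x₁ x₂ ε n x ∂expMeasure 1 ≤ 1 + V := by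
    intro n
    have h1 : ∫ x, trappedTime U x₀ x₁ x₂ ε n x ∂expMeasure 1 ≤
        ∫ x, (1 + trappedTime U x₀ x₁ x₂ ε n x ^ 2) ∂expMeasure 1 :=
      integral_mono (integrable_trappedTime hU hε n)
        ((integrable_const _).add (integrable_sq_trappedTime hU hε n)) fun x => by
          nlinarith [sq_nonneg (trappedTime U x₀ x₁ x₂ ε n x - 1)]
    rw [integral_add (integrable_const _) (integrable_sq_trappedTime hU hε n)] at h1
    simp only [integral_const, probReal_univ, one_smul] at h1
    linarith [hV ε hε hε1 n]
  unfold meanRound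
  linarith [h 0, h 1]

theorem tendsto_exp_neg_div {H : ℝ} (hH : 0 < H) :
    Tendsto (fun ε : ℝ => Real.exp (-(H / ε))) (𝓝[>] 0) (𝓝 0) := by
  simpa using tendsto_exp_neg_div_div_pow hH 0

/-- On the time scale of the mean hitting time, the time of the first transition is exponentially
distributed in the limit. -/
theorem IsClock.tendsto_trapped (hE : IsClock P E) (hU : IsDoubleWell U x₀ x₁ x₂) {t d : ℝ}
    (ht : 0 < t) {s : ℝ → ℝ}
    (hs : ∀ ε, 0 < ε → t * (meanRound U x₀ x₁ x₂ ε * Real.exp ((U x₁ - U x₀) / ε)) ≤ s ε ∧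
      s ε ≤ t * (meanRound U x₀ x₁ x₂ ε * Real.exp ((U x₁ - U x₀) / ε) + d)) :
    Tendsto (fun ε => P.real {ω | Trapped U x₀ x₁ x₂ ε (fun k => E k ω) (s ε)}) (𝓝[>] 0)
      (𝓝 (Real.exp (-t))) := by
  obtain ⟨κ, hκ, -, hκle⟩ := exists_le_duration hU
  obtain ⟨V, hV0, hV⟩ := exists_integral_sq_trappedTime_le hU
  have hH := hU.barrier_left_pos
  set H := U x₁ - U x₀ with hHdef
  set p : ℝ → ℝ := fun ε => Real.exp (-(H / ε)) with hp
  set m : ℝ → ℝ := fun ε => meanRound U x₀ x₁ x₂ ε with hm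
  set κ' := κ * Real.exp (-1) with hκ'
  have hκ'0 : 0 < κ' := by positivity
  have hmle : ∀ ε, 0 < ε → ε ≤ 1 → κ' * ε ≤ m ε := fun ε hε hε1 => by
    have := le_meanRound hU hε (hκle ε hε hε1)
    calc κ' * ε = κ * ε * Real.exp (-1) := by rw [hκ']; ring
      _ ≤ m ε := this
  have hpp : ∀ ε, 0 < p ε := fun ε => Real.exp_pos _
  have hpe : ∀ ε, p ε * Real.exp (H / ε) = 1 := fun ε => by
    rw [hp, ← Real.exp_add]
    simp
  have hp0 : Tendsto p (𝓝[>] 0) (𝓝 0) := tendsto_exp_neg_div hH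
  have hev : ∀ᶠ ε in 𝓝[>] (0 : ℝ), 0 < ε ∧ ε < 1 ∧ p ε < t :=
    (eventually_mem_nhdsWithin).and (((tendsto_nhdsWithin_of_tendsto_nhds tendsto_id).eventually_lt_const
      one_pos).and (hp0.eventually_lt_const ht))
  -- The number of mean rounds that fit into the time `s`; it satisfies `p r → t`.
  set r : ℝ → ℝ := fun ε => s ε / m ε with hr
  have hr1 : ∀ ε, 0 < ε → ε < 1 → t ≤ p ε * r ε ∧ p ε * r ε ≤ t + t * d / κ' * (p ε / ε ^ 1) := by
    intro ε hε hε1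
    have hm0 : 0 < m ε := (mul_pos hκ'0 hε).trans_le (hmle ε hε hε1.le)
    obtain ⟨h1, h2⟩ := hs ε hε
    have h1' : t * m ε ≤ p ε * s ε := by
      calc t * m ε = t * m ε * (p ε * Real.exp (H / ε)) := by rw [hpe, mul_one]
        _ = p ε * (t * (m ε * Real.exp (H / ε))) := by ring
        _ ≤ _ := mul_le_mul_of_nonneg_left h1 (hpp ε).le
    have h2' : p ε * s ε ≤ t * m ε + t * d * p ε := by
      calc p ε * s ε ≤ p ε * (t * (m ε * Real.exp (H / ε) + d)) :=
            mul_le_mul_of_nonneg_left h2 (hpp ε).le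
        _ = t * m ε * (p ε * Real.exp (H / ε)) + t * d * p ε := by ring
        _ = _ := by rw [hpe, mul_one]
    -- The sign of `d` is not assumed; the two bounds on `s` force it.
    have hd : 0 ≤ t * d := by
      have : t * (m ε * Real.exp (H / ε)) ≤ t * (m ε * Real.exp (H / ε)) + t * d := by
        rw [← mul_add]; exact h1.trans h2
      linarith
    have h3 : p ε * r ε = p ε * s ε / m ε := by rw [hr]; ring
    rw [h3]
    refine ⟨(le_div_iff₀ hm0).2 h1', (div_le_iff₀ hm0).2 (h2'.trans ?_)⟩
    have h4 : t * d * p ε ≤ t * d / κ' * (p ε / ε ^ 1) * m ε := by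
      calc t * d * p ε = t * d / κ' * (p ε / ε ^ 1) * (κ' * ε) := by field_simp
        _ ≤ _ := by
          refine mul_le_mul_of_nonneg_left (hmle ε hε hε1.le) ?_
          have := hpp ε
          positivity
    linarith
  have hprt : Tendsto (fun ε => p ε * r ε) (𝓝[>] 0) (𝓝 t) := by
    have h1 := (((tendsto_exp_neg_div_div_pow hH 1).const_mul (t * d / κ')).const_add t)
    rw [mul_zero, add_zero] at h1
    refine tendsto_of_tendsto_of_tendsto_of_le_of_le' tendsto_const_nhds h1 ?_ ?_
    · filter_upwards [hev] with ε hε using (hr1 ε hε.1 hε.2.1).1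
    · filter_upwards [hev] with ε hε using (hr1 ε hε.1 hε.2.1).2
  have hid : Tendsto (fun ε : ℝ => ε) (𝓝[>] 0) (𝓝 0) :=
    tendsto_nhdsWithin_of_tendsto_nhds tendsto_id
  have hr0 : ∀ ε, 0 < ε → ε < 1 → p ε < t → 1 ≤ r ε := by
    intro ε hε hε1 hpt
    have h1 := (hr1 ε hε hε1).1
    by_contra hlt
    have := mul_lt_mul_of_pos_left (not_le.1 hlt) (hpp ε)
    linarith
  -- The relative margin `ε` puts the mean total duration at a distance at least `ε s` from `s`,
  -- while the limit of `g p` is unchanged.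
  set gu : ℝ → ℕ := fun ε => ⌈(1 + ε) * r ε⌉₊ with hgu
  set gl : ℝ → ℕ := fun ε => ⌊(1 - ε) * r ε⌋₊ with hgl
  have hgut : Tendsto (fun ε => (gu ε : ℝ) * p ε) (𝓝[>] 0) (𝓝 t) := by
    have h1 := ((hid.const_add 1).mul hprt)
    have h2 := h1.add hp0
    rw [add_zero, one_mul] at h1
    rw [add_zero, add_zero, one_mul] at h2
    refine tendsto_of_tendsto_of_tendsto_of_le_of_le' h1 h2 ?_ ?_
    · filter_upwards [hev] with ε hε
      calc (1 + ε) * (p ε * r ε) = (1 + ε) * r ε * p ε := by ring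
        _ ≤ _ := mul_le_mul_of_nonneg_right (Nat.le_ceil _) (hpp ε).le
    · filter_upwards [hev] with ε hε
      have h3 : (0 : ℝ) ≤ (1 + ε) * r ε := by
        have := hr0 ε hε.1 hε.2.1 hε.2.2
        have := hε.1
        positivity
      calc (gu ε : ℝ) * p ε ≤ ((1 + ε) * r ε + 1) * p ε :=
            mul_le_mul_of_nonneg_right (Nat.ceil_lt_add_one h3).le (hpp ε).le
        _ = _ := by ring
  have hglt : Tendsto (fun ε => (gl ε : ℝ) * p ε) (𝓝[>] 0) (𝓝 t) := by
    have h1 := ((hid.const_sub 1).mul hprt)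
    have h2 := h1.sub hp0
    rw [sub_zero, one_mul] at h1
    rw [sub_zero, sub_zero, one_mul] at h2
    refine tendsto_of_tendsto_of_tendsto_of_le_of_le' h2 h1 ?_ ?_
    · filter_upwards [hev] with ε hε
      calc (1 - ε) * (p ε * r ε) - p ε = ((1 - ε) * r ε - 1) * p ε := by ring
        _ ≤ _ := mul_le_mul_of_nonneg_right (Nat.sub_one_lt_floor _).le (hpp ε).le
    · filter_upwards [hev] with ε hε
      have h3 : (0 : ℝ) ≤ (1 - ε) * r ε :=
        mul_nonneg (by linarith [hε.2.1]) (by linarith [hr0 ε hε.1 hε.2.1 hε.2.2])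
      calc (gl ε : ℝ) * p ε ≤ ((1 - ε) * r ε) * p ε :=
            mul_le_mul_of_nonneg_right (Nat.floor_le h3) (hpp ε).le
        _ = _ := by ring
  have herr : Tendsto (fun ε => 6 * V / (t * κ' ^ 2) * (p ε / ε ^ 4)) (𝓝[>] 0) (𝓝 0) := by
    simpa using (tendsto_exp_neg_div_div_pow hH 4).const_mul (6 * V / (t * κ' ^ 2))
  -- With `c ≥ ε r m`, `m ≥ κ' ε` and `1 / r ≤ p / t`, Chebyshev's bound is of order `p / ε ^ 4`.
  -- The factor 3 covers rounding up: `(1 + ε) r + 1 ≤ 3 r`.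
  have hbound : ∀ ε, 0 < ε → ε < 1 → p ε < t → ∀ g : ℝ, 0 ≤ g → g ≤ 3 * r ε → ∀ c,
      ε * s ε ≤ c → 2 * g * V / c ^ 2 ≤ 6 * V / (t * κ' ^ 2) * (p ε / ε ^ 4) := by
    intro ε hε hε1 hpt g hg0 hg c hc
    have hm0 : 0 < m ε := (mul_pos hκ'0 hε).trans_le (hmle ε hε hε1.le)
    have hrr := hr0 ε hε hε1 hpt
    have hsr : s ε = r ε * m ε := by rw [hr]; field_simp
    have hrpos : 0 < r ε := by linarith
    have hppos := hpp ε
    have h1 : ε * (r ε * (κ' * ε)) ≤ c := by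
      refine le_trans ?_ hc
      rw [hsr]
      have := hmle ε hε hε1.le
      gcongr
    calc 2 * g * V / c ^ 2 ≤ 2 * (3 * r ε) * V / (ε * (r ε * (κ' * ε))) ^ 2 := by gcongr
      _ = 6 * V / κ' ^ 2 / ε ^ 4 * (1 / r ε) := by field_simp; ring
      _ ≤ 6 * V / κ' ^ 2 / ε ^ 4 * (p ε / t) := by
        gcongr 6 * V / κ' ^ 2 / ε ^ 4 * ?_
        rw [div_le_div_iff₀ hrpos ht]
        linarith [(hr1 ε hε hε1).1]
      _ = _ := by field_simp
  have hlow := (tendsto_one_sub_pow hp0 hgut).sub herr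
  have hup := (tendsto_one_sub_pow hp0 hglt).add herr
  rw [sub_zero] at hlow
  rw [add_zero] at hup
  refine tendsto_of_tendsto_of_tendsto_of_le_of_le' hlow hup ?_ ?_
  · filter_upwards [hev] with ε ⟨hε, hε1, hpt⟩
    have hm0 : 0 < m ε := (mul_pos hκ'0 hε).trans_le (hmle ε hε hε1.le)
    have hrr := hr0 ε hε hε1 hpt
    have hsr : s ε = r ε * m ε := by rw [hr]; field_simp
    have hspos : 0 < s ε := by rw [hsr]; positivity
    have hg1 : (1 + ε) * r ε ≤ gu ε := Nat.le_ceil _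
    have hg2 : (gu ε : ℝ) < (1 + ε) * r ε + 1 := Nat.ceil_lt_add_one (by positivity)
    have hc : ε * s ε ≤ gu ε * m ε - s ε := by
      have h1 := mul_le_mul_of_nonneg_right hg1 hm0.le
      have h2 : (1 + ε) * r ε * m ε = s ε + ε * s ε := by rw [hsr]; ring
      linarith
    have h3 : (gu ε : ℝ) ≤ 3 * r ε := by nlinarith
    have h4 := hE.le_measure_trapped hU hε (hV ε hε hε1.le) (gu ε) (s := s ε)
      (by have := mul_pos hε hspos; change s ε < gu ε * m ε; linarith)
    have h5 := hbound ε hε hε1 hpt (gu ε) (Nat.cast_nonneg _) h3 _ hc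
    exact le_trans (sub_le_sub_left h5 _) h4
  · filter_upwards [hev] with ε ⟨hε, hε1, hpt⟩
    have hm0 : 0 < m ε := (mul_pos hκ'0 hε).trans_le (hmle ε hε hε1.le)
    have hrr := hr0 ε hε hε1 hpt
    have hsr : s ε = r ε * m ε := by rw [hr]; field_simp
    have hspos : 0 < s ε := by rw [hsr]; positivity
    have hg1 : (gl ε : ℝ) ≤ (1 - ε) * r ε :=
      Nat.floor_le (mul_nonneg (by linarith) (by linarith))
    have hc : ε * s ε ≤ s ε - gl ε * m ε := by
      have h1 := mul_le_mul_of_nonneg_right hg1 hm0.le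
      have h2 : (1 - ε) * r ε * m ε = s ε - ε * s ε := by rw [hsr]; ring
      linarith
    have h3 : (gl ε : ℝ) ≤ 3 * r ε := by nlinarith
    have h4 := hE.measure_trapped_le hU hε (hV ε hε hε1.le) (gl ε) (s := s ε)
      (by have := mul_pos hε hspos; change gl ε * m ε < s ε; linarith)
    have h5 := hbound ε hε hε1 hpt (gl ε) (Nat.cast_nonneg _) h3 _ hc
    exact h4.trans (add_le_add_right h5 _)

open Classical in
/-- The process is localized at the bottom of a well, and does not return from the lower well. -/
theorem IsClock.tendsto_lintegral_abs_dist_sub (hE : IsClock P E) (hU : IsDoubleWell U x₀ x₁ x₂)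
    (hlt : U x₂ < U x₀) {t d : ℝ} (ht : 0 < t) {s : ℝ → ℝ}
    (hs : ∀ ε, 0 < ε → 0 ≤ s ε ∧
      s ε ≤ t * (meanRound U x₀ x₁ x₂ ε * Real.exp ((U x₁ - U x₀) / ε) + d)) :
    Tendsto (fun ε => ∫⁻ ω, ENNReal.ofReal
      |(|(process U ε x₀ (-1) (fun k => E k ω) (s ε)).1 - x₂|) -
        (if Trapped U x₀ x₁ x₂ ε (fun k => E k ω) (s ε) then x₂ - x₀ else 0)| ∂P) (𝓝[>] 0)
      (𝓝 0) := by
  obtain ⟨κ, hκ, hκ1, hκle⟩ := exists_le_duration hU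
  obtain ⟨K, hK0, hK⟩ := exists_meanRound_le hU
  obtain ⟨C₀, hC₀0, hC₀⟩ := hU.exists_target_le
  have hL : 0 < x₂ - x₀ := sub_pos.2 hU.lt
  obtain ⟨C, hC0, hC, hCL⟩ : ∃ C, 0 ≤ C ∧ (∀ d w w' h, 0 < h →
      |target U x₀ x₂ d w h - bottom x₀ x₂ w'| ≤ C * (1 + h)) ∧ x₂ - x₀ ≤ C := by
    refine ⟨max C₀ (x₂ - x₀), le_max_of_le_left hC₀0, fun d w w' h hh => ?_, le_max_right _ _⟩
    exact (hC₀ d w w' h hh).trans (mul_le_mul_of_nonneg_right (le_max_left _ _) (by linarith))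
  have hH2 := hU.barrier_right_pos
  have hid : Tendsto (fun ε : ℝ => ε) (𝓝[>] 0) (𝓝 0) :=
    tendsto_nhdsWithin_of_tendsto_nhds tendsto_id
  -- Returns: the time horizon grows at most like `exp ((U x₁ - U x₀) / ε)`, each excursion returns
  -- with probability at most `exp (-(U x₁ - U x₂) / ε)`, and the product is small because the right
  -- well is lower.
  have hret : Tendsto (fun ε => (x₂ - x₀) * (Real.exp 1 * (1 + (s ε + 1) / (κ * ε))) *
      Real.exp (-((U x₁ - U x₂) / ε))) (𝓝[>] 0) (𝓝 0) := by
    have h1 := tendsto_exp_neg_div hH2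
    have h2 := tendsto_exp_neg_div_div_pow (sub_pos.2 hlt) 1
    have h3 := tendsto_exp_neg_div_div_pow hH2 1
    have h4 := ((h1.add ((h2.const_mul (t * K / κ)).add (h3.const_mul ((t * d + 1) / κ)))).const_mul
      ((x₂ - x₀) * Real.exp 1))
    simp only [mul_zero, add_zero] at h4
    refine squeeze_zero' ?_ ?_ h4
    · filter_upwards [eventually_mem_nhdsWithin] with ε hε
      have hε0 : 0 < ε := hε
      have := (hs ε hε).1
      positivity
    · filter_upwards [eventually_mem_nhdsWithin, hid.eventually_lt_const one_pos] with ε hε hε1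
      have hε0 : 0 < ε := hε
      have h5 := (hs ε hε).2
      have h6 : s ε + 1 ≤ t * K * Real.exp ((U x₁ - U x₀) / ε) + (t * d + 1) := by
        have h7 : t * (meanRound U x₀ x₁ x₂ ε * Real.exp ((U x₁ - U x₀) / ε)) ≤
            t * (K * Real.exp ((U x₁ - U x₀) / ε)) := by
          have := hK ε hε hε1.le
          gcongr
        linarith
      have h8 : Real.exp ((U x₁ - U x₀) / ε) * Real.exp (-((U x₁ - U x₂) / ε)) =
          Real.exp (-((U x₀ - U x₂) / ε)) := by
        rw [← Real.exp_add]
        congr 1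
        ring
      calc (x₂ - x₀) * (Real.exp 1 * (1 + (s ε + 1) / (κ * ε))) * Real.exp (-((U x₁ - U x₂) / ε))
          ≤ (x₂ - x₀) * (Real.exp 1 * (1 + (t * K * Real.exp ((U x₁ - U x₀) / ε) +
            (t * d + 1)) / (κ * ε))) * Real.exp (-((U x₁ - U x₂) / ε)) := by gcongr
        _ = (x₂ - x₀) * Real.exp 1 * (Real.exp (-((U x₁ - U x₂) / ε)) +
            (t * K / κ * ((Real.exp ((U x₁ - U x₀) / ε) * Real.exp (-((U x₁ - U x₂) / ε))) / ε ^ 1) +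
            (t * d + 1) / κ * (Real.exp (-((U x₁ - U x₂) / ε)) / ε ^ 1))) := by
          field_simp
        _ = _ := by rw [h8]
  rw [ENNReal.tendsto_nhds_zero]
  intro b hb
  obtain ⟨a, ha0, hab⟩ := ENNReal.lt_iff_exists_nnreal_btwn.1 hb
  have ha : (0 : ℝ) < a := by exact_mod_cast ha0
  -- One third each for the width of typical excursions, for returns and for untypical current
  -- excursions.
  have hδ : (0 : ℝ) < a / 3 := by positivity
  obtain ⟨η, hη0, hη1, -, hη⟩ := hU.exists_target_near hδ
  have hbad : Tendsto (fun ε : ℝ => ENNReal.ofReal (2 * C * Real.exp 1 * (1 + 2 * C) / η ^ 2 *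
      (ε ^ 2 / (κ * ε))) * ∫⁻ x, ENNReal.ofReal ((1 + x) ^ 4) ∂expMeasure 1) (𝓝[>] 0) (𝓝 0) := by
    have h1 : Tendsto (fun ε : ℝ => 2 * C * Real.exp 1 * (1 + 2 * C) / η ^ 2 *
      (ε ^ 2 / (κ * ε))) (𝓝[>] 0) (𝓝 0) := by
      have h2 := hid.const_mul (2 * C * Real.exp 1 * (1 + 2 * C) / η ^ 2 / κ)
      rw [mul_zero] at h2
      refine h2.congr' ?_
      filter_upwards [eventually_mem_nhdsWithin] with ε hε
      have hε0 : ε ≠ 0 := (Set.mem_Ioi.1 hε).ne'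
      field_simp
    have h3 := ENNReal.Tendsto.mul_const (ENNReal.tendsto_ofReal h1)
      (b := ∫⁻ x, ENNReal.ofReal ((1 + x) ^ 4) ∂expMeasure 1)
      (Or.inr lintegral_one_add_pow_four_lt_top.ne)
    simpa using h3
  have hδ' : 0 < ENNReal.ofReal (a / 3) := ENNReal.ofReal_pos.2 hδ
  filter_upwards [eventually_mem_nhdsWithin, hid.eventually_lt_const one_pos,
    hret.eventually_lt_const hδ, hbad.eventually_lt_const hδ'] with ε hε hε1 h1 h2
  have hε0 : 0 < ε := hε
  refine (hE.lintegral_abs_dist_sub_le hU hε0 hε1.le (hs ε hε0).1 hη0 hη1 hη hC0 hC hCL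
    (mul_pos hκ hε0) (mul_le_one₀ hκ1 hε0.le hε1.le) (hκle ε hε0 hε1.le)).trans ?_
  refine le_trans (add_le_add (add_le_add_right (ENNReal.ofReal_le_ofReal h1.le) _) h2.le) ?_
  rw [← ENNReal.ofReal_add hδ.le hδ.le, ← ENNReal.ofReal_add (by positivity) hδ.le]
  refine le_trans ?_ hab.le
  rw [show (a : ℝ) / 3 + a / 3 + a / 3 = a by ring, ENNReal.ofReal_coe_nnreal]

end VelocityJump


/-! ### Laplace's method and Wasserstein comparisons -/

namespace IsDoubleWell

open VelocityJump

variable {U : ℝ → ℝ} {x₀ x₁ x₂ : ℝ}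

theorem le_of_le_top (hU : IsDoubleWell U x₀ x₁ x₂) {z : ℝ} (hz : z ≤ x₁) : U x₀ ≤ U z := by
  rcases le_total z x₀ with h | h
  · exact hU.strictAntiOn_left.antitoneOn h Set.self_mem_Iic h
  · exact hU.strictMonoOn_left.monotoneOn ⟨le_rfl, hU.lt_left.le⟩ ⟨h, hz⟩ h

theorem le_of_top_le (hU : IsDoubleWell U x₀ x₁ x₂) {z : ℝ} (hz : x₁ ≤ z) : U x₂ ≤ U z := by
  rcases le_total z x₂ with h | h
  · exact hU.strictAntiOn_right.antitoneOn ⟨hz, h⟩ ⟨hU.lt_right.le, le_rfl⟩ h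
  · exact hU.strictMonoOn_right.monotoneOn Set.self_mem_Ici h h

/-- `U` is monotone on either side of `x₂` as far as the top, and to the left of the top it is at
least `U x₀ > U x₂`. The distance is truncated at `x₂ - x₁` to stay in the right well. -/
theorem exists_gap (hU : IsDoubleWell U x₀ x₁ x₂) (hlt : U x₂ < U x₀) {δ : ℝ} (hδ : 0 < δ) :
    ∃ θ, 0 < θ ∧ ∀ z, δ ≤ |z - x₂| → θ ≤ U z - U x₂ := by
  have hr := hU.lt_right
  set δ' := min δ (x₂ - x₁) with hδ'
  have hδ'0 : 0 < δ' := lt_min hδ (by linarith)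
  have hδ'1 : δ' ≤ x₂ - x₁ := min_le_right _ _
  have hmem : x₂ - δ' ∈ Set.Icc x₁ x₂ := ⟨by linarith, by linarith⟩
  have h1 : U x₂ < U (x₂ + δ) :=
    hU.strictMonoOn_right Set.self_mem_Ici (by simp [hδ.le]) (by linarith)
  have h2 : U x₂ < U (x₂ - δ') :=
    hU.strictAntiOn_right hmem ⟨hr.le, le_rfl⟩ (by linarith)
  refine ⟨min (U (x₂ + δ) - U x₂) (min (U (x₂ - δ') - U x₂) (U x₀ - U x₂)),
    lt_min (by linarith) (lt_min (by linarith) (by linarith)), fun z hz => ?_⟩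
  rcases le_abs.1 hz with h | h
  · refine (min_le_left _ _).trans (sub_le_sub_right ?_ _)
    exact hU.strictMonoOn_right.monotoneOn (by simp [hδ.le]) (Set.mem_Ici.2 (by linarith))
      (by linarith)
  · rcases le_total z x₁ with h3 | h3
    · exact (min_le_right _ _).trans ((min_le_right _ _).trans
        (sub_le_sub_right (hU.le_of_le_top h3) _))
    · refine (min_le_right _ _).trans ((min_le_left _ _).trans (sub_le_sub_right ?_ _))
      exact hU.strictAntiOn_right.antitoneOn ⟨h3, by linarith⟩ hmem
        (by linarith [min_le_left δ (x₂ - x₁)])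

theorem exists_coercive (hU : IsDoubleWell U x₀ x₁ x₂) (hlt : U x₂ < U x₀) :
    ∃ c C, 0 < c ∧ ∀ z, c * |z - x₂| - C ≤ U z - U x₂ := by
  obtain ⟨a, ha, h1⟩ := hU.exists_linear_growth
  obtain ⟨b, hb, h2⟩ := hU.comp_neg.exists_linear_growth
  have hL := hU.lt
  have hc : 0 < min a b := lt_min ha hb
  refine ⟨min a b, min a b * (x₂ - x₀ + 1), hc, fun z => ?_⟩
  rcases le_total x₂ z with h | h
  · rw [abs_of_nonneg (by linarith)]
    rcases le_total 1 (z - x₂) with h3 | h3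
    · have := mul_le_mul_of_nonneg_right (min_le_left a b) (by linarith : 0 ≤ z - x₂ - 1)
      nlinarith [h1 z h]
    · have := hU.le_of_top_le (hU.lt_right.le.trans h)
      nlinarith
  · rw [abs_of_nonpos (by linarith)]
    have hpos : U x₂ ≤ U z := by
      rcases le_total z x₁ with h3 | h3
      · linarith [hU.le_of_le_top h3]
      · exact hU.le_of_top_le h3
    rcases le_total (z + 1) x₀ with h3 | h3
    · have h4 := h2 (-z) (by linarith)
      simp only [neg_neg] at h4
      have := mul_le_mul_of_nonneg_right (min_le_right a b) (by linarith : 0 ≤ x₀ - z - 1)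
      nlinarith
    · nlinarith

end IsDoubleWell

namespace VelocityJump

variable {U : ℝ → ℝ} {x₀ x₁ x₂ : ℝ}

theorem integrable_one_add_mul_exp_neg {c : ℝ} (hc : 0 < c) (a : ℝ) :
    Integrable fun z : ℝ => (1 + |z - a|) * Real.exp (-(c * |z - a|)) := by
  have h : Integrable fun z : ℝ => (1 + |z|) * Real.exp (-(c * |z|)) := by
    -- The constant comes from `(1 + y) (1 + y²) = 1 + y + y² + y³` and `y ^ k ≤ k! / c ^ k * exp (c
    -- y)`.
    refine (integrable_inv_one_add_sq.const_mul (1 + 1 / c + 2 / c ^ 2 + 6 / c ^ 3)).mono'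
      (by fun_prop) (Eventually.of_forall fun z => ?_)
    have h0 := abs_nonneg z
    rw [Real.norm_of_nonneg (by positivity), ← div_eq_mul_inv, le_div_iff₀ (by positivity),
      Real.exp_neg, mul_right_comm, ← div_eq_mul_inv, div_le_iff₀ (Real.exp_pos _), ← sq_abs]
    set y := |z|
    have hy : 0 ≤ c * y := by positivity
    have e0 : 1 ≤ Real.exp (c * y) := Real.one_le_exp hy
    have e1 := Real.pow_div_factorial_le_exp (c * y) hy 1
    have e2 := Real.pow_div_factorial_le_exp (c * y) hy 2
    have e3 := Real.pow_div_factorial_le_exp (c * y) hy 3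
    simp only [Nat.factorial, Nat.cast_ofNat, pow_one, Nat.succ_eq_add_one, zero_add, mul_one,
      Nat.cast_one, div_one, Nat.reduceAdd, Nat.reduceMul] at e1 e2 e3
    have f1 : y ≤ 1 / c * Real.exp (c * y) := by
      calc y = 1 / c * (c * y) := by field_simp
        _ ≤ _ := by gcongr
    have f2 : y ^ 2 ≤ 2 / c ^ 2 * Real.exp (c * y) := by
      calc y ^ 2 = 2 / c ^ 2 * ((c * y) ^ 2 / 2) := by field_simp
        _ ≤ _ := by gcongr
    have f3 : y ^ 3 ≤ 6 / c ^ 3 * Real.exp (c * y) := by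
      calc y ^ 3 = 6 / c ^ 3 * ((c * y) ^ 3 / 6) := by field_simp
        _ ≤ _ := by gcongr
    linarith
  exact h.comp_sub_right a

theorem integrable_weight (hU : IsDoubleWell U x₀ x₁ x₂) (hlt : U x₂ < U x₀) {ε : ℝ} (hε : 0 < ε) :
    Integrable fun z : ℝ => (1 + |z - x₂|) * Real.exp (-(U z - U x₂) / ε) := by
  obtain ⟨c, C, hc, h⟩ := hU.exists_coercive hlt
  refine ((integrable_one_add_mul_exp_neg (div_pos hc hε) x₂).const_mul (Real.exp (C / ε))).mono'
    ?_ (Eventually.of_forall fun z => ?_)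
  · have := hU.continuous
    fun_prop
  · rw [Real.norm_of_nonneg (by positivity), mul_left_comm, ← Real.exp_add]
    gcongr
    have h1 : C / ε + -(c / ε * |z - x₂|) = -(c * |z - x₂| - C) / ε := by ring
    rw [h1]
    exact div_le_div_of_nonneg_right (neg_le_neg (h z)) hε.le

theorem integrable_exp_neg_div (hU : IsDoubleWell U x₀ x₁ x₂) (hlt : U x₂ < U x₀) {ε : ℝ}
    (hε : 0 < ε) : Integrable fun z : ℝ => Real.exp (-U z / ε) := by
  refine ((integrable_weight hU hlt hε).const_mul (Real.exp (-U x₂ / ε))).mono' ?_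
    (Eventually.of_forall fun z => ?_)
  · have := hU.continuous
    fun_prop
  · rw [Real.norm_of_nonneg (Real.exp_pos _).le, mul_left_comm, ← Real.exp_add,
      show -U x₂ / ε + -(U z - U x₂) / ε = -U z / ε by ring]
    exact le_mul_of_one_le_left (Real.exp_pos _).le (by linarith [abs_nonneg (z - x₂)])

theorem isProbabilityMeasure_gibbs (hU : IsDoubleWell U x₀ x₁ x₂) (hlt : U x₂ < U x₀) {ε : ℝ}
    (hε : 0 < ε) : IsProbabilityMeasure (gibbs U ε) :=
  isProbabilityMeasure_tilted (integrable_exp_neg_div hU hlt hε)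

/-- Laplace's method: the Gibbs measure concentrates at the lower bottom, in the first moment. -/
theorem tendsto_lintegral_gibbs (hU : IsDoubleWell U x₀ x₁ x₂) (hlt : U x₂ < U x₀) :
    Tendsto (fun ε => ∫⁻ z, ENNReal.ofReal |z - x₂| ∂gibbs U ε) (𝓝[>] 0) (𝓝 0) := by
  rw [ENNReal.tendsto_nhds_zero]
  intro b hb
  obtain ⟨a, ha0, hab⟩ := ENNReal.lt_iff_exists_nnreal_btwn.1 hb
  have ha : (0 : ℝ) < a := by exact_mod_cast ha0
  have hδ : (0 : ℝ) < a / 2 := by positivity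
  obtain ⟨θ, hθ, hgap⟩ := hU.exists_gap hlt hδ
  -- On this neighbourhood `U` exceeds its minimum by at most half the gap, which bounds the
  -- partition function from below.
  obtain ⟨r, hr0, hr⟩ : ∃ r, 0 < r ∧ ∀ z ∈ Set.Icc (x₂ - r) (x₂ + r), U z ≤ U x₂ + θ / 2 := by
    have h1 : ∀ᶠ z in 𝓝 x₂, U z < U x₂ + θ / 2 :=
      hU.continuous.continuousAt.eventually_lt_const (by linarith)
    obtain ⟨r, hr0, hr⟩ := Metric.eventually_nhds_iff.1 h1
    refine ⟨r / 2, by positivity, fun z hz => (hr ?_).le⟩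
    rw [Real.dist_eq, abs_lt]
    constructor <;> linarith [hz.1, hz.2]
  set I := ∫ z : ℝ, |z - x₂| * Real.exp (-(U z - U x₂) / 1) with hI
  have hIint : Integrable fun z : ℝ => |z - x₂| * Real.exp (-(U z - U x₂) / 1) := by
    refine (integrable_weight hU hlt one_pos).mono' ?_ (Eventually.of_forall fun z => ?_)
    · have := hU.continuous
      fun_prop
    · rw [Real.norm_of_nonneg (by positivity)]
      gcongr
      linarith
  have hlim : Tendsto (fun ε : ℝ => Real.exp (-(θ / 2 / ε)) * (Real.exp θ / (2 * r) * I))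
      (𝓝[>] 0) (𝓝 0) := by
    simpa using (tendsto_exp_neg_div (half_pos hθ)).mul_const (Real.exp θ / (2 * r) * I)
  filter_upwards [eventually_mem_nhdsWithin, hlim.eventually_lt_const hδ,
    (tendsto_nhdsWithin_of_tendsto_nhds (a := (0 : ℝ)) (s := Set.Ioi 0)
      tendsto_id).eventually_lt_const one_pos] with ε hε h1 hε1
  have hε0 : 0 < ε := hε
  simp only [id_eq] at hε1
  have hint := integrable_exp_neg_div hU hlt hε0
  set Z := ∫ z, Real.exp (-U z / ε) with hZ
  have hZle : 2 * r * Real.exp (-(U x₂ + θ / 2) / ε) ≤ Z := by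
    have h2 : ∫ z, (Set.Icc (x₂ - r) (x₂ + r)).indicator
        (fun _ => Real.exp (-(U x₂ + θ / 2) / ε)) z ≤ Z := by
      refine integral_mono ((integrable_indicator_iff measurableSet_Icc).2
        (integrableOn_const (by simp))) hint fun z => ?_
      rw [Set.indicator_apply]
      split_ifs with hz
      · simp only
        gcongr
        exact hr z hz
      · positivity
    rw [integral_indicator_const _ measurableSet_Icc, Real.volume_real_Icc_of_le (by linarith)]
      at h2
    rw [smul_eq_mul] at h2
    linarith
  have hZ0 : 0 < Z := lt_of_lt_of_le (by positivity) hZle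
  -- Points near `x₂` contribute at most `a / 2`. Far away `U - U x₂ ≥ θ`, so for `ε < 1` the weight
  -- is dominated by the one at temperature one, times a factor `exp (-θ / (2 ε))`.
  have hpt : ∀ z, Real.exp (-U z / ε) / Z * |z - x₂| ≤
      a / 2 * (Real.exp (-U z / ε) / Z) + Real.exp (-(θ / 2 / ε)) * (Real.exp θ / (2 * r)) *
        (|z - x₂| * Real.exp (-(U z - U x₂) / 1)) := by
    intro z
    have hE0 := Real.exp_pos (-U z / ε)
    rcases lt_or_ge |z - x₂| (a / 2) with hz | hz
    · refine le_trans ?_ (le_add_of_nonneg_right (by positivity))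
      rw [mul_comm]
      gcongr
    · refine le_trans ?_ (le_add_of_nonneg_left (by positivity))
      have hg := hgap z hz
      have h3 : Real.exp (-U z / ε) / Z ≤ Real.exp (-(θ / 2 / ε)) * (Real.exp θ / (2 * r)) *
          Real.exp (-(U z - U x₂) / 1) := by
        rw [div_le_iff₀ hZ0]
        calc Real.exp (-U z / ε) ≤ Real.exp (-(θ / 2 / ε) + θ + -(U z - U x₂) / 1 +
              -(U x₂ + θ / 2) / ε) := by
              gcongr
              have h4 : -(θ / 2 / ε) + θ + -(U z - U x₂) / 1 + -(U x₂ + θ / 2) / ε - -U z / ε =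
                  (U z - U x₂ - θ) * (1 - ε) / ε := by
                field_simp
                ring
              have h5 : 0 ≤ (U z - U x₂ - θ) * (1 - ε) / ε :=
                div_nonneg (mul_nonneg (by linarith) (by linarith)) hε0.le
              linarith
          _ = Real.exp (-(θ / 2 / ε)) * (Real.exp θ / (2 * r)) * Real.exp (-(U z - U x₂) / 1) *
              (2 * r * Real.exp (-(U x₂ + θ / 2) / ε)) := by
              rw [Real.exp_add, Real.exp_add, Real.exp_add]
              field_simp
          _ ≤ _ := by gcongr
      calc _ ≤ Real.exp (-(θ / 2 / ε)) * (Real.exp θ / (2 * r)) *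
          Real.exp (-(U z - U x₂) / 1) * |z - x₂| := by gcongr
        _ = _ := by ring
  have hint1 : Integrable fun z => a / 2 * (Real.exp (-U z / ε) / Z) :=
    (hint.div_const Z).const_mul _
  have hint2 : Integrable fun z => Real.exp (-(θ / 2 / ε)) * (Real.exp θ / (2 * r)) *
        (|z - x₂| * Real.exp (-(U z - U x₂) / 1)) := hIint.const_mul _
  rw [gibbs, lintegral_tilted]
  calc ∫⁻ z, ENNReal.ofReal (Real.exp (-U z / ε) / ∫ z, Real.exp (-U z / ε)) *
        ENNReal.ofReal |z - x₂|
      ≤ ∫⁻ z, ENNReal.ofReal (a / 2 * (Real.exp (-U z / ε) / Z) +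
        Real.exp (-(θ / 2 / ε)) * (Real.exp θ / (2 * r)) *
        (|z - x₂| * Real.exp (-(U z - U x₂) / 1))) := by
        refine lintegral_mono fun z => ?_
        rw [← ENNReal.ofReal_mul (by positivity)]
        exact ENNReal.ofReal_le_ofReal (hpt z)
    _ = ENNReal.ofReal (∫ z, (a / 2 * (Real.exp (-U z / ε) / Z) +
        Real.exp (-(θ / 2 / ε)) * (Real.exp θ / (2 * r)) *
        (|z - x₂| * Real.exp (-(U z - U x₂) / 1)))) :=
        (ofReal_integral_eq_lintegral_ofReal (hint1.add hint2)
          (Eventually.of_forall fun z => le_trans (by positivity) (hpt z))).symm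
    _ ≤ ENNReal.ofReal a := by
        refine ENNReal.ofReal_le_ofReal ?_
        rw [integral_add hint1 hint2, integral_const_mul, integral_const_mul, integral_div, ← hZ,
          div_self hZ0.ne', ← hI]
        linarith
    _ ≤ b := by
        rw [ENNReal.ofReal_coe_nnreal]
        exact hab.le

theorem measurable_ofReal_abs_sub (a : ℝ) : Measurable fun z : ℝ => ENNReal.ofReal |z - a| := by
  fun_prop

/-- The product coupling, with the triangle inequality through `a`; nothing finer is needed because
`ν₂` will be nearly a point mass at `a`. -/
theorem wasserstein_le (ν₁ ν₂ : Measure ℝ) [IsProbabilityMeasure ν₁] [IsProbabilityMeasure ν₂]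
    (a : ℝ) : wasserstein ν₁ ν₂ ≤
      ∫⁻ z, ENNReal.ofReal |z - a| ∂ν₁ + ∫⁻ z, ENNReal.ofReal |z - a| ∂ν₂ := by
  have hm := measurable_ofReal_abs_sub a
  refine (iInf₂_le (ν₁.prod ν₂) ⟨Measure.fst_prod, Measure.snd_prod⟩).trans ?_
  have h1 : ∫⁻ z, ENNReal.ofReal |z - a| ∂ν₁ =
      ∫⁻ z : ℝ × ℝ, ENNReal.ofReal |z.1 - a| ∂ν₁.prod ν₂ := by
    rw [← Measure.fst_prod (μ := ν₁) (ν := ν₂), Measure.fst, lintegral_map hm measurable_fst,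
      ← Measure.fst, Measure.fst_prod]
  have h2 : ∫⁻ z, ENNReal.ofReal |z - a| ∂ν₂ =
      ∫⁻ z : ℝ × ℝ, ENNReal.ofReal |z.2 - a| ∂ν₁.prod ν₂ := by
    rw [← Measure.snd_prod (μ := ν₁) (ν := ν₂), Measure.snd, lintegral_map hm measurable_snd,
      ← Measure.snd, Measure.snd_prod]
  have hm1 : Measurable fun z : ℝ × ℝ => ENNReal.ofReal |z.1 - a| := hm.comp measurable_fst
  rw [h1, h2, ← lintegral_add_left hm1]
  refine lintegral_mono fun z => ?_
  rw [← ENNReal.ofReal_add (abs_nonneg _) (abs_nonneg _)]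
  refine ENNReal.ofReal_le_ofReal ?_
  rw [abs_sub_comm z.2 a]
  exact abs_sub_le _ _ _

/-- The triangle inequality through `a` holds under every coupling, so it passes to the infimum. -/
theorem lintegral_le_wasserstein_add (ν₁ ν₂ : Measure ℝ) (a : ℝ) :
    ∫⁻ z, ENNReal.ofReal |z - a| ∂ν₁ ≤
      wasserstein ν₁ ν₂ + ∫⁻ z, ENNReal.ofReal |z - a| ∂ν₂ := by
  have hm := measurable_ofReal_abs_sub a
  have hm2 : Measurable fun z : ℝ × ℝ => ENNReal.ofReal |z.2 - a| := hm.comp measurable_snd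
  rw [← tsub_le_iff_right]
  refine le_iInf₂ fun π hπ => ?_
  rw [tsub_le_iff_right, ← hπ.1, ← hπ.2, Measure.fst, Measure.snd,
    lintegral_map hm measurable_fst, lintegral_map hm measurable_snd,
    ← lintegral_add_right _ hm2]
  refine lintegral_mono fun z => ?_
  rw [← ENNReal.ofReal_add (abs_nonneg _) (abs_nonneg _)]
  exact ENNReal.ofReal_le_ofReal (abs_sub_le _ _ _)

end VelocityJump


/-! ### Conclusion -/

namespace VelocityJump

variable {Ω : Type*} [MeasurableSpace Ω] {P : Measure Ω} {E : ℕ → Ω → ℝ}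
  {U : ℝ → ℝ} {x₀ x₁ x₂ : ℝ}

theorem IsClock.meanHittingTime_ne_top (hE : IsClock P E) (hU : IsDoubleWell U x₀ x₁ x₂) {ε : ℝ}
    (hε : 0 < ε) : meanHittingTime P E U ε x₀ (-1) x₁ ≠ ∞ :=
  ne_top_of_le_ne_top (by simp) (hE.meanHittingTime_bounds hU hε).2

/-- The main theorem for measurable clocks. -/
theorem IsClock.tendsto_wasserstein (hE : IsClock P E) (hU : IsDoubleWell U x₀ x₁ x₂)
    (hlt : U x₂ < U x₀) {t : ℝ} (ht : 0 < t) :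
    Tendsto (fun ε : ℝ => wasserstein (positionLaw P E U ε x₀ (-1)
      (t * (meanHittingTime P E U ε x₀ (-1) x₁).toReal)) (gibbs U ε)) (𝓝[>] 0)
      (𝓝 (ENNReal.ofReal (Real.exp (-t) * |x₂ - x₀|))) := by
  classical
  have := hE.isProb
  have hL : 0 < x₂ - x₀ := sub_pos.2 hU.lt
  set s : ℝ → ℝ := fun ε => t * (meanHittingTime P E U ε x₀ (-1) x₁).toReal with hs
  have hm0 : ∀ ε, 0 ≤ meanRound U x₀ x₁ x₂ ε := fun ε =>
    add_nonneg (integral_nonneg fun x => trappedTime_nonneg _ _ _ _ _ _ _)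
      (integral_nonneg fun x => trappedTime_nonneg _ _ _ _ _ _ _)
  have hsb : ∀ ε, 0 < ε → t * (meanRound U x₀ x₁ x₂ ε * Real.exp ((U x₁ - U x₀) / ε)) ≤ s ε ∧
      s ε ≤ t * (meanRound U x₀ x₁ x₂ ε * Real.exp ((U x₁ - U x₀) / ε) + (x₁ - x₀)) := by
    intro ε hε
    obtain ⟨h1, h2⟩ := hE.meanHittingTime_bounds hU hε
    have hA : 0 ≤ meanRound U x₀ x₁ x₂ ε * Real.exp ((U x₁ - U x₀) / ε) :=
      mul_nonneg (hm0 ε) (Real.exp_pos _).le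
    have hd : 0 ≤ x₁ - x₀ := (sub_pos.2 hU.lt_left).le
    rw [← ENNReal.ofReal_add hA hd] at h2
    exact ⟨mul_le_mul_of_nonneg_left
        ((ENNReal.ofReal_le_iff_le_toReal (hE.meanHittingTime_ne_top hU hε)).1 h1) ht.le,
      mul_le_mul_of_nonneg_left (ENNReal.toReal_le_of_le_ofReal (add_nonneg hA hd) h2) ht.le⟩
  have hs0 : ∀ ε, 0 ≤ s ε := fun ε => mul_nonneg ht.le ENNReal.toReal_nonneg
  set R : ℝ → ℝ≥0∞ := fun ε => ∫⁻ ω, ENNReal.ofReal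
      |(|(process U ε x₀ (-1) (fun k => E k ω) (s ε)).1 - x₂|) -
        (if Trapped U x₀ x₁ x₂ ε (fun k => E k ω) (s ε) then x₂ - x₀ else 0)| ∂P with hR
  set G : ℝ → ℝ≥0∞ := fun ε => ∫⁻ z, ENNReal.ofReal |z - x₂| ∂gibbs U ε with hG
  set A : ℝ → ℝ≥0∞ := fun ε => ENNReal.ofReal
    (P.real {ω | Trapped U x₀ x₁ x₂ ε (fun k => E k ω) (s ε)} * (x₂ - x₀)) with hA
  have hRlim : Tendsto R (𝓝[>] 0) (𝓝 0) :=
    hE.tendsto_lintegral_abs_dist_sub hU hlt ht fun ε hε => ⟨hs0 ε, (hsb ε hε).2⟩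
  have hGlim : Tendsto G (𝓝[>] 0) (𝓝 0) := tendsto_lintegral_gibbs hU hlt
  have hAlim : Tendsto A (𝓝[>] 0) (𝓝 (ENNReal.ofReal (Real.exp (-t) * |x₂ - x₀|))) := by
    rw [abs_of_pos hL]
    exact ENNReal.tendsto_ofReal ((hE.tendsto_trapped hU ht hsb).mul_const _)
  -- The mean distance to `x₂` is within `R` of `A` by localization, and the Wasserstein distance is
  -- within `G` of that mean distance.
  have hmain : ∀ ε, 0 < ε →
      wasserstein (positionLaw P E U ε x₀ (-1) (s ε)) (gibbs U ε) ≤ A ε + (R ε + G ε) ∧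
      A ε ≤ wasserstein (positionLaw P E U ε x₀ (-1) (s ε)) (gibbs U ε) + (R ε + G ε) := by
    intro ε hε
    have hXm := hE.aemeasurable_process hU hε (hs0 ε)
    have hgibbs := isProbabilityMeasure_gibbs hU hlt hε
    have hlaw : IsProbabilityMeasure (positionLaw P E U ε x₀ (-1) (s ε)) :=
      Measure.isProbabilityMeasure_map hXm
    have hX : ∫⁻ z, ENNReal.ofReal |z - x₂| ∂positionLaw P E U ε x₀ (-1) (s ε) =
        ∫⁻ ω, ENNReal.ofReal |(process U ε x₀ (-1) (fun k => E k ω) (s ε)).1 - x₂| ∂P :=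
      lintegral_map' (measurable_ofReal_abs_sub x₂).aemeasurable hXm
    have hTm := hE.measurableSet_trapped hU ε (s ε)
    have hind : Measurable fun ω => ENNReal.ofReal
        (if Trapped U x₀ x₁ x₂ ε (fun k => E k ω) (s ε) then x₂ - x₀ else 0) :=
      (Measurable.ite hTm measurable_const measurable_const).ennreal_ofReal
    have hAeq : A ε = ∫⁻ ω, ENNReal.ofReal
        (if Trapped U x₀ x₁ x₂ ε (fun k => E k ω) (s ε) then x₂ - x₀ else 0) ∂P := by
      rw [hA]
      simp only
      rw [mul_comm, ENNReal.ofReal_mul hL.le, ofReal_measureReal, ← lintegral_indicator_const hTm]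
      refine lintegral_congr fun ω => ?_
      simp only [Set.indicator_apply, Set.mem_ofPred_eq]
      split_ifs <;> simp
    have hle : ∀ x y : ℝ, ENNReal.ofReal x ≤ ENNReal.ofReal y + ENNReal.ofReal |x - y| := by
      intro x y
      refine le_trans (ENNReal.ofReal_le_ofReal ?_) ENNReal.ofReal_add_le
      linarith [le_abs_self (x - y)]
    have h1 : ∫⁻ z, ENNReal.ofReal |z - x₂| ∂positionLaw P E U ε x₀ (-1) (s ε) ≤ A ε + R ε := by
      rw [hX, hAeq, hR, ← lintegral_add_left hind]
      exact lintegral_mono fun ω => hle _ _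
    have h2 : A ε ≤ ∫⁻ z, ENNReal.ofReal |z - x₂| ∂positionLaw P E U ε x₀ (-1) (s ε) + R ε := by
      rw [hX, hAeq, hR, ← lintegral_add_left' (hXm.sub_const x₂).abs.ennreal_ofReal]
      exact lintegral_mono fun ω => (hle _ _).trans_eq (by rw [abs_sub_comm (ite _ _ _)])
    constructor
    · refine (wasserstein_le _ _ x₂).trans ?_
      rw [← add_assoc]
      exact add_le_add_left h1 _
    · refine h2.trans ?_
      rw [add_comm (R ε), ← add_assoc]
      exact add_le_add_left (lintegral_le_wasserstein_add _ _ x₂) _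
  have hRG : Tendsto (fun ε => R ε + G ε) (𝓝[>] 0) (𝓝 0) := by
    simpa using hRlim.add hGlim
  have hlow : Tendsto (fun ε => A ε - (R ε + G ε)) (𝓝[>] 0)
      (𝓝 (ENNReal.ofReal (Real.exp (-t) * |x₂ - x₀|))) := by
    simpa using ENNReal.Tendsto.sub hAlim hRG (Or.inl ENNReal.ofReal_ne_top)
  have hup : Tendsto (fun ε => A ε + (R ε + G ε)) (𝓝[>] 0)
      (𝓝 (ENNReal.ofReal (Real.exp (-t) * |x₂ - x₀|))) := by
    simpa using hAlim.add hRG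
  refine tendsto_of_tendsto_of_tendsto_of_le_of_le' hlow hup ?_ ?_
  · filter_upwards [eventually_mem_nhdsWithin] with ε hε
    exact tsub_le_iff_right.2 (hmain ε hε).2
  · filter_upwards [eventually_mem_nhdsWithin] with ε hε using (hmain ε hε).1

end VelocityJump

theorem mainTheorem10 {Ω : Type*} [MeasurableSpace Ω] (P : Measure Ω) [IsProbabilityMeasure P]
    (E : ℕ → Ω → ℝ) (hE_indep : iIndepFun E P) (hE_law : ∀ k, HasLaw (E k) (expMeasure 1) P)
    (U : ℝ → ℝ) (x₀ x₁ x₂ : ℝ) (hU : IsDoubleWell U x₀ x₁ x₂) (hlt : U x₂ < U x₀)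
    (t : ℝ) (ht : 0 < t) :
    (∀ ε : ℝ, 0 < ε → VelocityJump.meanHittingTime P E U ε x₀ (-1) x₁ ≠ ∞) ∧
      Tendsto
        (fun ε : ℝ =>
          VelocityJump.wasserstein
            (VelocityJump.positionLaw P E U ε x₀ (-1)
              (t * (VelocityJump.meanHittingTime P E U ε x₀ (-1) x₁).toReal))
            (VelocityJump.gibbs U ε))
        (𝓝[>] 0) (𝓝 (ENNReal.ofReal (Real.exp (-t) * |x₂ - x₀|))) := by
  have haem : ∀ k, AEMeasurable (E k) P := fun k => (hE_law k).aemeasurable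
  -- The clocks are only almost everywhere measurable; measurable versions change neither the mean
  -- hitting time nor the law of the position.
  have hclock : VelocityJump.IsClock P fun k => (haem k).mk (E k) :=
    { isProb := inferInstance
      measurable := fun k => (haem k).measurable_mk
      indep := hE_indep.congr fun k => (haem k).ae_eq_mk
      map_eq := fun k => by rw [← Measure.map_congr (haem k).ae_eq_mk, (hE_law k).map_eq] }
  have hae : ∀ᵐ ω ∂P, (fun k => E k ω) = fun k => (haem k).mk (E k) ω := by
    filter_upwards [ae_all_iff.2 fun k => (haem k).ae_eq_mk] with ω hω
    exact funext hω
  have hmean : ∀ ε, VelocityJump.meanHittingTime P E U ε x₀ (-1) x₁ =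
      VelocityJump.meanHittingTime P (fun k => (haem k).mk (E k)) U ε x₀ (-1) x₁ := fun ε =>
    lintegral_congr_ae (hae.mono fun ω hω => by simp only [hω])
  have hlaw : ∀ ε s, VelocityJump.positionLaw P E U ε x₀ (-1) s =
      VelocityJump.positionLaw P (fun k => (haem k).mk (E k)) U ε x₀ (-1) s := fun ε s =>
    Measure.map_congr (hae.mono fun ω hω => by simp only [hω])
  simp only [hmean, hlaw]
  exact ⟨fun ε hε => hclock.meanHittingTime_ne_top hU hε, hclock.tendsto_wasserstein hU hlt ht⟩
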